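/- **Setting.** Let $n\ge 2$, let $U\subset\mathbb R^n$ be a bounded domain with boundary $\Gamma$, let $N\ge 1$ and let $0=\alpha_0<\alpha_1<\dots<\alpha_N$ be real numbers. Put $a=\frac{\alpha_N}{\alpha_N+1}\in(0,1)$ and $\kappa_0=\frac{a}{2-a}+\frac12$. Let $\phi:U\to(0,1]$ and $a_0,\dots,a_N:U\to[0,\infty)$ be measurable with $a_0,a_N>0$ on $U$ and $\int_U a_N\,dx<\infty$. Let $g(x,s)=\sum_{j=0}^N a_j(x)s^{\alpha_j}$ and, for $\xi\ge0$, $K(x,\xi)=1/g(x,s(x,\xi))$, where $s=s(x,\xi)\ge 0$ is the unique solution of $s\,g(x,s)=\xi$. Put $$H(x,\xi)=\int_0^{\xi^2}K(x,\sqrt s)\,ds,\qquad W_1(x)=\frac{a_N(x)^a}{2N\max_{0\le j\le N}a_j(x)},\qquad \|u\|_{L^q_f}=\Big(\int_U f|u|^q\,dx\Big)^{1/q},$$ and $B_*=\max\{\int_U a_N\,dx,1\}$. **Solutions.** A function $u(x,t)$ on $U\times[0,\infty)$ is called *regular* if $u\in C([0,\infty);L^2_\phi)$ and $\nabla u\in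 C([0,\infty);L^2_{1/a_0})$, $u$ is twice differentiable on $(0,\infty)$ with values in $L^2_\phi$, and $\nabla u$ is differentiable on $(0,\infty)$ with values in $L^2_{1/a_0}$, with derivative $\nabla u_t$; here gradients are weak gradients (of locally integrable functions, and locally integrable themselves). Let $p_1,p_2,\Psi_1,\Psi_2$ be regular. For $i=1,2$, assume that $p_i$ is a solution with boundary data $\Psi_i|_\Gamma$, that is, with $\bar p_i=p_i-\Psi_i$, $$\phi\, p_{i,t}=\nabla\cdot(K(x,|\nabla p_i|)\nabla p_i)\ \text{ on }U\times(0,\infty),\qquad \bar p_i=0\ \text{ on }\Gamma\times(0,\infty).$$ The equation is understood weakly in $x$ for each $t>0$, against $\eta\in C_c^\infty(U)$ with $\nabla\eta\in L^2_{1/a_0}$; the boundary condition means that, for each $t>0$, $(\bar p_i,\nabla\bar p_i)(t)$ is a limit in $L^2_\phi\times L^2_{1/a_0}$ of pairs $(\eta,\nabla\eta)$ with such $\eta$. Put $\Phi=\Psi_1-\Psi_2$ and $\bar P=\bar p_1-\bar p_2$. Assume that for some constant $c_P>0$ the inequality $$\|u\|_{L^2_\phi}\le c_P\|\nabla u\|_{L^{2-a}_{W_1}}$$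 holds for $u=\bar p_1(t),\ \bar p_2(t),\ \bar P(t)$ and all $t>0$. **Quantities.** For $\Psi=\Psi_1,\Psi_2$ let $$G[\Psi](t)=B_*+\int_U a_0^{-1}|\nabla\Psi|^2dx+\int_U W_1|\nabla\Psi|^{2-a}dx+\Big(\int_U|\Psi_t|^2\phi\,dx\Big)^{\frac{2-a}{2(1-a)}},$$ $$G_1[\Psi](t)=\int_U a_0^{-1}|\nabla\Psi_t|^2dx,\qquad G_2[\Psi](t)=\int_U|\Psi_{tt}|^2\phi\,dx,$$ and assume that these are continuous functions of $t\in[0,\infty)$. Let $$D(t)=\int_U a_0^{-1}|\nabla\Phi|^2dx+\Big(\int_U a_0^{-1}|\nabla\Phi|^2dx\Big)^{\frac12}+\Big(\int_U|\Phi_t|^2\phi\,dx\Big)^{\frac12},$$ $$\mathcal H_0=\sum_{i=1}^2\int_U H(x,|\nabla p_i(x,0)|)\,dx,\quad \bar{\mathcal P}_0=\sum_{i=1}^2\int_U\bar p_i(x,0)^2\phi\,dx,\quad \tilde G_k=G_k[\Psi_1]+G_k[\Psi_2]\ (k=1,2).$$ Given continuous increasing functions $\mathcal M[\Psi_i]$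 on $[0,\infty)$ with $\mathcal M[\Psi_i]\ge G[\Psi_i]$, let $\tilde{\mathcal M}=\mathcal M[\Psi_1]+\mathcal M[\Psi_2]$ and, for $t_0\in(0,1]$, $$\mathcal M_1(t)=\mathcal H_0+\bar{\mathcal P}_0+\tilde{\mathcal M}(t)^{\frac2{2-a}}+\sup_{[0,t]}\tilde G_1,\qquad \mathcal M_2(t)=t_0^{-1}(\mathcal H_0+\bar{\mathcal P}_0)+\tilde{\mathcal M}(t)^{\frac2{2-a}}+\sup_{[0,t]}(\tilde G_1+\tilde G_2).$$ Finally let $\tilde{\mathcal A}=\sum_{i}\limsup_{t\to\infty}G[\Psi_i](t)$, $\mathcal G_k=\sum_i\limsup_{t\to\infty}G_k[\Psi_i](t)$ for $k=1,2$, and $\mathcal D=\limsup_{t\to\infty}D(t)$, all in $[0,\infty]$. **Theorem.** There are constants $C,d_4>0$ depending only on $n$, $U$, $N$, $\alpha_0,\dots,\alpha_N$ and $c_P$ (not on $\phi$, the functions $a_j$, the solutions, the data $\Psi_i$, the functions $\mathcal M[\Psi_i]$ or $t_0$) such that, in the above setting, the following hold. (i) For all $t_0\in(0,1]$ and $t\ge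 t_0$, $$\|\nabla\bar P(t)\|_{L^{2-a}_{W_1}}^2\le C\mathcal M_2(t)^{\kappa_0}\Big(e^{-d_4\int_0^t\mathcal M_1(\tau)^{-\frac a{2-a}}d\tau}\|\bar P(0)\|_{L^2_\phi}^2+D(t)^2+\int_0^te^{-d_4\int_s^t\mathcal M_1(\tau)^{-\frac a{2-a}}d\tau}\mathcal M_1(s)^{\frac12}D(s)\,ds\Big)^{\frac12}.$$ (ii) If $\mathcal D>0$, or if $\tilde{\mathcal A},\mathcal G_1,\mathcal G_2<\infty$ (so that the right-hand side below is not of the form $\infty\cdot 0$), then $$\limsup_{t\to\infty}\|\nabla\bar P(t)\|_{L^{2-a}_{W_1}}^2\le C\Big[\big(\tilde{\mathcal A}^{\frac2{2-a}}+\mathcal G_1+\mathcal G_2\big)^{3\kappa_0}\mathcal D\Big]^{\frac12}+C\big(\tilde{\mathcal A}^{\frac2{2-a}}+\mathcal G_1\big)^{\kappa_0}\mathcal D.$$ -/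

import Mathlib

open MeasureTheory Filter Set
open scoped ENNReal Topology ContDiff RealInnerProductSpace

noncomputable section

namespace Forchheimer

/-! ### The Forchheimer polynomial, the function `K` and the function `H` -/

/-- The generalized polynomial `g(s) = c₀ s^{α₀} + ⋯ + c_N s^{α_N}`. -/
def forchPoly {N : ℕ} (α c : Fin (N + 1) → ℝ) (s : ℝ) : ℝ :=
  ∑ j, c j * s ^ α j

/-- The non-negative solution `s` of `s g(s) = ξ`
(it exists and is unique by `existsUnique_forchRoot`). -/
def forchRoot {N : ℕ} (α c : Fin (N + 1) → ℝ) (ξ : ℝ) : ℝ :=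
  Classical.epsilon fun s : ℝ => 0 ≤ s ∧ s * forchPoly α c s = ξ

/-- `K(ξ) = 1 / g(s(ξ))`. -/
def forchK {N : ℕ} (α c : Fin (N + 1) → ℝ) (ξ : ℝ) : ℝ :=
  1 / forchPoly α c (forchRoot α c ξ)

/-- `H(ξ) = ∫₀^{ξ²} K(√s) ds`. -/
def forchH {N : ℕ} (α c : Fin (N + 1) → ℝ) (ξ : ℝ) : ℝ :=
  ∫ s in (0 : ℝ)..ξ ^ 2, forchK α c (Real.sqrt s)

/-- The exponent `a = α_N / (α_N + 1)`. -/
def expA {N : ℕ} (α : Fin (N + 1) → ℝ) : ℝ :=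
  α (Fin.last N) / (α (Fin.last N) + 1)

/-- `κ₀ = a / (2 - a) + 1 / 2`. -/
def kappa {N : ℕ} (α : Fin (N + 1) → ℝ) : ℝ :=
  expA α / (2 - expA α) + 1 / 2

theorem existsUnique_forchRoot {N : ℕ} {α c : Fin (N + 1) → ℝ} (h0 : α 0 = 0)
    (hα : StrictMono α) (hc : ∀ j, 0 ≤ c j) (hc0 : 0 < c 0) {ξ : ℝ} (hξ : 0 ≤ ξ) :
    ∃! s : ℝ, 0 ≤ s ∧ s * forchPoly α c s = ξ := by
  have hα0 : ∀ j, 0 ≤ α j := fun j => h0 ▸ hα.monotone (Fin.zero_le j)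
  have hmono : ∀ s t : ℝ, 0 ≤ s → s ≤ t → forchPoly α c s ≤ forchPoly α c t := by
    intro s t hs hst
    exact Finset.sum_le_sum fun j _ =>
      mul_le_mul_of_nonneg_left (Real.rpow_le_rpow hs hst (hα0 j)) (hc j)
  have hlow : ∀ s : ℝ, 0 ≤ s → c 0 ≤ forchPoly α c s := by
    intro s hs
    have h := Finset.single_le_sum (f := fun j => c j * s ^ α j)
      (fun j _ => mul_nonneg (hc j) (Real.rpow_nonneg hs _)) (Finset.mem_univ 0)
    simpa [forchPoly, h0] using h
  have hcont : Continuous fun s : ℝ => s * forchPoly α c s := by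
    unfold forchPoly
    exact continuous_id.mul (continuous_finsetSum _ fun j _ =>
      continuous_const.mul (Real.continuous_rpow_const (hα0 j)))
  have hstrict : ∀ s t : ℝ, 0 ≤ s → s < t →
      s * forchPoly α c s < t * forchPoly α c t := by
    intro s t hs hst
    have h1 := hmono s t hs hst.le
    have h2 := hlow t (hs.trans hst.le)
    nlinarith
  have hmem : ξ ∈ Icc ((0 : ℝ) * forchPoly α c 0) ((ξ / c 0) * forchPoly α c (ξ / c 0)) := by
    constructor
    · simpa using hξ
    · have h1 := hlow (ξ / c 0) (by positivity)
      have h2 : ξ / c 0 * c 0 = ξ := by field_simp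
      have h3 : 0 ≤ ξ / c 0 := by positivity
      nlinarith
  obtain ⟨s, hs, hse⟩ := intermediate_value_Icc (by positivity) hcont.continuousOn hmem
  refine ⟨s, ⟨hs.1, hse⟩, ?_⟩
  rintro t ⟨ht, hte⟩
  rcases lt_trichotomy t s with h | h | h
  · have := hstrict t s ht h
    simp only at hse
    linarith
  · exact h
  · have := hstrict s t hs.1 h
    simp only at hse
    linarith

theorem forchRoot_spec {N : ℕ} {α c : Fin (N + 1) → ℝ} (h0 : α 0 = 0)
    (hα : StrictMono α) (hc : ∀ j, 0 ≤ c j) (hc0 : 0 < c 0) {ξ : ℝ} (hξ : 0 ≤ ξ) :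
    0 ≤ forchRoot α c ξ ∧ forchRoot α c ξ * forchPoly α c (forchRoot α c ξ) = ξ :=
  Classical.epsilon_spec (p := fun s : ℝ => 0 ≤ s ∧ s * forchPoly α c s = ξ)
    (existsUnique_forchRoot h0 hα hc hc0 hξ).exists

/-! ### The heterogeneous medium -/

/-- The porosity `φ` and the coefficient functions `a₀, …, a_N` on `U`.
Values outside `U` play no role. -/
structure Medium {n : ℕ} (U : Set (EuclideanSpace ℝ (Fin n))) {N : ℕ}
    (α : Fin (N + 1) → ℝ) where
  /-- the porosity -/
  phi : EuclideanSpace ℝ (Fin n) → ℝ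
  /-- the coefficient functions -/
  coef : Fin (N + 1) → EuclideanSpace ℝ (Fin n) → ℝ
  measurable_phi : Measurable phi
  measurable_coef : ∀ j, Measurable (coef j)
  phi_mem : ∀ x ∈ U, phi x ∈ Ioc (0 : ℝ) 1
  coef_nonneg : ∀ j, ∀ x ∈ U, 0 ≤ coef j x
  coef_zero_pos : ∀ x ∈ U, 0 < coef 0 x
  coef_last_pos : ∀ x ∈ U, 0 < coef (Fin.last N) x
  integrable_coef_last : IntegrableOn (coef (Fin.last N)) U volume

namespace Medium

variable {n : ℕ} {U : Set (EuclideanSpace ℝ (Fin n))} {N : ℕ} {α : Fin (N + 1) → ℝ}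

/-- `K(x, ξ)`. -/
def K (m : Medium U α) (x : EuclideanSpace ℝ (Fin n)) (ξ : ℝ) : ℝ :=
  forchK α (fun j => m.coef j x) ξ

/-- `H(x, ξ)`. -/
def H (m : Medium U α) (x : EuclideanSpace ℝ (Fin n)) (ξ : ℝ) : ℝ :=
  forchH α (fun j => m.coef j x) ξ

/-- `M(x) = max_j a_j(x)`. -/
def coefMax (m : Medium U α) (x : EuclideanSpace ℝ (Fin n)) : ℝ :=
  Finset.univ.sup' Finset.univ_nonempty fun j => m.coef j x

/-- `W₁(x) = a_N(x)^a / (2 N M(x))`. -/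
def W1 (m : Medium U α) (x : EuclideanSpace ℝ (Fin n)) : ℝ :=
  m.coef (Fin.last N) x ^ expA α / (2 * N * m.coefMax x)

/-- The measure `φ(x) dx` on `U`. -/
def muPhi (m : Medium U α) : Measure (EuclideanSpace ℝ (Fin n)) :=
  (volume.restrict U).withDensity fun x => ENNReal.ofReal (m.phi x)

/-- The measure `a₀(x)⁻¹ dx` on `U`. -/
def muA (m : Medium U α) : Measure (EuclideanSpace ℝ (Fin n)) :=
  (volume.restrict U).withDensity fun x => ENNReal.ofReal ((m.coef 0 x)⁻¹)

/-- The weighted space `L²_φ(U)`. -/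
abbrev L2Phi (m : Medium U α) : Type := Lp ℝ 2 m.muPhi

/-- The weighted space `L²_{1/a₀}(U)` of vector fields. -/
abbrev L2A (m : Medium U α) : Type := Lp (EuclideanSpace ℝ (Fin n)) 2 m.muA

end Medium

/-! ### Weak gradients, test functions, boundary values -/

/-- `η ∈ C_c^∞(U)`. -/
def IsTestFunction {n : ℕ} (U : Set (EuclideanSpace ℝ (Fin n)))
    (η : EuclideanSpace ℝ (Fin n) → ℝ) : Prop :=
  ContDiff ℝ ∞ η ∧ HasCompactSupport η ∧ tsupport η ⊆ U

/-- `v` is the weak (distributional) gradient of `u` on `U`. -/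
def HasWeakGradient {n : ℕ} (U : Set (EuclideanSpace ℝ (Fin n)))
    (u : EuclideanSpace ℝ (Fin n) → ℝ)
    (v : EuclideanSpace ℝ (Fin n) → EuclideanSpace ℝ (Fin n)) : Prop :=
  LocallyIntegrableOn u U volume ∧ LocallyIntegrableOn v U volume ∧
    ∀ η, IsTestFunction U η →
      ∫ x in U, u x • gradient η x = -∫ x in U, η x • v x

section Solutions

variable {n : ℕ} {U : Set (EuclideanSpace ℝ (Fin n))} {N : ℕ} {α : Fin (N + 1) → ℝ}

/-- Test functions whose gradient has finite `L²_{1/a₀}` norm. If `1/a₀` is locally integrable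
on `U`, these are all test functions. -/
def IsAdmissibleTest (m : Medium U α) (η : EuclideanSpace ℝ (Fin n) → ℝ) : Prop :=
  IsTestFunction U η ∧ MemLp (gradient η) 2 m.muA

/-- `u`, with gradient `v`, vanishes on the boundary of `U`: the pair `(u, v)` is the limit in
`L²_φ × L²_{1/a₀}` of pairs `(η, ∇η)` with `η ∈ C_c^∞(U)`. -/
def VanishesOnBoundary (m : Medium U α) (u : m.L2Phi) (v : m.L2A) : Prop :=
  (u, v) ∈ closure {w : m.L2Phi × m.L2A | ∃ η, IsAdmissibleTest m η ∧
    w.1 =ᵐ[volume.restrict U] η ∧ w.2 =ᵐ[volume.restrict U] gradient η}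

/-- A function `u(x,t)` on `U × [0,∞)` with `u ∈ C([0,∞); L²_φ)`, `∇u ∈ C([0,∞); L²_{1/a₀})`
(`∇` is the weak gradient), `u` twice differentiable on `(0,∞)` in `L²_φ`, and `∇u`
differentiable on `(0,∞)` in `L²_{1/a₀}`, with `∂ₜ∇u = ∇uₜ`. The values at `t = 0` of the
fields for time derivatives are not constrained here. -/
structure RegularPath (m : Medium U α) where
  /-- `u(·,t)` -/
  val : ℝ → m.L2Phi
  /-- `∇u(·,t)` -/
  grad : ℝ → m.L2A
  /-- `uₜ(·,t)` -/
  dval : ℝ → m.L2Phi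
  /-- `∇uₜ(·,t)` -/
  dgrad : ℝ → m.L2A
  /-- `uₜₜ(·,t)` -/
  ddval : ℝ → m.L2Phi
  hasWeakGradient : ∀ t, 0 ≤ t → HasWeakGradient U (val t) (grad t)
  hasWeakGradient_deriv : ∀ t, 0 < t → HasWeakGradient U (dval t) (dgrad t)
  continuousOn_val : ContinuousOn val (Ici 0)
  continuousOn_grad : ContinuousOn grad (Ici 0)
  hasDerivAt_val : ∀ t, 0 < t → HasDerivAt val (dval t) t
  hasDerivAt_grad : ∀ t, 0 < t → HasDerivAt grad (dgrad t) t
  hasDerivAt_dval : ∀ t, 0 < t → HasDerivAt dval (ddval t) t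

/-- `φ pₜ = ∇ · (K(x,|∇p|) ∇p)` on `U × (0,∞)`, in the weak sense in `x` at each time. -/
def SolvesEquation (m : Medium U α) (p : RegularPath m) : Prop :=
  ∀ t, 0 < t → ∀ η, IsAdmissibleTest m η →
    ∫ x in U, m.phi x * p.dval t x * η x =
      -∫ x in U, m.K x ‖p.grad t x‖ * ⟪p.grad t x, gradient η x⟫

/-- `p` solves the equation, and `p = Ψ` on `∂U × (0,∞)`. -/
def IsSolution (m : Medium U α) (p Ψ : RegularPath m) : Prop :=
  SolvesEquation m p ∧
    ∀ t, 0 < t → VanishesOnBoundary m (p.val t - Ψ.val t) (p.grad t - Ψ.grad t)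

/-! ### Norms and the quantities built from the data -/

/-- The weighted norm `‖u‖_{L^q_f(U)} = (∫_U f |u|^q dx)^{1/q}`. -/
def wNorm {F : Type*} [NormedAddCommGroup F] (U : Set (EuclideanSpace ℝ (Fin n)))
    (f : EuclideanSpace ℝ (Fin n) → ℝ) (q : ℝ) (u : EuclideanSpace ℝ (Fin n) → F) : ℝ :=
  (∫ x in U, f x * ‖u x‖ ^ q) ^ (1 / q)

/-- The two-weight Poincaré–Sobolev inequality with constant `c` for `u` with gradient `v`. -/
def PoincareSobolev (m : Medium U α) (c : ℝ) (u : m.L2Phi) (v : m.L2A) : Prop :=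
  wNorm U m.phi 2 u ≤ c * wNorm U m.W1 (2 - expA α) v

/-- `B_* = max {∫_U a_N dx, 1}`. -/
def Bstar (m : Medium U α) : ℝ :=
  max (∫ x in U, m.coef (Fin.last N) x) 1

/-- `G[Ψ](t)`. -/
def G (m : Medium U α) (Ψ : RegularPath m) (t : ℝ) : ℝ :=
  Bstar m + (∫ x in U, (m.coef 0 x)⁻¹ * ‖Ψ.grad t x‖ ^ 2)
    + (∫ x in U, m.W1 x * ‖Ψ.grad t x‖ ^ (2 - expA α))
    + (∫ x in U, (Ψ.dval t x) ^ 2 * m.phi x) ^ ((2 - expA α) / (2 * (1 - expA α)))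

/-- `G₁[Ψ](t) = ∫_U a₀⁻¹ |∇Ψₜ|² dx`. -/
def G1 (m : Medium U α) (Ψ : RegularPath m) (t : ℝ) : ℝ :=
  ∫ x in U, (m.coef 0 x)⁻¹ * ‖Ψ.dgrad t x‖ ^ 2

/-- `G₂[Ψ](t) = ∫_U |Ψₜₜ|² φ dx`. -/
def G2 (m : Medium U α) (Ψ : RegularPath m) (t : ℝ) : ℝ :=
  ∫ x in U, (Ψ.ddval t x) ^ 2 * m.phi x

/-- `M` is a continuous increasing function on `[0,∞)` with `M ≥ g`. -/
def IsMajorant (M g : ℝ → ℝ) : Prop :=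
  ContinuousOn M (Ici 0) ∧ MonotoneOn M (Ici 0) ∧ ∀ t, 0 ≤ t → g t ≤ M t

/-- `D(t)`, with `Φ = Ψ₁ - Ψ₂`. -/
def D (m : Medium U α) (Ψ₁ Ψ₂ : RegularPath m) (t : ℝ) : ℝ :=
  (∫ x in U, (m.coef 0 x)⁻¹ * ‖(Ψ₁.grad t - Ψ₂.grad t) x‖ ^ 2)
    + (∫ x in U, (m.coef 0 x)⁻¹ * ‖(Ψ₁.grad t - Ψ₂.grad t) x‖ ^ 2) ^ (1 / 2 : ℝ)
    + (∫ x in U, ((Ψ₁.dval t - Ψ₂.dval t) x) ^ 2 * m.phi x) ^ (1 / 2 : ℝ)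

/-- `P̄(t) = (p₁ - Ψ₁)(t) - (p₂ - Ψ₂)(t)`. -/
def Pbar {m : Medium U α} (p₁ Ψ₁ p₂ Ψ₂ : RegularPath m) (t : ℝ) : m.L2Phi :=
  (p₁.val t - Ψ₁.val t) - (p₂.val t - Ψ₂.val t)

/-- `∇P̄(t)`. -/
def gradPbar {m : Medium U α} (p₁ Ψ₁ p₂ Ψ₂ : RegularPath m) (t : ℝ) : m.L2A :=
  (p₁.grad t - Ψ₁.grad t) - (p₂.grad t - Ψ₂.grad t)

/-- `𝒫̄₀ = ∑ᵢ ∫_U p̄ᵢ(x,0)² φ dx`. -/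
def P0 (m : Medium U α) (p₁ Ψ₁ p₂ Ψ₂ : RegularPath m) : ℝ :=
  (∫ x in U, ((p₁.val 0 - Ψ₁.val 0) x) ^ 2 * m.phi x)
    + (∫ x in U, ((p₂.val 0 - Ψ₂.val 0) x) ^ 2 * m.phi x)

/-- `ℋ₀ = ∑ᵢ ∫_U H(x,|∇pᵢ(x,0)|) dx`. -/
def H0 (m : Medium U α) (p₁ p₂ : RegularPath m) : ℝ :=
  (∫ x in U, m.H x ‖p₁.grad 0 x‖) + (∫ x in U, m.H x ‖p₂.grad 0 x‖)

/-- `ℳ₁(t) = ℋ₀ + 𝒫̄₀ + ℳ̃(t)^{2/(2-a)} + sup_{[0,t]} G̃₁`, where `ℳ̃ = M₁ + M₂`. -/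
def calM1 (m : Medium U α) (p₁ Ψ₁ p₂ Ψ₂ : RegularPath m) (M₁ M₂ : ℝ → ℝ) (t : ℝ) : ℝ :=
  H0 m p₁ p₂ + P0 m p₁ Ψ₁ p₂ Ψ₂ + (M₁ t + M₂ t) ^ (2 / (2 - expA α))
    + sSup ((fun τ => G1 m Ψ₁ τ + G1 m Ψ₂ τ) '' Icc 0 t)

/-- `ℳ₂(t) = t₀⁻¹(ℋ₀ + 𝒫̄₀) + ℳ̃(t)^{2/(2-a)} + sup_{[0,t]} (G̃₁ + G̃₂)`. -/
def calM2 (m : Medium U α) (p₁ Ψ₁ p₂ Ψ₂ : RegularPath m) (M₁ M₂ : ℝ → ℝ) (t₀ t : ℝ) : ℝ :=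
  t₀⁻¹ * (H0 m p₁ p₂ + P0 m p₁ Ψ₁ p₂ Ψ₂) + (M₁ t + M₂ t) ^ (2 / (2 - expA α))
    + sSup ((fun τ => (G1 m Ψ₁ τ + G1 m Ψ₂ τ) + (G2 m Ψ₁ τ + G2 m Ψ₂ τ)) '' Icc 0 t)

/-- `limsup_{t → ∞} f(t)` of a non-negative function, in `[0,∞]`. -/
def limsupInfty (f : ℝ → ℝ) : ℝ≥0∞ :=
  limsup (fun t => ENNReal.ofReal (f t)) atTop

end Solutions

end Forchheimer

end

open Forchheimer

/-
The flux `y ↦ K(x, |y|) y` is monotone with the degenerate modulus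
`K(x, max(|y|, |z|)) |y - z|² ≤ C ⟨flux y - flux z, y - z⟩`, and it is cocoercive with constant
`a₀`. Testing the equation for `pᵢ` with `p̄ᵢ` and with `p̄ᵢ,ₜ` controls the energy
`∫ H(x, |∇pᵢ|) + ‖p̄ᵢ‖²`; cocoercivity, applied to time differences, controls `‖p̄ᵢ,ₜ‖²` from a
positive time on, and the Poincaré–Sobolev inequality turns the dissipation into decay.

For `P̄`, Hölder's inequality with `W₁ ≤ K(x, ξ) max(ξ, a_N)^a`, `ξ = max(|∇p₁|, |∇p₂|)`, bounds
`‖∇P̄‖²` by `ℳ₁^{a/(2-a)} (⟨flux ∇p₁ - flux ∇p₂, ∇p₁ - ∇p₂⟩ + ‖∇Φ‖²)`. With the Poincaré–Sobolev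
inequality this gives `(‖P̄‖²)' ≤ -c ℳ₁^{-a/(2-a)} ‖P̄‖² + C ℳ₁^{1/2} D`, which Gronwall's
inequality integrates. The equation bounds the same pairing of fluxes at a fixed time by
`‖p₁,ₜ - p₂,ₜ‖ ‖P̄‖ + D`, up to a constant, whence the gradient estimate. For large times the data
are replaced by their limits superior plus `ε`.
-/

namespace Forchheimer

section Exponents

/-- The exponents `0 = α₀ < α₁ < ⋯ < α_N`, `N ≥ 1`, of a Forchheimer polynomial. -/
structure IsForchExponents {N : ℕ} (α : Fin (N + 1) → ℝ) : Prop where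
  one_le : 1 ≤ N
  zero : α 0 = 0
  strictMono : StrictMono α

namespace IsForchExponents

variable {N : ℕ} {α : Fin (N + 1) → ℝ}

theorem nonneg (hα : IsForchExponents α) (j : Fin (N + 1)) : 0 ≤ α j :=
  hα.zero ▸ hα.strictMono.monotone (Fin.zero_le j)

theorem le_last (hα : IsForchExponents α) (j : Fin (N + 1)) : α j ≤ α (Fin.last N) :=
  hα.strictMono.monotone (Fin.le_last j)

theorem last_pos (hα : IsForchExponents α) : 0 < α (Fin.last N) :=
  hα.zero ▸ hα.strictMono (Fin.lt_def.2 (Nat.pos_of_ne_zero (Nat.one_le_iff_ne_zero.1 hα.one_le)))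

theorem expA_pos (hα : IsForchExponents α) : 0 < expA α :=
  div_pos hα.last_pos (by linarith [hα.last_pos])

theorem expA_lt_one (hα : IsForchExponents α) : expA α < 1 :=
  (div_lt_one (by linarith [hα.last_pos])).2 (by linarith)

end IsForchExponents

end Exponents

theorem one_sub_rpow_le {r A : ℝ} (hr : 0 < r) (hr1 : r ≤ 1) :
    1 - r ^ A ≤ max 1 A * (1 - r) := by
  rcases le_total 1 A with hA | hA
  · have bernoulli := one_add_mul_self_le_rpow_one_add (s := r - 1) (by linarith) hA
    rw [add_sub_cancel] at bernoulli
    rw [max_eq_right hA]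
    linarith
  · have : r ^ (1 : ℝ) ≤ r ^ A := Real.rpow_le_rpow_of_exponent_ge hr hr1 hA
    rw [Real.rpow_one] at this
    rw [max_eq_left hA]
    linarith

section InnerProductSpace

variable {E : Type*} [NormedAddCommGroup E] [InnerProductSpace ℝ E]

theorem inner_sub_smul_sub_smul (A B : ℝ) (w v : E) :
    ⟪w - v, A • w - B • v⟫ =
      (A + B) / 2 * ‖w - v‖ ^ 2 + (A - B) / 2 * (‖w‖ ^ 2 - ‖v‖ ^ 2) := by
  rw [norm_sub_sq_real]
  simp only [inner_sub_left, inner_sub_right, real_inner_smul_right, real_inner_self_eq_norm_sq,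
    real_inner_comm w v]
  ring

theorem norm_smul_sub_smul_sq (A B : ℝ) (w v : E) :
    ‖A • w - B • v‖ ^ 2 =
      A * B * ‖w - v‖ ^ 2 + (A - B) * (A * ‖w‖ ^ 2 - B * ‖v‖ ^ 2) := by
  rw [norm_sub_sq_real, norm_sub_sq_real]
  simp only [real_inner_smul_right, real_inner_smul_left, norm_smul, mul_pow, Real.norm_eq_abs,
    sq_abs]
  ring

end InnerProductSpace

/-- Exponents and coefficients `c₀ > 0`, `c₁, …, c_N ≥ 0` of a Forchheimer polynomial. -/
structure IsForch {N : ℕ} (α c : Fin (N + 1) → ℝ) : Prop extends IsForchExponents α where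
  coeff_nonneg : ∀ j, 0 ≤ c j
  coeff_zero_pos : 0 < c 0

/-- The flux `K(|y|) y`. -/
noncomputable def flux {E : Type*} [NormedAddCommGroup E] [InnerProductSpace ℝ E]
    {N : ℕ} (α c : Fin (N + 1) → ℝ) (y : E) : E :=
  forchK α c ‖y‖ • y

/-- The weight `c_N^a / (2 N max_j c_j)`, whose value at the coefficients of a medium is `W₁`. -/
noncomputable def forchWeight {N : ℕ} (α c : Fin (N + 1) → ℝ) : ℝ :=
  c (Fin.last N) ^ expA α / (2 * N * Finset.univ.sup' Finset.univ_nonempty c)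

/-- The constant in the degenerate monotonicity of the flux. -/
noncomputable def fluxConst {N : ℕ} (α : Fin (N + 1) → ℝ) : ℝ :=
  2 + 2 * max 1 (α (Fin.last N))

theorem fluxConst_pos {N : ℕ} (α : Fin (N + 1) → ℝ) : 0 < fluxConst α := by
  unfold fluxConst
  positivity

namespace IsForch

variable {N : ℕ} {α c : Fin (N + 1) → ℝ}

section Root

theorem poly_mono (h : IsForch α c) {s t : ℝ} (hs : 0 ≤ s) (hst : s ≤ t) :
    forchPoly α c s ≤ forchPoly α c t :=
  Finset.sum_le_sum fun j _ =>
    mul_le_mul_of_nonneg_left (Real.rpow_le_rpow hs hst (h.nonneg j)) (h.coeff_nonneg j)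

theorem coeff_mul_rpow_le_poly (h : IsForch α c) {s : ℝ} (hs : 0 ≤ s) (j : Fin (N + 1)) :
    c j * s ^ α j ≤ forchPoly α c s :=
  Finset.single_le_sum (f := fun j => c j * s ^ α j)
    (fun j _ => mul_nonneg (h.coeff_nonneg j) (Real.rpow_nonneg hs _)) (Finset.mem_univ j)

theorem coeff_zero_le_poly (h : IsForch α c) {s : ℝ} (hs : 0 ≤ s) : c 0 ≤ forchPoly α c s := by
  simpa [h.zero] using h.coeff_mul_rpow_le_poly hs 0

theorem poly_pos (h : IsForch α c) {s : ℝ} (hs : 0 ≤ s) : 0 < forchPoly α c s :=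
  h.coeff_zero_pos.trans_le (h.coeff_zero_le_poly hs)

theorem continuous_poly (h : IsForch α c) : Continuous (forchPoly α c) :=
  continuous_finsetSum _ fun j _ => continuous_const.mul (Real.continuous_rpow_const (h.nonneg j))

theorem poly_sub_mul_sq_sub_nonneg (h : IsForch α c) {s t : ℝ} (hs : 0 ≤ s) (ht : 0 ≤ t) :
    0 ≤ (forchPoly α c s - forchPoly α c t) * (s ^ 2 - t ^ 2) := by
  rcases le_total s t with hle | hle
  · exact mul_nonneg_of_nonpos_of_nonpos (sub_nonpos.2 (h.poly_mono hs hle))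
      (sub_nonpos.2 (by gcongr))
  · exact mul_nonneg (sub_nonneg.2 (h.poly_mono ht hle)) (sub_nonneg.2 (by gcongr))

theorem root_nonneg (h : IsForch α c) {ξ : ℝ} (hξ : 0 ≤ ξ) : 0 ≤ forchRoot α c ξ :=
  (forchRoot_spec h.zero h.strictMono h.coeff_nonneg h.coeff_zero_pos hξ).1

theorem root_mul_poly (h : IsForch α c) {ξ : ℝ} (hξ : 0 ≤ ξ) :
    forchRoot α c ξ * forchPoly α c (forchRoot α c ξ) = ξ :=
  (forchRoot_spec h.zero h.strictMono h.coeff_nonneg h.coeff_zero_pos hξ).2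

theorem root_le_iff (h : IsForch α c) {ξ r : ℝ} (hξ : 0 ≤ ξ) (hr : 0 ≤ r) :
    forchRoot α c ξ ≤ r ↔ ξ ≤ r * forchPoly α c r := by
  have hroot := h.root_nonneg hξ
  constructor
  · intro hle
    rw [← h.root_mul_poly hξ]
    exact mul_le_mul hle (h.poly_mono hroot hle) (h.poly_pos hroot).le hr
  · contrapose!
    intro hlt
    rw [← h.root_mul_poly hξ]
    exact mul_lt_mul hlt (h.poly_mono hr hlt.le) (h.poly_pos hr) hroot

theorem root_mono (h : IsForch α c) {ξ η : ℝ} (hξ : 0 ≤ ξ) (hη : ξ ≤ η) :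
    forchRoot α c ξ ≤ forchRoot α c η := by
  rwa [h.root_le_iff hξ (h.root_nonneg (hξ.trans hη)), h.root_mul_poly (hξ.trans hη)]

theorem K_pos (h : IsForch α c) {ξ : ℝ} (hξ : 0 ≤ ξ) : 0 < forchK α c ξ :=
  one_div_pos.2 (h.poly_pos (h.root_nonneg hξ))

theorem K_mul_poly (h : IsForch α c) {ξ : ℝ} (hξ : 0 ≤ ξ) :
    forchK α c ξ * forchPoly α c (forchRoot α c ξ) = 1 :=
  one_div_mul_cancel (h.poly_pos (h.root_nonneg hξ)).ne'

theorem K_mul_self (h : IsForch α c) {ξ : ℝ} (hξ : 0 ≤ ξ) :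
    forchK α c ξ * ξ = forchRoot α c ξ := by
  linear_combination forchRoot α c ξ * h.K_mul_poly hξ - forchK α c ξ * h.root_mul_poly hξ

theorem coeff_zero_mul_K_le_one (h : IsForch α c) {ξ : ℝ} (hξ : 0 ≤ ξ) :
    c 0 * forchK α c ξ ≤ 1 := by
  rw [← h.K_mul_poly hξ, mul_comm]
  exact mul_le_mul_of_nonneg_left (h.coeff_zero_le_poly (h.root_nonneg hξ)) (h.K_pos hξ).le

theorem K_anti (h : IsForch α c) {ξ η : ℝ} (hξ : 0 ≤ ξ) (hη : ξ ≤ η) :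
    forchK α c η ≤ forchK α c ξ :=
  one_div_le_one_div_of_le (h.poly_pos (h.root_nonneg hξ))
    (h.poly_mono (h.root_nonneg hξ) (h.root_mono hξ hη))

end Root

section Flux

variable {E : Type*} [NormedAddCommGroup E] [InnerProductSpace ℝ E]

theorem norm_flux (h : IsForch α c) (y : E) : ‖flux α c y‖ = forchRoot α c ‖y‖ := by
  rw [flux, norm_smul, Real.norm_of_nonneg (h.K_pos (norm_nonneg y)).le,
    h.K_mul_self (norm_nonneg y)]

theorem poly_smul_flux (h : IsForch α c) (y : E) :
    forchPoly α c ‖flux α c y‖ • flux α c y = y := by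
  rw [h.norm_flux, flux, smul_smul, mul_comm, h.K_mul_poly (norm_nonneg y), one_smul]

theorem flux_cocoercive (h : IsForch α c) (y z : E) :
    c 0 * ‖flux α c y - flux α c z‖ ^ 2 ≤ ⟪flux α c y - flux α c z, y - z⟫ := by
  set w := flux α c y with hw
  set v := flux α c z with hv
  have hyz : y - z = forchPoly α c ‖w‖ • w - forchPoly α c ‖v‖ • v := by
    rw [hw, hv, h.poly_smul_flux, h.poly_smul_flux]
  have hmono := h.poly_sub_mul_sq_sub_nonneg (norm_nonneg w) (norm_nonneg v)
  calc c 0 * ‖w - v‖ ^ 2 ≤ (forchPoly α c ‖w‖ + forchPoly α c ‖v‖) / 2 * ‖w - v‖ ^ 2 := by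
        gcongr
        linarith [h.coeff_zero_le_poly (norm_nonneg w), h.coeff_zero_le_poly (norm_nonneg v)]
    _ ≤ ⟪w - v, y - z⟫ := by
        rw [hyz, inner_sub_smul_sub_smul]
        linarith

theorem lipschitzWith_flux (h : IsForch α c) :
    LipschitzWith (c 0).toNNReal⁻¹ (flux α c : E → E) := by
  refine LipschitzWith.of_dist_le_mul fun y z => ?_
  rw [dist_eq_norm, dist_eq_norm, NNReal.coe_inv, Real.coe_toNNReal _ (h.coeff_nonneg 0),
    le_inv_mul_iff₀ h.coeff_zero_pos]
  rcases (norm_nonneg (flux α c y - flux α c z)).eq_or_lt with hzero | hpos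
  · rw [← hzero, mul_zero]
    exact norm_nonneg _
  · refine le_of_mul_le_mul_left ?_ hpos
    linarith [h.flux_cocoercive y z, real_inner_le_norm (flux α c y - flux α c z) (y - z)]

theorem rpow_last_mul_poly_le (h : IsForch α c) {s r : ℝ} (hs : 0 ≤ s) (hr : 0 < r)
    (hr1 : r ≤ 1) : r ^ α (Fin.last N) * forchPoly α c s ≤ forchPoly α c (r * s) := by
  unfold forchPoly
  rw [Finset.mul_sum]
  refine Finset.sum_le_sum fun j _ => ?_
  rw [Real.mul_rpow hr.le hs, mul_left_comm]
  have hpow : r ^ α (Fin.last N) ≤ r ^ α j :=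
    Real.rpow_le_rpow_of_exponent_ge hr hr1 (h.le_last j)
  have := h.coeff_nonneg j
  gcongr

theorem poly_sub_mul_sq_le (h : IsForch α c) {s t : ℝ} (ht : 0 ≤ t) (hts : t ≤ s) :
    (forchPoly α c s - forchPoly α c t) * t ^ 2 ≤
      max 1 (α (Fin.last N)) * forchPoly α c s * (s ^ 2 - t ^ 2) := by
  have hpoly := h.poly_pos (ht.trans hts)
  set A := α (Fin.last N)
  rcases ht.eq_or_lt with rfl | ht
  · rw [zero_pow two_ne_zero, mul_zero, sub_zero]
    positivity
  have hs : 0 < s := ht.trans_le hts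
  obtain ⟨r, hr, rfl⟩ : ∃ r, 0 < r ∧ t = r * s := ⟨t / s, by positivity, by field_simp⟩
  have hr1 : r ≤ 1 := by nlinarith
  have : 0 ≤ max 1 A * (1 - r) := mul_nonneg (by positivity) (by linarith)
  calc (forchPoly α c s - forchPoly α c (r * s)) * (r * s) ^ 2
      ≤ ((1 - r ^ A) * forchPoly α c s) * (r * s) ^ 2 := by
        gcongr
        linarith [h.rpow_last_mul_poly_le hs.le hr hr1]
    _ ≤ (max 1 A * (1 - r) * forchPoly α c s) * (r * s) ^ 2 := by
        gcongr
        exact one_sub_rpow_le hr hr1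
    _ = max 1 A * forchPoly α c s * s ^ 2 * ((1 - r) * r ^ 2) := by ring
    _ ≤ max 1 A * forchPoly α c s * s ^ 2 * (1 - r ^ 2) := by
        gcongr
        nlinarith [mul_nonneg hr.le (sub_nonneg.2 hr1)]
    _ = max 1 A * forchPoly α c s * (s ^ 2 - (r * s) ^ 2) := by ring

theorem K_mul_norm_sub_sq_le (h : IsForch α c) (y z : E) :
    forchK α c (max ‖y‖ ‖z‖) * ‖y - z‖ ^ 2 ≤
      fluxConst α * ⟪flux α c y - flux α c z, y - z⟫ := by
  wlog hle : ‖z‖ ≤ ‖y‖ generalizing y z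
  · have := this z y (not_le.1 hle).le
    rwa [max_comm, norm_sub_rev, ← neg_sub (flux α c z), ← neg_sub z, inner_neg_neg]
  rw [max_eq_left hle, fluxConst]
  set w := flux α c y with hw
  set v := flux α c z with hv
  have hyz : y - z = forchPoly α c ‖w‖ • w - forchPoly α c ‖v‖ • v := by
    rw [hw, hv, h.poly_smul_flux, h.poly_smul_flux]
  have hvw : ‖v‖ ≤ ‖w‖ := by
    rw [hw, hv, h.norm_flux, h.norm_flux]
    exact h.root_mono (norm_nonneg z) hle
  have hAB := h.poly_mono (norm_nonneg v) hvw
  have hgrowth := h.poly_sub_mul_sq_le (norm_nonneg v) hvw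
  have hB := h.poly_pos (norm_nonneg v)
  rw [hyz, inner_sub_smul_sub_smul, norm_smul_sub_smul_sq, forchK, ← h.norm_flux y, ← hw, one_div,
    inv_mul_le_iff₀ (h.poly_pos (norm_nonneg w))]
  set A := forchPoly α c ‖w‖
  set B := forchPoly α c ‖v‖
  set m := max 1 (α (Fin.last N))
  have hm : 1 ≤ m := le_max_left _ _
  calc A * B * ‖w - v‖ ^ 2 + (A - B) * (A * ‖w‖ ^ 2 - B * ‖v‖ ^ 2)
      = A * B * ‖w - v‖ ^ 2
          + (A - B) * (A * (‖w‖ ^ 2 - ‖v‖ ^ 2) + (A - B) * ‖v‖ ^ 2) := by ring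
    _ ≤ A * ((1 + m) * (A + B)) * ‖w - v‖ ^ 2
          + (A - B) * (A * (‖w‖ ^ 2 - ‖v‖ ^ 2) + m * A * (‖w‖ ^ 2 - ‖v‖ ^ 2)) := by
        have : 0 < A := hB.trans_le hAB
        gcongr
        nlinarith
    _ = A * ((2 + 2 * m) * ((A + B) / 2 * ‖w - v‖ ^ 2 + (A - B) / 2 * (‖w‖ ^ 2 - ‖v‖ ^ 2))) := by
        ring

theorem K_le_inv (h : IsForch α c) {ξ : ℝ} (hξ : 0 ≤ ξ) : forchK α c ξ ≤ (c 0)⁻¹ :=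
  (le_inv_mul_iff₀ h.coeff_zero_pos).2 (h.coeff_zero_mul_K_le_one hξ) |>.trans_eq (mul_one _)

theorem K_mul_norm_sub_sub_sq_le (h : IsForch α c) (y z w : E) :
    forchK α c (max ‖y‖ ‖z‖) * ‖y - z - w‖ ^ 2 ≤
      2 * fluxConst α * (⟪flux α c y - flux α c z, y - z⟫ + (c 0)⁻¹ * ‖w‖ ^ 2) := by
  have hmax : 0 ≤ max ‖y‖ ‖z‖ := le_max_of_le_left (norm_nonneg y)
  have hK := h.K_pos hmax
  have hconst : 1 ≤ fluxConst α := by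
    linarith [le_max_left 1 (α (Fin.last N)), fluxConst.eq_1 α]
  have hweight : 0 ≤ (c 0)⁻¹ * ‖w‖ ^ 2 := mul_nonneg (inv_pos.2 h.coeff_zero_pos).le (sq_nonneg _)
  have hparallelogram : ‖y - z - w‖ ^ 2 ≤ 2 * (‖y - z‖ ^ 2 + ‖w‖ ^ 2) :=
    (pow_le_pow_left₀ (norm_nonneg _) (norm_sub_le _ _) 2).trans (add_sq_le)
  calc forchK α c (max ‖y‖ ‖z‖) * ‖y - z - w‖ ^ 2
      ≤ forchK α c (max ‖y‖ ‖z‖) * (2 * (‖y - z‖ ^ 2 + ‖w‖ ^ 2)) := by gcongr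
    _ = 2 * (forchK α c (max ‖y‖ ‖z‖) * ‖y - z‖ ^ 2
          + forchK α c (max ‖y‖ ‖z‖) * ‖w‖ ^ 2) := by ring
    _ ≤ 2 * (fluxConst α * ⟪flux α c y - flux α c z, y - z⟫
          + fluxConst α * ((c 0)⁻¹ * ‖w‖ ^ 2)) := by
        refine mul_le_mul_of_nonneg_left (add_le_add (h.K_mul_norm_sub_sq_le y z) ?_) zero_le_two
        exact (mul_le_mul_of_nonneg_right (h.K_le_inv hmax) (sq_nonneg _)).trans
          (le_mul_of_one_le_left hweight hconst)
    _ = _ := by ring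

theorem continuousOn_root (h : IsForch α c) : ContinuousOn (forchRoot α c) (Ici 0) := by
  refine (h.lipschitzWith_flux (E := ℝ)).continuous.norm.continuousOn.congr fun ξ hξ => ?_
  change forchRoot α c ξ = ‖flux α c ξ‖
  rw [h.norm_flux, Real.norm_of_nonneg hξ]

end Flux

section Energy

theorem continuousOn_K (h : IsForch α c) : ContinuousOn (forchK α c) (Ici 0) :=
  continuousOn_const.div (h.continuous_poly.comp_continuousOn h.continuousOn_root)
    fun _ hξ => (h.poly_pos (h.root_nonneg hξ)).ne'

theorem continuous_K_sqrt (h : IsForch α c) : Continuous fun s => forchK α c (Real.sqrt s) :=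
  h.continuousOn_K.comp_continuous Real.continuous_sqrt Real.sqrt_nonneg

theorem hasDerivAt_H (h : IsForch α c) {ξ : ℝ} (hξ : 0 ≤ ξ) :
    HasDerivAt (forchH α c) (2 * forchRoot α c ξ) ξ := by
  have hinner : HasDerivAt (fun u => ∫ s in (0 : ℝ)..u, forchK α c (Real.sqrt s))
      (forchK α c (Real.sqrt (ξ ^ 2))) (ξ ^ 2) :=
    h.continuous_K_sqrt.integral_hasStrictDerivAt 0 (ξ ^ 2) |>.hasDerivAt
  have hcomp : HasDerivAt (forchH α c) _ ξ :=
    hinner.comp (h := fun x : ℝ => x ^ 2) ξ (hasDerivAt_pow 2 ξ)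
  convert hcomp using 1
  rw [Real.sqrt_sq hξ, ← h.K_mul_self hξ]
  push_cast
  ring

theorem convexOn_H (h : IsForch α c) : ConvexOn ℝ (Ici 0) (forchH α c) := by
  refine MonotoneOn.convexOn_of_deriv (convex_Ici 0)
    (fun ξ hξ => (h.hasDerivAt_H hξ).continuousAt.continuousWithinAt) ?_ ?_
  · rw [interior_Ici]
    exact fun ξ hξ => (h.hasDerivAt_H (le_of_lt hξ)).differentiableAt.differentiableWithinAt
  · rw [interior_Ici]
    intro ξ hξ η hη hle
    rw [(h.hasDerivAt_H (le_of_lt hξ)).deriv, (h.hasDerivAt_H (le_of_lt hη)).deriv]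
    exact mul_le_mul_of_nonneg_left (h.root_mono (le_of_lt hξ) hle) zero_le_two

theorem root_mul_sub_le_H_sub (h : IsForch α c) {ξ η : ℝ} (hξ : 0 ≤ ξ) (hη : 0 ≤ η) :
    2 * forchRoot α c ξ * (η - ξ) ≤ forchH α c η - forchH α c ξ := by
  rcases lt_trichotomy ξ η with hlt | rfl | hlt
  · have := h.convexOn_H.le_slope_of_hasDerivAt hξ hη hlt (h.hasDerivAt_H hξ)
    rwa [slope_def_field, le_div_iff₀ (sub_pos.2 hlt)] at this
  · simp
  · have := h.convexOn_H.slope_le_of_hasDerivAt hη hξ hlt (h.hasDerivAt_H hξ)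
    rw [slope_def_field, div_le_iff₀ (sub_pos.2 hlt)] at this
    linarith

theorem H_le_two_mul (h : IsForch α c) {ξ : ℝ} (hξ : 0 ≤ ξ) :
    forchH α c ξ ≤ 2 * (forchK α c ξ * ξ ^ 2) := by
  have hzero : forchH α c 0 = 0 := by simp [forchH]
  have htangent := h.root_mul_sub_le_H_sub hξ le_rfl
  rw [hzero, ← h.K_mul_self hξ] at htangent
  linarith

theorem K_mul_sq_le_H (h : IsForch α c) {ξ : ℝ} (hξ : 0 ≤ ξ) :
    forchK α c ξ * ξ ^ 2 ≤ forchH α c ξ := by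
  have : ∫ _ in (0 : ℝ)..ξ ^ 2, forchK α c ξ ≤ forchH α c ξ :=
    intervalIntegral.integral_mono_on (sq_nonneg ξ) intervalIntegrable_const
      (h.continuous_K_sqrt.intervalIntegrable _ _) fun s hs =>
        h.K_anti (Real.sqrt_nonneg s) (Real.sqrt_le_iff.2 ⟨hξ, hs.2⟩)
  simpa [mul_comm] using this

theorem inner_flux_sub_le_H_norm_sub {E : Type*} [NormedAddCommGroup E] [InnerProductSpace ℝ E]
    (h : IsForch α c) (y z : E) :
    2 * ⟪flux α c y, z - y⟫ ≤ forchH α c ‖z‖ - forchH α c ‖y‖ := by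
  refine le_trans ?_ (h.root_mul_sub_le_H_sub (norm_nonneg y) (norm_nonneg z))
  have hcs := mul_le_mul_of_nonneg_left (real_inner_le_norm y z) (h.K_pos (norm_nonneg y)).le
  rw [inner_sub_right, flux, real_inner_smul_left, real_inner_smul_left,
    real_inner_self_eq_norm_sq, ← h.K_mul_self (norm_nonneg y)]
  linarith

end Energy

section Measurability

variable {X : Type*} [MeasurableSpace X] {c : X → Fin (N + 1) → ℝ} {ξ : X → ℝ}

theorem measurable_root (h : ∀ x, IsForch α (c x)) (hc : ∀ j, Measurable fun x => c x j)
    (hξ : Measurable ξ) (hξ0 : ∀ x, 0 ≤ ξ x) : Measurable fun x => forchRoot α (c x) (ξ x) := by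
  refine measurable_of_Iic fun r => ?_
  rcases lt_or_ge r 0 with hr | hr
  · convert MeasurableSet.empty
    ext x
    simpa using hr.trans_le ((h x).root_nonneg (hξ0 x))
  · have hpre : (fun x => forchRoot α (c x) (ξ x)) ⁻¹' Iic r =
        {x | ξ x ≤ r * forchPoly α (c x) r} := by
      ext x
      exact (h x).root_le_iff (hξ0 x) hr
    rw [hpre]
    exact measurableSet_le hξ (measurable_const.mul
      (Finset.measurable_sum _ fun j _ => (hc j).mul_const _))

theorem measurable_K (h : ∀ x, IsForch α (c x)) (hc : ∀ j, Measurable fun x => c x j)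
    (hξ : Measurable ξ) (hξ0 : ∀ x, 0 ≤ ξ x) : Measurable fun x => forchK α (c x) (ξ x) :=
  measurable_const.div (Finset.measurable_sum _ fun j _ =>
    (hc j).mul ((measurable_root h hc hξ hξ0).pow_const _))

/-- The form of `H` in which measurability with respect to a parameter is visible. -/
theorem H_eq_sq_mul_integral (α c : Fin (N + 1) → ℝ) (ξ : ℝ) :
    forchH α c ξ = ξ ^ 2 * ∫ r in (0 : ℝ)..1, forchK α c (Real.sqrt (ξ ^ 2 * r)) := by
  rw [← smul_eq_mul, intervalIntegral.smul_integral_comp_mul_left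
    (fun s => forchK α c (Real.sqrt s)), mul_zero, mul_one, forchH]

theorem measurable_H (h : ∀ x, IsForch α (c x)) (hc : ∀ j, Measurable fun x => c x j)
    (hξ : Measurable ξ) : Measurable fun x => forchH α (c x) (ξ x) := by
  simp only [H_eq_sq_mul_integral, intervalIntegral.integral_of_le zero_le_one]
  have hK : Measurable fun p : X × ℝ => forchK α (c p.1) (Real.sqrt (ξ p.1 ^ 2 * p.2)) :=
    measurable_K (c := fun p : X × ℝ => c p.1) (fun p => h p.1)
      (fun j => (hc j).comp measurable_fst)
      (((hξ.comp measurable_fst).pow_const 2).mul measurable_snd).sqrt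
      fun _ => Real.sqrt_nonneg _
  exact (hξ.pow_const 2).mul hK.stronglyMeasurable.integral_prod_right.measurable

end Measurability

section Degeneracy

theorem sup_coeff_pos (h : IsForch α c) : 0 < Finset.univ.sup' Finset.univ_nonempty c :=
  h.coeff_zero_pos.trans_le (Finset.le_sup' c (Finset.mem_univ 0))

theorem one_le_natCast (h : IsForch α c) : (1 : ℝ) ≤ N := by exact_mod_cast h.one_le

theorem two_mul_natCast_mul_sup_coeff_pos (h : IsForch α c) :
    0 < 2 * N * Finset.univ.sup' Finset.univ_nonempty c :=
  mul_pos (by linarith [h.one_le_natCast]) h.sup_coeff_pos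

theorem weight_nonneg (h : IsForch α c) : 0 ≤ forchWeight α c :=
  div_nonneg (Real.rpow_nonneg (h.coeff_nonneg _) _) h.two_mul_natCast_mul_sup_coeff_pos.le

theorem weight_pos (h : IsForch α c) (hcN : 0 < c (Fin.last N)) : 0 < forchWeight α c :=
  div_pos (Real.rpow_pos_of_pos hcN _) h.two_mul_natCast_mul_sup_coeff_pos

theorem poly_le_mul_max (h : IsForch α c) {s : ℝ} (hs : 0 ≤ s) :
    forchPoly α c s ≤
      2 * N * Finset.univ.sup' Finset.univ_nonempty c * max 1 (s ^ α (Fin.last N)) := by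
  have hN := h.one_le_natCast
  have hM := h.sup_coeff_pos
  set M := Finset.univ.sup' Finset.univ_nonempty c
  have hpow (j : Fin (N + 1)) : s ^ α j ≤ max 1 (s ^ α (Fin.last N)) := by
    rcases le_total s 1 with hs1 | hs1
    · exact (Real.rpow_le_one hs hs1 (h.nonneg j)).trans (le_max_left _ _)
    · exact (Real.rpow_le_rpow_of_exponent_le hs1 (h.le_last j)).trans (le_max_right _ _)
  calc forchPoly α c s ≤ ∑ _j : Fin (N + 1), M * max 1 (s ^ α (Fin.last N)) := by
        refine Finset.sum_le_sum fun j _ => ?_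
        gcongr
        exacts [Finset.le_sup' c (Finset.mem_univ j), hpow j]
    _ = (N + 1) * (M * max 1 (s ^ α (Fin.last N))) := by simp
    _ ≤ 2 * N * (M * max 1 (s ^ α (Fin.last N))) := by gcongr; linarith
    _ = 2 * N * M * max 1 (s ^ α (Fin.last N)) := by ring

theorem coeff_last_rpow_mul_max_le (h : IsForch α c) (hcN : 0 < c (Fin.last N)) {ξ : ℝ}
    (hξ : 0 ≤ ξ) :
    c (Fin.last N) ^ expA α * max 1 (forchRoot α c ξ ^ α (Fin.last N)) ≤
      max ξ (c (Fin.last N)) ^ expA α := by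
  have hs := h.root_nonneg hξ
  have hξs := h.root_mul_poly hξ
  set s := forchRoot α c ξ
  have hlast := h.last_pos
  rcases le_total (s ^ α (Fin.last N)) 1 with hle | hle
  · rw [max_eq_left hle, mul_one]
    exact Real.rpow_le_rpow hcN.le (le_max_right _ _) h.expA_pos.le
  · have hpow : s ^ α (Fin.last N) = (s ^ (α (Fin.last N) + 1)) ^ expA α := by
      rw [← Real.rpow_mul hs, expA, mul_div_cancel₀ _ (by linarith)]
    rw [max_eq_right hle, hpow, ← Real.mul_rpow hcN.le (Real.rpow_nonneg hs _)]
    refine Real.rpow_le_rpow (by positivity) (le_max_of_le_left ?_) h.expA_pos.le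
    calc c (Fin.last N) * s ^ (α (Fin.last N) + 1) = s * (c (Fin.last N) * s ^ α (Fin.last N)) := by
          rw [Real.rpow_add_one' hs (by linarith)]
          ring
      _ ≤ s * forchPoly α c s := by
          gcongr
          exact h.coeff_mul_rpow_le_poly hs _
      _ = ξ := hξs

theorem weight_le_K_mul_max_rpow (h : IsForch α c) (hcN : 0 < c (Fin.last N)) {ξ : ℝ}
    (hξ : 0 ≤ ξ) : forchWeight α c ≤ forchK α c ξ * max ξ (c (Fin.last N)) ^ expA α := by
  have hs := h.root_nonneg hξ
  have hpoly := h.poly_le_mul_max hs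
  have hmax := h.coeff_last_rpow_mul_max_le hcN hξ
  have hM := h.two_mul_natCast_mul_sup_coeff_pos
  rw [forchWeight, forchK, div_le_iff₀ hM, one_div, mul_assoc, ← div_eq_inv_mul,
    le_div_iff₀ (h.poly_pos hs)]
  set s := forchRoot α c ξ
  set M := 2 * N * Finset.univ.sup' Finset.univ_nonempty c
  calc c (Fin.last N) ^ expA α * forchPoly α c s
      ≤ c (Fin.last N) ^ expA α * (M * max 1 (s ^ α (Fin.last N))) := by gcongr
    _ = c (Fin.last N) ^ expA α * max 1 (s ^ α (Fin.last N)) * M := by ring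
    _ ≤ max ξ (c (Fin.last N)) ^ expA α * M := by gcongr

theorem weight_mul_coeff_last_rpow_le (h : IsForch α c) (hcN : 0 < c (Fin.last N)) :
    forchWeight α c * c (Fin.last N) ^ (2 - expA α) ≤ c (Fin.last N) / 2 := by
  have hM := h.two_mul_natCast_mul_sup_coeff_pos
  have hle : c (Fin.last N) ≤ N * Finset.univ.sup' Finset.univ_nonempty c :=
    (Finset.le_sup' c (Finset.mem_univ _)).trans
      (le_mul_of_one_le_left h.sup_coeff_pos.le h.one_le_natCast)
  rw [forchWeight, div_mul_eq_mul_div, ← Real.rpow_add hcN, add_sub_cancel, Real.rpow_two,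
    div_le_iff₀ hM]
  nlinarith

theorem weight_mul_max_rpow_le (h : IsForch α c) (hcN : 0 < c (Fin.last N)) {ξ : ℝ} (hξ : 0 ≤ ξ) :
    forchWeight α c * max ξ (c (Fin.last N)) ^ (2 - expA α) ≤
      forchK α c ξ * ξ ^ 2 + c (Fin.last N) / 2 := by
  have hK := h.K_pos hξ
  rcases le_total ξ (c (Fin.last N)) with hle | hle
  · rw [max_eq_right hle]
    have : 0 ≤ forchK α c ξ * ξ ^ 2 := by positivity
    linarith [h.weight_mul_coeff_last_rpow_le hcN]
  · have hweight := h.weight_le_K_mul_max_rpow hcN hξ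
    have hξ0 : 0 < ξ := hcN.trans_le hle
    rw [max_eq_left hle] at hweight ⊢
    calc forchWeight α c * ξ ^ (2 - expA α)
        ≤ forchK α c ξ * ξ ^ expA α * ξ ^ (2 - expA α) := by gcongr
      _ = forchK α c ξ * ξ ^ 2 := by
        rw [mul_assoc, ← Real.rpow_add hξ0, add_sub_cancel, Real.rpow_two]
      _ ≤ forchK α c ξ * ξ ^ 2 + c (Fin.last N) / 2 := by linarith

theorem weight_mul_rpow_le (h : IsForch α c) (hcN : 0 < c (Fin.last N)) {ξ : ℝ} (hξ : 0 ≤ ξ) :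
    forchWeight α c * ξ ^ (2 - expA α) ≤ forchK α c ξ * ξ ^ 2 + c (Fin.last N) / 2 :=
  (mul_le_mul_of_nonneg_left (Real.rpow_le_rpow hξ (le_max_left _ _) (by linarith [h.expA_lt_one]))
    h.weight_nonneg).trans (h.weight_mul_max_rpow_le hcN hξ)

theorem weight_mul_rpow_le_rpow_mul_rpow (h : IsForch α c) (hcN : 0 < c (Fin.last N)) {ξ r : ℝ}
    (hξ : 0 ≤ ξ) (hr : 0 ≤ r) :
    forchWeight α c * r ^ (2 - expA α) ≤
      (forchK α c ξ * r ^ 2) ^ ((2 - expA α) / 2) *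
        (forchK α c ξ * ξ ^ 2 + c (Fin.last N) / 2) ^ (expA α / 2) := by
  have ha := h.expA_pos
  have ha1 := h.expA_lt_one
  have hK := h.K_pos hξ
  have hWK := h.weight_le_K_mul_max_rpow hcN hξ
  have hWm := h.weight_mul_max_rpow_le hcN hξ
  have hW := h.weight_pos hcN
  set a := expA α
  set W := forchWeight α c
  set m := max ξ (c (Fin.last N))
  have hm : 0 < m := hcN.trans_le (le_max_right _ _)
  have hWsplit : W = W ^ ((2 - a) / 2) * W ^ (a / 2) := by
    rw [← Real.rpow_add hW, show (2 - a) / 2 + a / 2 = 1 by ring, Real.rpow_one]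
  have hrpow : r ^ (2 - a) = (r ^ 2) ^ ((2 - a) / 2) := by
    rw [← Real.rpow_two, ← Real.rpow_mul hr, mul_div_cancel₀ _ two_ne_zero]
  have hmpow : (m ^ a) ^ ((2 - a) / 2) = (m ^ (2 - a)) ^ (a / 2) := by
    rw [← Real.rpow_mul hm.le, ← Real.rpow_mul hm.le, mul_div_left_comm]
  calc W * r ^ (2 - a) = W ^ ((2 - a) / 2) * W ^ (a / 2) * r ^ (2 - a) := by rw [← hWsplit]
    _ ≤ (forchK α c ξ * m ^ a) ^ ((2 - a) / 2) * W ^ (a / 2) * r ^ (2 - a) := by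
        gcongr
        linarith
    _ = (forchK α c ξ * r ^ 2) ^ ((2 - a) / 2) * (W * m ^ (2 - a)) ^ (a / 2) := by
        rw [Real.mul_rpow hK.le (by positivity), Real.mul_rpow hK.le (by positivity),
          Real.mul_rpow hW.le (by positivity), hrpow, hmpow]
        ring
    _ ≤ (forchK α c ξ * r ^ 2) ^ ((2 - a) / 2) *
          (forchK α c ξ * ξ ^ 2 + c (Fin.last N) / 2) ^ (a / 2) := by gcongr

end Degeneracy

end IsForch

section WeightedMeasure

variable {X : Type*} [MeasurableSpace X] {μ : Measure X} {ρ : X → ℝ}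

theorem ae_withDensity_ofReal (hρ : Measurable ρ) (hpos : ∀ᵐ x ∂μ, 0 < ρ x) :
    ae (μ.withDensity fun x => ENNReal.ofReal (ρ x)) = ae μ := by
  refine le_antisymm (withDensity_absolutelyContinuous μ _).ae_le
    (withDensity_absolutelyContinuous' hρ.ennreal_ofReal.aemeasurable ?_).ae_le
  filter_upwards [hpos] with x hx
  exact (ENNReal.ofReal_pos.2 hx).ne'

theorem integral_withDensity_ofReal (hρ : Measurable ρ) (hpos : ∀ᵐ x ∂μ, 0 < ρ x) (f : X → ℝ) :
    ∫ x, f x ∂(μ.withDensity fun x => ENNReal.ofReal (ρ x)) = ∫ x, ρ x * f x ∂μ := by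
  rw [integral_withDensity_eq_integral_toReal_smul hρ.ennreal_ofReal (by simp)]
  refine integral_congr_ae ?_
  filter_upwards [hpos] with x hx
  rw [ENNReal.toReal_ofReal hx.le, smul_eq_mul]

theorem integrable_withDensity_ofReal (hρ : Measurable ρ) (hpos : ∀ᵐ x ∂μ, 0 < ρ x) {f : X → ℝ} :
    Integrable f (μ.withDensity fun x => ENNReal.ofReal (ρ x)) ↔
      Integrable (fun x => ρ x * f x) μ := by
  rw [integrable_withDensity_iff_integrable_smul' hρ.ennreal_ofReal (by simp)]
  refine integrable_congr ?_
  filter_upwards [hpos] with x hx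
  rw [ENNReal.toReal_ofReal hx.le, smul_eq_mul]

theorem inner_withDensity_ofReal {E : Type*} [NormedAddCommGroup E] [InnerProductSpace ℝ E]
    (hρ : Measurable ρ) (hpos : ∀ᵐ x ∂μ, 0 < ρ x)
    (f g : Lp E 2 (μ.withDensity fun x => ENNReal.ofReal (ρ x))) :
    ⟪f, g⟫ = ∫ x, ρ x * ⟪f x, g x⟫ ∂μ := by
  rw [L2.inner_def, integral_withDensity_ofReal hρ hpos]

theorem integrable_inner_withDensity_ofReal {E : Type*} [NormedAddCommGroup E]
    [InnerProductSpace ℝ E] (hρ : Measurable ρ) (hpos : ∀ᵐ x ∂μ, 0 < ρ x)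
    (f g : Lp E 2 (μ.withDensity fun x => ENNReal.ofReal (ρ x))) :
    Integrable (fun x => ρ x * ⟪f x, g x⟫) μ :=
  (integrable_withDensity_ofReal hρ hpos).1 (L2.integrable_inner (𝕜 := ℝ) f g)

end WeightedMeasure

section Hölder

variable {X : Type*} [MeasurableSpace X] {μ : Measure X} {f g : X → ℝ} {θ : ℝ}

theorem integrable_rpow_mul_rpow (hθ : 0 ≤ θ) (hθ1 : θ ≤ 1) (hf : Integrable f μ)
    (hg : Integrable g μ) (hf0 : 0 ≤ᵐ[μ] f) (hg0 : 0 ≤ᵐ[μ] g) :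
    Integrable (fun x => f x ^ θ * g x ^ (1 - θ)) μ := by
  refine ((hf.const_mul θ).add (hg.const_mul (1 - θ))).mono'
    ((hf.aemeasurable.pow_const θ).mul (hg.aemeasurable.pow_const _)).aestronglyMeasurable ?_
  filter_upwards [hf0, hg0] with x hfx hgx
  rw [Real.norm_of_nonneg (mul_nonneg (Real.rpow_nonneg hfx _) (Real.rpow_nonneg hgx _))]
  exact Real.geom_mean_le_arith_mean2_weighted hθ (sub_nonneg.2 hθ1) hfx hgx (add_sub_cancel _ _)

theorem integral_rpow_mul_rpow_le (hθ : 0 ≤ θ) (hθ1 : θ ≤ 1) (hf : Integrable f μ)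
    (hg : Integrable g μ) (hf0 : 0 ≤ᵐ[μ] f) (hg0 : 0 ≤ᵐ[μ] g) :
    ∫ x, f x ^ θ * g x ^ (1 - θ) ∂μ ≤ (∫ x, f x ∂μ) ^ θ * (∫ x, g x ∂μ) ^ (1 - θ) := by
  have hθ1' := sub_nonneg.2 hθ1
  have hholder := ENNReal.lintegral_mul_norm_pow_le hf.aemeasurable.ennreal_ofReal
    hg.aemeasurable.ennreal_ofReal hθ hθ1' (add_sub_cancel _ _)
  have hfg0 : 0 ≤ᵐ[μ] fun x => f x ^ θ * g x ^ (1 - θ) := by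
    filter_upwards [hf0, hg0] with x hfx hgx
    exact mul_nonneg (Real.rpow_nonneg hfx _) (Real.rpow_nonneg hgx _)
  have hofReal : ∫⁻ x, ENNReal.ofReal (f x ^ θ * g x ^ (1 - θ)) ∂μ =
      ∫⁻ x, ENNReal.ofReal (f x) ^ θ * ENNReal.ofReal (g x) ^ (1 - θ) ∂μ := by
    refine lintegral_congr_ae ?_
    filter_upwards [hf0, hg0] with x hfx hgx
    rw [ENNReal.ofReal_mul (Real.rpow_nonneg hfx _), ENNReal.ofReal_rpow_of_nonneg hfx hθ,
      ENNReal.ofReal_rpow_of_nonneg hgx hθ1']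
  have hf_top := ENNReal.rpow_ne_top_of_nonneg hθ hf.lintegral_lt_top.ne
  have hg_top := ENNReal.rpow_ne_top_of_nonneg hθ1' hg.lintegral_lt_top.ne
  rw [integral_eq_lintegral_of_nonneg_ae hf0 hf.aestronglyMeasurable,
    integral_eq_lintegral_of_nonneg_ae hg0 hg.aestronglyMeasurable,
    integral_eq_lintegral_of_nonneg_ae hfg0
      (integrable_rpow_mul_rpow hθ hθ1 hf hg hf0 hg0).aestronglyMeasurable,
    ENNReal.toReal_rpow, ENNReal.toReal_rpow, ← ENNReal.toReal_mul, hofReal]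
  exact ENNReal.toReal_mono (ENNReal.mul_ne_top hf_top hg_top) hholder

end Hölder

variable {n : ℕ} {U : Set (EuclideanSpace ℝ (Fin n))} {N : ℕ} {α : Fin (N + 1) → ℝ}
  {m : Medium U α}

section WeightedSpaces

theorem Medium.isForch (m : Medium U α) (hα : IsForchExponents α) {x : EuclideanSpace ℝ (Fin n)}
    (hx : x ∈ U) : IsForch α fun j => m.coef j x :=
  ⟨hα, fun j => m.coef_nonneg j x hx, m.coef_zero_pos x hx⟩

theorem Medium.ae_isForch (m : Medium U α) (hα : IsForchExponents α) (hU : MeasurableSet U) :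
    ∀ᵐ x ∂volume.restrict U, IsForch α fun j => m.coef j x :=
  (ae_restrict_mem hU).mono fun _ => m.isForch hα

theorem Medium.ae_inv_coef_zero_pos (m : Medium U α) (hU : MeasurableSet U) :
    ∀ᵐ x ∂volume.restrict U, 0 < (m.coef 0 x)⁻¹ :=
  (ae_restrict_mem hU).mono fun x hx => inv_pos.2 (m.coef_zero_pos x hx)

theorem Medium.ae_phi_pos (m : Medium U α) (hU : MeasurableSet U) :
    ∀ᵐ x ∂volume.restrict U, 0 < m.phi x :=
  (ae_restrict_mem hU).mono fun x hx => (m.phi_mem x hx).1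

theorem Medium.ae_muA (m : Medium U α) (hU : MeasurableSet U) :
    ae m.muA = ae (volume.restrict U) :=
  ae_withDensity_ofReal (m.measurable_coef 0).inv (m.ae_inv_coef_zero_pos hU)

theorem Medium.ae_muPhi (m : Medium U α) (hU : MeasurableSet U) :
    ae m.muPhi = ae (volume.restrict U) :=
  ae_withDensity_ofReal m.measurable_phi (m.ae_phi_pos hU)

theorem coeFn_sub_L2A (hU : MeasurableSet U) (v w : m.L2A) :
    ∀ᵐ x ∂volume.restrict U, (v - w) x = v x - w x := by
  rw [← m.ae_muA hU]
  exact Lp.coeFn_sub v w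

theorem inner_L2A (hU : MeasurableSet U) (v w : m.L2A) :
    ⟪v, w⟫ = ∫ x in U, (m.coef 0 x)⁻¹ * ⟪v x, w x⟫ :=
  inner_withDensity_ofReal (m.measurable_coef 0).inv (m.ae_inv_coef_zero_pos hU) v w

theorem integrable_inner_L2A (hU : MeasurableSet U) (v w : m.L2A) :
    IntegrableOn (fun x => (m.coef 0 x)⁻¹ * ⟪v x, w x⟫) U :=
  integrable_inner_withDensity_ofReal (m.measurable_coef 0).inv (m.ae_inv_coef_zero_pos hU) v w

theorem norm_sq_L2A (hU : MeasurableSet U) (v : m.L2A) :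
    ‖v‖ ^ 2 = ∫ x in U, (m.coef 0 x)⁻¹ * ‖v x‖ ^ 2 := by
  rw [← real_inner_self_eq_norm_sq, inner_L2A hU]
  simp only [real_inner_self_eq_norm_sq]

theorem integrable_norm_sq_L2A (hU : MeasurableSet U) (v : m.L2A) :
    IntegrableOn (fun x => (m.coef 0 x)⁻¹ * ‖v x‖ ^ 2) U := by
  simpa only [real_inner_self_eq_norm_sq] using integrable_inner_L2A hU v v

theorem inner_L2Phi (hU : MeasurableSet U) (u w : m.L2Phi) :
    ⟪u, w⟫ = ∫ x in U, m.phi x * ⟪u x, w x⟫ :=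
  inner_withDensity_ofReal m.measurable_phi (m.ae_phi_pos hU) u w

theorem norm_sq_L2Phi (hU : MeasurableSet U) (u : m.L2Phi) :
    ‖u‖ ^ 2 = ∫ x in U, u x ^ 2 * m.phi x := by
  rw [← real_inner_self_eq_norm_sq, inner_L2Phi hU]
  simp only [real_inner_self_eq_norm_sq, Real.norm_eq_abs, sq_abs, mul_comm]

theorem wNorm_phi (hU : MeasurableSet U) (u : m.L2Phi) : wNorm U m.phi 2 u = ‖u‖ := by
  rw [← Real.sqrt_sq (norm_nonneg u), norm_sq_L2Phi hU, Real.sqrt_eq_rpow, wNorm]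
  simp only [Real.rpow_two, Real.norm_eq_abs, sq_abs, mul_comm]

theorem measurable_coeFn_L2A (v : m.L2A) : Measurable v :=
  (Lp.stronglyMeasurable v).measurable

theorem Medium.aemeasurable_K (m : Medium U α) (hα : IsForchExponents α) (hU : MeasurableSet U)
    {ξ : EuclideanSpace ℝ (Fin n) → ℝ} (hξ : Measurable ξ) (hξ0 : ∀ x, 0 ≤ ξ x) :
    AEMeasurable (fun x => m.K x (ξ x)) (volume.restrict U) :=
  aemeasurable_restrict_of_measurable_subtype hU <|
    IsForch.measurable_K (c := fun (x : U) j => m.coef j x) (fun x => m.isForch hα x.2)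
      (fun j => (m.measurable_coef j).comp measurable_subtype_coe)
      (hξ.comp measurable_subtype_coe) fun x => hξ0 x

theorem Medium.aemeasurable_H (m : Medium U α) (hα : IsForchExponents α) (hU : MeasurableSet U)
    {ξ : EuclideanSpace ℝ (Fin n) → ℝ} (hξ : Measurable ξ) :
    AEMeasurable (fun x => m.H x (ξ x)) (volume.restrict U) :=
  aemeasurable_restrict_of_measurable_subtype hU <|
    IsForch.measurable_H (c := fun (x : U) j => m.coef j x) (fun x => m.isForch hα x.2)
      (fun j => (m.measurable_coef j).comp measurable_subtype_coe)
      (hξ.comp measurable_subtype_coe)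

end WeightedSpaces

section FluxOperator

/-- The vector field `a₀ K(x,|v|) v`. The factor `a₀` compensates the weight of `L²_{1/a₀}`:
the inner product with this field is `∫_U K(x,|v|) v · w dx`. -/
noncomputable def fluxFun (m : Medium U α) (v : m.L2A) (x : EuclideanSpace ℝ (Fin n)) :
    EuclideanSpace ℝ (Fin n) :=
  m.coef 0 x • flux α (fun j => m.coef j x) (v x)

theorem memLp_fluxFun (hα : IsForchExponents α) (hU : MeasurableSet U) (v : m.L2A) :
    MemLp (fluxFun m v) 2 m.muA := by
  refine (Lp.memLp v).mono ?_ ?_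
  · refine AEStronglyMeasurable.mono_ac (withDensity_absolutelyContinuous _ _) ?_
    exact (m.measurable_coef 0).aestronglyMeasurable.smul
      ((m.aemeasurable_K hα hU (measurable_coeFn_L2A v).norm
        fun _ => norm_nonneg _).aestronglyMeasurable.smul
        (measurable_coeFn_L2A v).aestronglyMeasurable)
  · rw [m.ae_muA hU]
    filter_upwards [m.ae_isForch hα hU] with x hx
    rw [fluxFun, norm_smul, hx.norm_flux, Real.norm_of_nonneg hx.coeff_zero_pos.le,
      ← hx.K_mul_self (norm_nonneg _), ← mul_assoc]
    exact mul_le_of_le_one_left (norm_nonneg _) (hx.coeff_zero_mul_K_le_one (norm_nonneg _))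

/-- The flux operator `v ↦ a₀ K(x,|v|) v` on `L²_{1/a₀}`. -/
noncomputable def fluxLp (hα : IsForchExponents α) (hU : MeasurableSet U) (v : m.L2A) : m.L2A :=
  (memLp_fluxFun hα hU v).toLp

theorem coeFn_fluxLp (hα : IsForchExponents α) (hU : MeasurableSet U) (v : m.L2A) :
    ∀ᵐ x ∂volume.restrict U,
      fluxLp hα hU v x = m.coef 0 x • flux α (fun j => m.coef j x) (v x) := by
  rw [← m.ae_muA hU]
  exact (memLp_fluxFun hα hU v).coeFn_toLp

theorem inner_coeFn_fluxLp (hα : IsForchExponents α) (hU : MeasurableSet U) (v w : m.L2A) :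
    (fun x => (m.coef 0 x)⁻¹ * ⟪fluxLp hα hU v x, w x⟫) =ᵐ[volume.restrict U]
      fun x => m.K x ‖v x‖ * ⟪v x, w x⟫ := by
  filter_upwards [m.ae_isForch hα hU, coeFn_fluxLp hα hU v] with x hx hv
  rw [hv, real_inner_smul_left, inv_mul_cancel_left₀ hx.coeff_zero_pos.ne', flux,
    real_inner_smul_left, Medium.K]

theorem inner_fluxLp (hα : IsForchExponents α) (hU : MeasurableSet U) (v w : m.L2A) :
    ⟪fluxLp hα hU v, w⟫ = ∫ x in U, m.K x ‖v x‖ * ⟪v x, w x⟫ := by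
  rw [inner_L2A hU]
  exact integral_congr_ae (inner_coeFn_fluxLp hα hU v w)

theorem integrable_K_mul_inner (hα : IsForchExponents α) (hU : MeasurableSet U) (v w : m.L2A) :
    IntegrableOn (fun x => m.K x ‖v x‖ * ⟪v x, w x⟫) U :=
  (integrable_inner_L2A hU (fluxLp hα hU v) w).congr (inner_coeFn_fluxLp hα hU v w)

theorem inner_coeFn_fluxLp_sub (hα : IsForchExponents α) (hU : MeasurableSet U) (v w z : m.L2A) :
    (fun x => (m.coef 0 x)⁻¹ * ⟪(fluxLp hα hU v - fluxLp hα hU w) x, z x⟫)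
      =ᵐ[volume.restrict U] fun x =>
        ⟪flux α (fun j => m.coef j x) (v x) - flux α (fun j => m.coef j x) (w x), z x⟫ := by
  filter_upwards [m.ae_isForch hα hU, coeFn_fluxLp hα hU v, coeFn_fluxLp hα hU w,
    coeFn_sub_L2A hU (fluxLp hα hU v) (fluxLp hα hU w)] with x hx hv hw hsub
  rw [hsub, hv, hw, ← smul_sub, real_inner_smul_left,
    inv_mul_cancel_left₀ hx.coeff_zero_pos.ne']

theorem fluxLp_cocoercive (hα : IsForchExponents α) (hU : MeasurableSet U) (v w : m.L2A) :
    ‖fluxLp hα hU v - fluxLp hα hU w‖ ^ 2 ≤ ⟪fluxLp hα hU v - fluxLp hα hU w, v - w⟫ := by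
  rw [norm_sq_L2A hU, inner_L2A hU]
  refine integral_mono_ae (integrable_norm_sq_L2A hU _) (integrable_inner_L2A hU _ _) ?_
  filter_upwards [m.ae_isForch hα hU, coeFn_fluxLp hα hU v, coeFn_fluxLp hα hU w,
    coeFn_sub_L2A hU (fluxLp hα hU v) (fluxLp hα hU w), coeFn_sub_L2A hU v w,
    inner_coeFn_fluxLp_sub hα hU v w (v - w)] with x hx hv hw hflux hsub hinner
  rw [hinner, hflux, hv, hw, hsub, ← smul_sub, norm_smul, mul_pow,
    Real.norm_of_nonneg hx.coeff_zero_pos.le, pow_two (m.coef 0 x), ← mul_assoc,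
    inv_mul_cancel_left₀ hx.coeff_zero_pos.ne']
  exact hx.flux_cocoercive (v x) (w x)

theorem norm_fluxLp_sub_le (hα : IsForchExponents α) (hU : MeasurableSet U) (v w : m.L2A) :
    ‖fluxLp hα hU v - fluxLp hα hU w‖ ≤ ‖v - w‖ := by
  by_contra! hlt
  nlinarith [fluxLp_cocoercive hα hU v w, norm_nonneg (v - w),
    real_inner_le_norm (fluxLp hα hU v - fluxLp hα hU w) (v - w)]

theorem fluxLp_zero (hα : IsForchExponents α) (hU : MeasurableSet U) :
    fluxLp hα hU (0 : m.L2A) = 0 := by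
  refine Lp.ext ?_
  filter_upwards [(memLp_fluxFun hα hU (0 : m.L2A)).coeFn_toLp,
    Lp.coeFn_zero (EuclideanSpace ℝ (Fin n)) 2 m.muA] with x hflux hzero
  rw [fluxLp, hflux, hzero, fluxFun, hzero, Pi.zero_apply, flux, smul_zero, smul_zero]

end FluxOperator

section Energy

/-- The dissipation `∫_U K(x,|v|) |v|² dx` of a pressure gradient `v`. -/
noncomputable def dissipation (m : Medium U α) (v : m.L2A) : ℝ :=
  ∫ x in U, m.K x ‖v x‖ * ‖v x‖ ^ 2

/-- The energy `∫_U H(x,|v|) dx` of a pressure gradient `v`. -/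
noncomputable def energy (m : Medium U α) (v : m.L2A) : ℝ := ∫ x in U, m.H x ‖v x‖

theorem inner_fluxLp_self (hα : IsForchExponents α) (hU : MeasurableSet U) (v : m.L2A) :
    ⟪fluxLp hα hU v, v⟫ = dissipation m v := by
  rw [inner_fluxLp, dissipation]
  simp only [real_inner_self_eq_norm_sq]

theorem integrable_dissipation (hα : IsForchExponents α) (hU : MeasurableSet U) (v : m.L2A) :
    IntegrableOn (fun x => m.K x ‖v x‖ * ‖v x‖ ^ 2) U := by
  simpa only [real_inner_self_eq_norm_sq] using integrable_K_mul_inner hα hU v v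

theorem norm_sq_fluxLp_le_dissipation (hα : IsForchExponents α) (hU : MeasurableSet U)
    (v : m.L2A) : ‖fluxLp hα hU v‖ ^ 2 ≤ dissipation m v := by
  simpa only [fluxLp_zero, sub_zero, inner_fluxLp_self] using fluxLp_cocoercive hα hU v 0

theorem dissipation_nonneg (hα : IsForchExponents α) (hU : MeasurableSet U) (v : m.L2A) :
    0 ≤ dissipation m v :=
  (sq_nonneg _).trans (norm_sq_fluxLp_le_dissipation hα hU v)

theorem integrable_energy (hα : IsForchExponents α) (hU : MeasurableSet U) (v : m.L2A) :
    IntegrableOn (fun x => m.H x ‖v x‖) U := by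
  refine ((integrable_dissipation hα hU v).const_mul 2).mono'
    (m.aemeasurable_H hα hU (measurable_coeFn_L2A v).norm).aestronglyMeasurable ?_
  filter_upwards [m.ae_isForch hα hU] with x hx
  have hK := hx.K_pos (norm_nonneg (v x))
  have hH : 0 ≤ m.H x ‖v x‖ := le_trans (by positivity) (hx.K_mul_sq_le_H (norm_nonneg (v x)))
  rw [Real.norm_of_nonneg hH]
  exact hx.H_le_two_mul (norm_nonneg (v x))

theorem dissipation_le_energy (hα : IsForchExponents α) (hU : MeasurableSet U) (v : m.L2A) :
    dissipation m v ≤ energy m v := by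
  refine integral_mono_ae (integrable_dissipation hα hU v) (integrable_energy hα hU v) ?_
  filter_upwards [m.ae_isForch hα hU] with x hx
  exact hx.K_mul_sq_le_H (norm_nonneg (v x))

theorem energy_le_two_mul_dissipation (hα : IsForchExponents α) (hU : MeasurableSet U)
    (v : m.L2A) : energy m v ≤ 2 * dissipation m v := by
  rw [dissipation, ← integral_const_mul]
  refine integral_mono_ae (integrable_energy hα hU v)
    ((integrable_dissipation hα hU v).const_mul 2) ?_
  filter_upwards [m.ae_isForch hα hU] with x hx
  exact hx.H_le_two_mul (norm_nonneg (v x))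

theorem energy_nonneg (hα : IsForchExponents α) (hU : MeasurableSet U) (v : m.L2A) :
    0 ≤ energy m v :=
  (dissipation_nonneg hα hU v).trans (dissipation_le_energy hα hU v)

theorem inner_fluxLp_sub_le_energy_sub (hα : IsForchExponents α) (hU : MeasurableSet U)
    (v w : m.L2A) : 2 * ⟪fluxLp hα hU v, w - v⟫ ≤ energy m w - energy m v := by
  rw [inner_fluxLp, ← integral_const_mul, energy, energy,
    ← integral_sub (integrable_energy hα hU w) (integrable_energy hα hU v)]
  refine integral_mono_ae ((integrable_K_mul_inner hα hU v _).const_mul 2)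
    ((integrable_energy hα hU w).sub (integrable_energy hα hU v)) ?_
  filter_upwards [m.ae_isForch hα hU, coeFn_sub_L2A hU w v] with x hx hsub
  have hconvex := hx.inner_flux_sub_le_H_norm_sub (v x) (w x)
  rw [flux, real_inner_smul_left] at hconvex
  rwa [hsub]

theorem hasFDerivAt_energy (hα : IsForchExponents α) (hU : MeasurableSet U) (v : m.L2A) :
    HasFDerivAt (energy m) ((2 : ℝ) • innerSL ℝ (fluxLp hα hU v)) v := by
  rw [hasFDerivAt_iff_isLittleO_nhds_zero]
  have hquadratic : (fun w : m.L2A => energy m (v + w) - energy m v -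
      ((2 : ℝ) • innerSL ℝ (fluxLp hα hU v)) w) =O[𝓝 0] fun w => ‖w‖ ^ 2 := by
    refine Asymptotics.IsBigO.of_bound 2 (Eventually.of_forall fun w => ?_)
    have hlower := inner_fluxLp_sub_le_energy_sub hα hU v (v + w)
    have hupper := inner_fluxLp_sub_le_energy_sub hα hU (v + w) v
    have hlip := norm_fluxLp_sub_le hα hU (v + w) v
    have hcs := real_inner_le_norm (fluxLp hα hU (v + w) - fluxLp hα hU v) w
    rw [add_sub_cancel_left] at hlower hlip
    rw [sub_add_cancel_left, inner_neg_right] at hupper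
    rw [inner_sub_left] at hcs
    change ‖energy m (v + w) - energy m v - 2 * ⟪fluxLp hα hU v, w⟫‖ ≤ 2 * ‖‖w‖ ^ 2‖
    have hmul := mul_le_mul_of_nonneg_right hlip (norm_nonneg w)
    rw [Real.norm_eq_abs, Real.norm_of_nonneg (sq_nonneg _), abs_le]
    constructor <;> nlinarith
  exact hquadratic.trans_isLittleO (Asymptotics.isLittleO_norm_pow_id one_lt_two)

theorem hasDerivAt_energy (hα : IsForchExponents α) (hU : MeasurableSet U) {v : ℝ → m.L2A}
    {v' : m.L2A} {t : ℝ} (hv : HasDerivAt v v' t) :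
    HasDerivAt (fun s => energy m (v s)) (2 * ⟪fluxLp hα hU (v t), v'⟫) t :=
  (hasFDerivAt_energy hα hU (v t)).comp_hasDerivAt t hv

theorem continuous_energy (hα : IsForchExponents α) (hU : MeasurableSet U) :
    Continuous (energy m) :=
  continuous_iff_continuousAt.2 fun v => (hasFDerivAt_energy hα hU v).continuousAt

end Energy

section GradientModular

theorem Medium.measurable_coefMax (m : Medium U α) : Measurable m.coefMax := by
  have := Finset.measurable_sup' (s := Finset.univ) Finset.univ_nonempty
    (f := fun j x => m.coef j x) fun j _ => m.measurable_coef j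
  convert this using 1
  ext x
  rw [Medium.coefMax, Finset.sup'_apply]

theorem Medium.measurable_W1 (m : Medium U α) : Measurable m.W1 :=
  ((m.measurable_coef _).pow_const _).div (measurable_const.mul m.measurable_coefMax)

theorem Medium.ae_W1_nonneg (m : Medium U α) (hα : IsForchExponents α) (hU : MeasurableSet U) :
    ∀ᵐ x ∂volume.restrict U, 0 ≤ m.W1 x :=
  (m.ae_isForch hα hU).mono fun _ hx => hx.weight_nonneg

/-- `∫_U W₁ |v|^{2-a} dx`, a power of the norm of `v` in `L^{2-a}_{W₁}`. -/
noncomputable def gradModular (m : Medium U α) (v : m.L2A) : ℝ :=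
  ∫ x in U, m.W1 x * ‖v x‖ ^ (2 - expA α)

theorem ae_W1_mul_rpow_le (hα : IsForchExponents α) (hU : MeasurableSet U) (v : m.L2A) :
    ∀ᵐ x ∂volume.restrict U, m.W1 x * ‖v x‖ ^ (2 - expA α) ≤
      m.K x ‖v x‖ * ‖v x‖ ^ 2 + m.coef (Fin.last N) x / 2 := by
  filter_upwards [ae_restrict_mem hU] with x hx
  exact (m.isForch hα hx).weight_mul_rpow_le (m.coef_last_pos x hx) (norm_nonneg _)

theorem integrable_gradModular (hα : IsForchExponents α) (hU : MeasurableSet U) (v : m.L2A) :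
    IntegrableOn (fun x => m.W1 x * ‖v x‖ ^ (2 - expA α)) U := by
  refine ((integrable_dissipation hα hU v).add (m.integrable_coef_last.div_const 2)).mono'
    (m.measurable_W1.mul ((measurable_coeFn_L2A v).norm.pow_const _)).aestronglyMeasurable ?_
  filter_upwards [ae_W1_mul_rpow_le hα hU v, m.ae_W1_nonneg hα hU] with x hle hW
  rwa [Real.norm_of_nonneg (mul_nonneg hW (Real.rpow_nonneg (norm_nonneg _) _))]

theorem gradModular_nonneg (hα : IsForchExponents α) (hU : MeasurableSet U) (v : m.L2A) :
    0 ≤ gradModular m v := by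
  refine integral_nonneg_of_ae ?_
  filter_upwards [m.ae_W1_nonneg hα hU] with x hx
  exact mul_nonneg hx (Real.rpow_nonneg (norm_nonneg _) _)

theorem one_le_Bstar (m : Medium U α) : 1 ≤ Bstar m := le_max_right _ _

theorem integral_coef_last_le_Bstar (m : Medium U α) :
    ∫ x in U, m.coef (Fin.last N) x ≤ Bstar m :=
  le_max_left _ _

theorem gradModular_le (hα : IsForchExponents α) (hU : MeasurableSet U) (v : m.L2A) :
    gradModular m v ≤ dissipation m v + Bstar m :=
  calc gradModular m v
      ≤ ∫ x in U, (m.K x ‖v x‖ * ‖v x‖ ^ 2 + m.coef (Fin.last N) x / 2) := by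
        refine integral_mono_ae (integrable_gradModular hα hU v) ?_ (ae_W1_mul_rpow_le hα hU v)
        exact (integrable_dissipation hα hU v).add (m.integrable_coef_last.div_const 2)
    _ = dissipation m v + (∫ x in U, m.coef (Fin.last N) x) / 2 := by
        rw [integral_add (integrable_dissipation hα hU v) (m.integrable_coef_last.div_const 2),
          integral_div, dissipation]
    _ ≤ dissipation m v + Bstar m := by
        linarith [one_le_Bstar m, integral_coef_last_le_Bstar m]

end GradientModular

section GradientNorm

theorem gradModular_sub_le (hα : IsForchExponents α) (hU : MeasurableSet U) (v w : m.L2A) :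
    gradModular m (v - w) ≤ 2 * (gradModular m v + gradModular m w) := by
  have ha := hα.expA_pos
  have ha1 := hα.expA_lt_one
  have hv := integrable_gradModular hα hU v
  have hw := integrable_gradModular hα hU w
  unfold gradModular
  rw [← integral_add hv hw, ← integral_const_mul]
  refine integral_mono_ae (integrable_gradModular hα hU _) ((hv.add hw).const_mul 2) ?_
  filter_upwards [m.ae_W1_nonneg hα hU, coeFn_sub_L2A hU v w] with x hW hsub
  rw [hsub, ← mul_add, mul_left_comm]
  gcongr
  calc ‖v x - w x‖ ^ (2 - expA α) ≤ (‖v x‖ + ‖w x‖) ^ (2 - expA α) :=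
        Real.rpow_le_rpow (norm_nonneg _) (norm_sub_le _ _) (by linarith)
    _ ≤ 2 ^ (2 - expA α - 1) * (‖v x‖ ^ (2 - expA α) + ‖w x‖ ^ (2 - expA α)) :=
        mod_cast NNReal.rpow_add_le_mul_rpow_add_rpow ‖v x‖₊ ‖w x‖₊ (by linarith)
    _ ≤ 2 * (‖v x‖ ^ (2 - expA α) + ‖w x‖ ^ (2 - expA α)) := by
        gcongr
        exact (Real.rpow_le_rpow_of_exponent_le one_le_two (by linarith)).trans_eq
          (Real.rpow_one 2)

theorem wNorm_W1_nonneg (hα : IsForchExponents α) (hU : MeasurableSet U) (v : m.L2A) :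
    0 ≤ wNorm U m.W1 (2 - expA α) v :=
  Real.rpow_nonneg (gradModular_nonneg hα hU v) _

theorem wNorm_W1_rpow (hα : IsForchExponents α) (hU : MeasurableSet U) (v : m.L2A) :
    wNorm U m.W1 (2 - expA α) v ^ (2 - expA α) = gradModular m v := by
  change (gradModular m v ^ (1 / (2 - expA α))) ^ (2 - expA α) = _
  rw [one_div, Real.rpow_inv_rpow (gradModular_nonneg hα hU v) (by linarith [hα.expA_lt_one])]

theorem wNorm_W1_sq (hα : IsForchExponents α) (hU : MeasurableSet U) (v : m.L2A) :
    wNorm U m.W1 (2 - expA α) v ^ 2 = gradModular m v ^ (2 / (2 - expA α)) := by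
  change (gradModular m v ^ (1 / (2 - expA α))) ^ 2 = _
  rw [← Real.rpow_mul_natCast (gradModular_nonneg hα hU v), Nat.cast_ofNat, one_div_mul_eq_div]

end GradientNorm

section DegenerateMonotonicity

theorem integrable_K_mul_norm_sq (hα : IsForchExponents α) (hU : MeasurableSet U)
    {ξ : EuclideanSpace ℝ (Fin n) → ℝ} (hξ : Measurable ξ) (hξ0 : ∀ x, 0 ≤ ξ x) (u : m.L2A) :
    IntegrableOn (fun x => m.K x (ξ x) * ‖u x‖ ^ 2) U := by
  refine (integrable_norm_sq_L2A hU u).mono' ((m.aemeasurable_K hα hU hξ hξ0).mul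
    ((measurable_coeFn_L2A u).norm.pow_const 2).aemeasurable).aestronglyMeasurable ?_
  filter_upwards [m.ae_isForch hα hU] with x hx
  have hK : 0 < m.K x (ξ x) := hx.K_pos (hξ0 x)
  rw [Real.norm_of_nonneg (by positivity)]
  gcongr
  exact hx.K_le_inv (hξ0 x)

theorem gradModular_le_rpow_mul_rpow (hα : IsForchExponents α) (hU : MeasurableSet U)
    {ξ : EuclideanSpace ℝ (Fin n) → ℝ} (hξ : Measurable ξ) (hξ0 : ∀ x, 0 ≤ ξ x)
    (hint : IntegrableOn (fun x => m.K x (ξ x) * ξ x ^ 2) U) (u : m.L2A) :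
    gradModular m u ≤ (∫ x in U, m.K x (ξ x) * ‖u x‖ ^ 2) ^ ((2 - expA α) / 2) *
      (∫ x in U, (m.K x (ξ x) * ξ x ^ 2 + m.coef (Fin.last N) x / 2)) ^ (expA α / 2) := by
  have hθ : expA α / 2 = 1 - (2 - expA α) / 2 := by ring
  have ha := hα.expA_pos
  have ha1 := hα.expA_lt_one
  have hf := integrable_K_mul_norm_sq hα hU hξ hξ0 u
  have hg := hint.add (m.integrable_coef_last.div_const 2)
  have hf0 : 0 ≤ᵐ[volume.restrict U] fun x => m.K x (ξ x) * ‖u x‖ ^ 2 := by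
    filter_upwards [m.ae_isForch hα hU] with x hx
    exact mul_nonneg (hx.K_pos (hξ0 x)).le (sq_nonneg _)
  have hg0 : 0 ≤ᵐ[volume.restrict U]
      fun x => m.K x (ξ x) * ξ x ^ 2 + m.coef (Fin.last N) x / 2 := by
    filter_upwards [m.ae_isForch hα hU] with x hx
    exact add_nonneg (mul_nonneg (hx.K_pos (hξ0 x)).le (sq_nonneg _))
      (div_nonneg (hx.coeff_nonneg (Fin.last N)) zero_le_two)
  rw [hθ]
  refine le_trans ?_ (integral_rpow_mul_rpow_le (by linarith) (by linarith) hf hg hf0 hg0)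
  refine integral_mono_ae (integrable_gradModular hα hU u)
    (integrable_rpow_mul_rpow (by linarith) (by linarith) hf hg hf0 hg0) ?_
  filter_upwards [ae_restrict_mem hU] with x hx
  change m.W1 x * ‖u x‖ ^ (2 - expA α) ≤ _ ^ _ * _ ^ (1 - _)
  rw [← hθ]
  exact (m.isForch hα hx).weight_mul_rpow_le_rpow_mul_rpow (m.coef_last_pos x hx) (hξ0 x)
    (norm_nonneg (u x))

variable (v₁ v₂ : m.L2A)

theorem measurable_max_norm : Measurable fun x => max ‖v₁ x‖ ‖v₂ x‖ :=
  (measurable_coeFn_L2A v₁).norm.max (measurable_coeFn_L2A v₂).norm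

theorem ae_K_max_mul_sq_le (hα : IsForchExponents α) (hU : MeasurableSet U) :
    ∀ᵐ x ∂volume.restrict U, m.K x (max ‖v₁ x‖ ‖v₂ x‖) * max ‖v₁ x‖ ‖v₂ x‖ ^ 2 ≤
      m.K x ‖v₁ x‖ * ‖v₁ x‖ ^ 2 + m.K x ‖v₂ x‖ * ‖v₂ x‖ ^ 2 := by
  filter_upwards [m.ae_isForch hα hU] with x hx
  have hnonneg (v : m.L2A) : 0 ≤ m.K x ‖v x‖ * ‖v x‖ ^ 2 :=
    mul_nonneg (hx.K_pos (norm_nonneg _)).le (sq_nonneg _)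
  rcases max_choice ‖v₁ x‖ ‖v₂ x‖ with hmax | hmax <;> rw [hmax]
  exacts [le_add_of_nonneg_right (hnonneg v₂), le_add_of_nonneg_left (hnonneg v₁)]

theorem integrable_K_max_mul_sq (hα : IsForchExponents α) (hU : MeasurableSet U) :
    IntegrableOn (fun x => m.K x (max ‖v₁ x‖ ‖v₂ x‖) * max ‖v₁ x‖ ‖v₂ x‖ ^ 2) U := by
  have hmax := measurable_max_norm v₁ v₂
  have hmax0 : ∀ x, 0 ≤ max ‖v₁ x‖ ‖v₂ x‖ := fun x => le_max_of_le_left (norm_nonneg _)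
  refine ((integrable_dissipation hα hU v₁).add (integrable_dissipation hα hU v₂)).mono'
    ((m.aemeasurable_K hα hU hmax hmax0).mul
      (hmax.pow_const 2).aemeasurable).aestronglyMeasurable ?_
  filter_upwards [m.ae_isForch hα hU, ae_K_max_mul_sq_le v₁ v₂ hα hU] with x hx hle
  have hK : 0 < m.K x (max ‖v₁ x‖ ‖v₂ x‖) := hx.K_pos (hmax0 x)
  rwa [Real.norm_of_nonneg (mul_nonneg hK.le (sq_nonneg _))]

theorem integral_K_max_mul_sq_add_le (hα : IsForchExponents α) (hU : MeasurableSet U) :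
    ∫ x in U, (m.K x (max ‖v₁ x‖ ‖v₂ x‖) * max ‖v₁ x‖ ‖v₂ x‖ ^ 2
        + m.coef (Fin.last N) x / 2) ≤ dissipation m v₁ + dissipation m v₂ + Bstar m := by
  have hv₁ := integrable_dissipation hα hU v₁
  have hv₂ := integrable_dissipation hα hU v₂
  have hle : ∫ x in U, m.K x (max ‖v₁ x‖ ‖v₂ x‖) * max ‖v₁ x‖ ‖v₂ x‖ ^ 2 ≤
      dissipation m v₁ + dissipation m v₂ := by
    rw [dissipation, dissipation, ← integral_add hv₁ hv₂]
    exact integral_mono_ae (integrable_K_max_mul_sq v₁ v₂ hα hU) (hv₁.add hv₂)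
      (ae_K_max_mul_sq_le v₁ v₂ hα hU)
  rw [integral_add (integrable_K_max_mul_sq v₁ v₂ hα hU) (m.integrable_coef_last.div_const 2),
    integral_div]
  linarith [one_le_Bstar m, integral_coef_last_le_Bstar m]

theorem integral_K_max_mul_norm_sub_sq_le (hα : IsForchExponents α) (hU : MeasurableSet U)
    (w : m.L2A) :
    ∫ x in U, m.K x (max ‖v₁ x‖ ‖v₂ x‖) * ‖(v₁ - v₂ - w) x‖ ^ 2 ≤
      2 * fluxConst α * (⟪fluxLp hα hU v₁ - fluxLp hα hU v₂, v₁ - v₂⟫ + ‖w‖ ^ 2) := by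
  have hmax0 : ∀ x, 0 ≤ max ‖v₁ x‖ ‖v₂ x‖ := fun x => le_max_of_le_left (norm_nonneg _)
  have hinner := integrable_inner_L2A hU (fluxLp hα hU v₁ - fluxLp hα hU v₂) (v₁ - v₂)
  have hw := integrable_norm_sq_L2A hU w
  rw [norm_sq_L2A hU, inner_L2A hU, ← integral_add hinner hw, ← integral_const_mul]
  refine integral_mono_ae
    (integrable_K_mul_norm_sq hα hU (measurable_max_norm v₁ v₂) hmax0 _)
    ((hinner.add hw).const_mul _) ?_
  filter_upwards [m.ae_isForch hα hU, inner_coeFn_fluxLp_sub hα hU v₁ v₂ (v₁ - v₂),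
    coeFn_sub_L2A hU v₁ v₂, coeFn_sub_L2A hU (v₁ - v₂) w] with x hx hflux hv hvw
  rw [hflux, hvw, hv]
  exact hx.K_mul_norm_sub_sub_sq_le (v₁ x) (v₂ x) (w x)

theorem wNorm_W1_sub_sub_sq_le (hα : IsForchExponents α) (hU : MeasurableSet U) (w : m.L2A) :
    wNorm U m.W1 (2 - expA α) (v₁ - v₂ - w : m.L2A) ^ 2 ≤
      2 * fluxConst α * (⟪fluxLp hα hU v₁ - fluxLp hα hU v₂, v₁ - v₂⟫ + ‖w‖ ^ 2) *
        (dissipation m v₁ + dissipation m v₂ + Bstar m) ^ (expA α / (2 - expA α)) := by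
  have ha := hα.expA_pos
  have ha2 : 0 < 2 - expA α := by linarith [hα.expA_lt_one]
  have hmax0 : ∀ x, 0 ≤ max ‖v₁ x‖ ‖v₂ x‖ := fun x => le_max_of_le_left (norm_nonneg _)
  have hholder := gradModular_le_rpow_mul_rpow hα hU (measurable_max_norm v₁ v₂) hmax0
    (integrable_K_max_mul_sq v₁ v₂ hα hU) (v₁ - v₂ - w)
  have hF := integral_K_max_mul_norm_sub_sq_le v₁ v₂ hα hU w
  have hG := integral_K_max_mul_sq_add_le v₁ v₂ hα hU
  have hF0 : 0 ≤ ∫ x in U, m.K x (max ‖v₁ x‖ ‖v₂ x‖) * ‖(v₁ - v₂ - w) x‖ ^ 2 := by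
    refine integral_nonneg_of_ae ?_
    filter_upwards [m.ae_isForch hα hU] with x hx
    exact mul_nonneg (hx.K_pos (hmax0 x)).le (sq_nonneg _)
  have hG0 : 0 ≤ ∫ x in U, (m.K x (max ‖v₁ x‖ ‖v₂ x‖) * max ‖v₁ x‖ ‖v₂ x‖ ^ 2
      + m.coef (Fin.last N) x / 2) := by
    refine integral_nonneg_of_ae ?_
    filter_upwards [m.ae_isForch hα hU] with x hx
    exact add_nonneg (mul_nonneg (hx.K_pos (hmax0 x)).le (sq_nonneg _))
      (div_nonneg (hx.coeff_nonneg (Fin.last N)) zero_le_two)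
  rw [wNorm_W1_sq hα hU]
  set F := ∫ x in U, m.K x (max ‖v₁ x‖ ‖v₂ x‖) * ‖(v₁ - v₂ - w) x‖ ^ 2
  set G := ∫ x in U, (m.K x (max ‖v₁ x‖ ‖v₂ x‖) * max ‖v₁ x‖ ‖v₂ x‖ ^ 2
      + m.coef (Fin.last N) x / 2)
  calc gradModular m (v₁ - v₂ - w) ^ (2 / (2 - expA α))
      ≤ (F ^ ((2 - expA α) / 2) * G ^ (expA α / 2)) ^ (2 / (2 - expA α)) :=
        Real.rpow_le_rpow (gradModular_nonneg hα hU _) hholder (by positivity)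
    _ = F * G ^ (expA α / (2 - expA α)) := by
        rw [Real.mul_rpow (by positivity) (by positivity), ← Real.rpow_mul hF0,
          ← Real.rpow_mul hG0, div_mul_div_cancel₀ two_ne_zero, div_self ha2.ne', Real.rpow_one,
          div_mul_div_cancel₀ two_ne_zero]
    _ ≤ _ := mul_le_mul hF (Real.rpow_le_rpow hG0 hG (by positivity))
        (Real.rpow_nonneg hG0 _) (hF0.trans hF)

end DegenerateMonotonicity

section WeakFormulation

theorem gradient_add {E : Type*} [NormedAddCommGroup E] [InnerProductSpace ℝ E] [CompleteSpace E]
    {f g : E → ℝ} (hf : Differentiable ℝ f) (hg : Differentiable ℝ g) :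
    gradient (f + g) = gradient f + gradient g := by
  ext1 x
  simp [gradient, fderiv_add (hf x) (hg x)]

theorem gradient_const_smul {E : Type*} [NormedAddCommGroup E] [InnerProductSpace ℝ E]
    [CompleteSpace E] {f : E → ℝ} (hf : Differentiable ℝ f) (c : ℝ) :
    gradient (c • f) = c • gradient f := by
  ext1 x
  simp [gradient, fderiv_const_smul (hf x)]

theorem IsTestFunction.differentiable {η : EuclideanSpace ℝ (Fin n) → ℝ}
    (hη : IsTestFunction U η) : Differentiable ℝ η :=
  hη.1.differentiable (by simp)

theorem IsAdmissibleTest.zero (m : Medium U α) : IsAdmissibleTest m 0 :=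
  ⟨⟨contDiff_const, HasCompactSupport.zero, by simp⟩,
    (congrArg (MemLp · 2 m.muA) (gradient_const' (0 : ℝ))).mpr MemLp.zero'⟩

theorem IsAdmissibleTest.add {η ζ : EuclideanSpace ℝ (Fin n) → ℝ}
    (hη : IsAdmissibleTest m η) (hζ : IsAdmissibleTest m ζ) : IsAdmissibleTest m (η + ζ) := by
  refine ⟨⟨hη.1.1.add hζ.1.1, hη.1.2.1.add hζ.1.2.1,
    (tsupport_add η ζ).trans (union_subset hη.1.2.2 hζ.1.2.2)⟩, ?_⟩
  rw [gradient_add hη.1.differentiable hζ.1.differentiable]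
  exact hη.2.add hζ.2

theorem IsAdmissibleTest.smul {η : EuclideanSpace ℝ (Fin n) → ℝ}
    (hη : IsAdmissibleTest m η) (c : ℝ) : IsAdmissibleTest m (c • η) := by
  refine ⟨⟨contDiff_const.smul hη.1.1, hη.1.2.1.smul_left (f := fun _ => c),
    (tsupport_smul_subset_right (fun _ => c) η).trans hη.1.2.2⟩, ?_⟩
  rw [gradient_const_smul hη.1.differentiable]
  exact hη.2.const_smul c

/-- The subspace of pairs `(η, ∇η)` in `L²_φ × L²_{1/a₀}` with `η` an admissible test function;
its closure is the condition `VanishesOnBoundary`. -/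
noncomputable def testPairs (m : Medium U α) (hU : MeasurableSet U) :
    Submodule ℝ (m.L2Phi × m.L2A) where
  carrier := {w | ∃ η, IsAdmissibleTest m η ∧
    w.1 =ᵐ[volume.restrict U] η ∧ w.2 =ᵐ[volume.restrict U] gradient η}
  zero_mem' := by
    refine ⟨0, IsAdmissibleTest.zero m, ?_, ?_⟩
    · rw [EventuallyEq, ← m.ae_muPhi hU]
      exact Lp.coeFn_zero _ _ _
    · rw [show gradient (0 : EuclideanSpace ℝ (Fin n) → ℝ) = 0 from gradient_const' (0 : ℝ),
        EventuallyEq, ← m.ae_muA hU]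
      exact Lp.coeFn_zero _ _ _
  add_mem' := by
    rintro w z ⟨η, hη, hw, hw'⟩ ⟨ζ, hζ, hz, hz'⟩
    have hadd := Lp.coeFn_add w.1 z.1
    have hadd' := Lp.coeFn_add w.2 z.2
    rw [EventuallyEq, m.ae_muPhi hU] at hadd
    rw [EventuallyEq, m.ae_muA hU] at hadd'
    refine ⟨η + ζ, hη.add hζ, EventuallyEq.trans hadd (hw.add hz), ?_⟩
    rw [gradient_add hη.1.differentiable hζ.1.differentiable]
    exact EventuallyEq.trans hadd' (hw'.add hz')
  smul_mem' := by
    rintro c w ⟨η, hη, hw, hw'⟩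
    have hsmul := Lp.coeFn_smul c w.1
    have hsmul' := Lp.coeFn_smul c w.2
    rw [EventuallyEq, m.ae_muPhi hU] at hsmul
    rw [EventuallyEq, m.ae_muA hU] at hsmul'
    refine ⟨c • η, hη.smul c, EventuallyEq.trans hsmul (hw.const_smul c), ?_⟩
    rw [gradient_const_smul hη.1.differentiable]
    exact EventuallyEq.trans hsmul' (hw'.const_smul c)

/-- The closed subspace of pairs `(u, ∇u)` such that `u` vanishes on the boundary of `U`. -/
noncomputable def zeroTrace (m : Medium U α) (hU : MeasurableSet U) :
    Submodule ℝ (m.L2Phi × m.L2A) :=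
  (testPairs m hU).topologicalClosure

theorem SolvesEquation.inner_dval (hα : IsForchExponents α) (hU : MeasurableSet U)
    {p : RegularPath m} (hp : SolvesEquation m p) {t : ℝ} (ht : 0 < t) {w : m.L2Phi × m.L2A}
    (hw : w ∈ zeroTrace m hU) : ⟪p.dval t, w.1⟫ = -⟪fluxLp hα hU (p.grad t), w.2⟫ := by
  have hclosed : IsClosed {w : m.L2Phi × m.L2A |
      ⟪p.dval t, w.1⟫ = -⟪fluxLp hα hU (p.grad t), w.2⟫} :=
    isClosed_eq (continuous_const.inner continuous_fst)
      (continuous_const.inner continuous_snd).neg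
  refine closure_minimal ?_ hclosed hw
  rintro z ⟨η, hη, hz, hz'⟩
  rw [mem_ofPred_eq, inner_L2Phi hU, inner_fluxLp hα hU]
  convert hp t ht η hη using 1
  · refine integral_congr_ae ?_
    filter_upwards [hz] with x hx
    rw [hx, mul_assoc, real_inner_comm]
    rfl
  · refine congrArg Neg.neg (integral_congr_ae ?_)
    filter_upwards [hz'] with x hx
    rw [hx]

theorem hasDerivAt_mem_of_isClosed {E : Type*} [NormedAddCommGroup E] [NormedSpace ℝ E]
    {V : Submodule ℝ E} (hV : IsClosed (V : Set E)) {f : ℝ → E} {f' : E} {t : ℝ}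
    (hf : HasDerivAt f f' t) (hmem : ∀ᶠ s in 𝓝 t, f s ∈ V) : f' ∈ V := by
  refine hV.mem_of_tendsto (hasDerivAt_iff_tendsto_slope.1 hf) ?_
  filter_upwards [nhdsWithin_le_nhds hmem] with s hs
  exact V.smul_mem _ (V.sub_mem hs hmem.self_of_nhds)

end WeakFormulation

section Data

variable (Ψ Ψ₁ Ψ₂ : RegularPath m) (t : ℝ)

theorem G_eq (hU : MeasurableSet U) :
    G m Ψ t = Bstar m + ‖Ψ.grad t‖ ^ 2 + gradModular m (Ψ.grad t)
      + (‖Ψ.dval t‖ ^ 2) ^ ((2 - expA α) / (2 * (1 - expA α))) := by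
  rw [norm_sq_L2A hU, norm_sq_L2Phi hU]
  rfl

theorem G1_eq (hU : MeasurableSet U) : G1 m Ψ t = ‖Ψ.dgrad t‖ ^ 2 :=
  (norm_sq_L2A hU _).symm

theorem G2_eq (hU : MeasurableSet U) : G2 m Ψ t = ‖Ψ.ddval t‖ ^ 2 :=
  (norm_sq_L2Phi hU _).symm

theorem D_eq (hU : MeasurableSet U) :
    D m Ψ₁ Ψ₂ t = ‖Ψ₁.grad t - Ψ₂.grad t‖ ^ 2 + ‖Ψ₁.grad t - Ψ₂.grad t‖
      + ‖Ψ₁.dval t - Ψ₂.dval t‖ := by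
  unfold D
  rw [← norm_sq_L2A hU, ← norm_sq_L2Phi hU, ← Real.sqrt_eq_rpow, ← Real.sqrt_eq_rpow,
    Real.sqrt_sq (norm_nonneg _), Real.sqrt_sq (norm_nonneg _)]

theorem Bstar_add_gradModular_le_G (hU : MeasurableSet U) :
    Bstar m + gradModular m (Ψ.grad t) ≤ G m Ψ t := by
  rw [G_eq Ψ t hU]
  have : 0 ≤ (‖Ψ.dval t‖ ^ 2) ^ ((2 - expA α) / (2 * (1 - expA α))) := by positivity
  linarith [sq_nonneg ‖Ψ.grad t‖]

theorem Bstar_le_G (hα : IsForchExponents α) (hU : MeasurableSet U) : Bstar m ≤ G m Ψ t :=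
  (le_add_of_nonneg_right (gradModular_nonneg hα hU _)).trans (Bstar_add_gradModular_le_G Ψ t hU)

theorem one_le_G (hα : IsForchExponents α) (hU : MeasurableSet U) : 1 ≤ G m Ψ t :=
  (one_le_Bstar m).trans (Bstar_le_G Ψ t hα hU)

theorem norm_sq_grad_le_G (hα : IsForchExponents α) (hU : MeasurableSet U) :
    ‖Ψ.grad t‖ ^ 2 ≤ G m Ψ t := by
  rw [G_eq Ψ t hU]
  have : 0 ≤ (‖Ψ.dval t‖ ^ 2) ^ ((2 - expA α) / (2 * (1 - expA α))) := by positivity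
  linarith [one_le_Bstar m, gradModular_nonneg hα hU (Ψ.grad t)]

theorem norm_dval_rpow_le_G (hα : IsForchExponents α) (hU : MeasurableSet U) :
    ‖Ψ.dval t‖ ^ ((2 - expA α) / (1 - expA α)) ≤ G m Ψ t := by
  have hpow : ‖Ψ.dval t‖ ^ ((2 - expA α) / (1 - expA α)) =
      (‖Ψ.dval t‖ ^ 2) ^ ((2 - expA α) / (2 * (1 - expA α))) := by
    rw [← Real.rpow_natCast_mul (norm_nonneg _), Nat.cast_ofNat, mul_div_assoc',
      mul_div_mul_left _ _ two_ne_zero]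
  rw [G_eq Ψ t hU, hpow]
  linarith [one_le_Bstar m, gradModular_nonneg hα hU (Ψ.grad t), sq_nonneg ‖Ψ.grad t‖]

theorem norm_sq_dval_le_G (hα : IsForchExponents α) (hU : MeasurableSet U) :
    ‖Ψ.dval t‖ ^ 2 ≤ G m Ψ t := by
  rcases le_total ‖Ψ.dval t‖ 1 with hle | hle
  · exact (pow_le_one₀ (norm_nonneg _) hle).trans (one_le_G Ψ t hα hU)
  · refine le_trans ?_ (norm_dval_rpow_le_G Ψ t hα hU)
    have ha := hα.expA_pos
    have ha1 := hα.expA_lt_one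
    rw [← Real.rpow_natCast, Nat.cast_ofNat]
    refine Real.rpow_le_rpow_of_exponent_le hle ?_
    rw [le_div_iff₀ (by linarith)]
    linarith

end Data

section EnergyInequalities

theorem exists_mul_le_mul_rpow_add_mul_rpow {p q : ℝ} (hpq : p.HolderConjugate q) {ε : ℝ}
    (hε : 0 < ε) :
    ∃ C, 0 < C ∧ ∀ x y : ℝ, 0 ≤ x → 0 ≤ y → x * y ≤ ε * x ^ p + C * y ^ q := by
  set δ := ε ^ p⁻¹
  have hδ : 0 < δ := Real.rpow_pos_of_pos hε _
  refine ⟨δ⁻¹ ^ q, by positivity, fun x y hx hy => ?_⟩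
  calc x * y = δ * x * (δ⁻¹ * y) := by field_simp
    _ ≤ (δ * x) ^ p / p + (δ⁻¹ * y) ^ q / q :=
        Real.young_inequality_of_nonneg (by positivity) (by positivity) hpq
    _ ≤ (δ * x) ^ p + (δ⁻¹ * y) ^ q :=
        add_le_add (div_le_self (by positivity) hpq.lt.le)
          (div_le_self (by positivity) hpq.symm.lt.le)
    _ = ε * x ^ p + δ⁻¹ ^ q * y ^ q := by
        rw [Real.mul_rpow hδ.le hx, Real.mul_rpow (by positivity) hy,
          Real.rpow_inv_rpow hε.le hpq.pos.ne']

theorem IsForchExponents.holderConjugate (hα : IsForchExponents α) :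
    (2 - expA α).HolderConjugate ((2 - expA α) / (1 - expA α)) := by
  have ha1 := sub_pos.2 hα.expA_lt_one
  have : 2 - expA α = 1 + (1 - expA α) := by ring
  rw [Real.holderConjugate_iff, this]
  refine ⟨by linarith, ?_⟩
  field_simp

/-- `p` solves the initial boundary value problem with boundary data `Ψ`, and `p̄ = p - Ψ`
satisfies the Poincaré–Sobolev inequality with constant `cP` at all positive times. -/
structure IsPoincareSolution (m : Medium U α) (cP : ℝ) (p Ψ : RegularPath m) : Prop where
  isSolution : IsSolution m p Ψ
  poincare : ∀ t, 0 < t → PoincareSobolev m cP (p.val t - Ψ.val t) (p.grad t - Ψ.grad t)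

namespace IsPoincareSolution

variable {cP : ℝ} {p Ψ : RegularPath m} {s t : ℝ}

theorem norm_val_sub_rpow_le (hα : IsForchExponents α) (hU : MeasurableSet U) (hcP : 0 ≤ cP)
    (hp : IsPoincareSolution m cP p Ψ) (ht : 0 < t) :
    ‖p.val t - Ψ.val t‖ ^ (2 - expA α) ≤
      2 * cP ^ (2 - expA α) * (dissipation m (p.grad t) + G m Ψ t) := by
  have hpoincare := hp.poincare t ht
  rw [PoincareSobolev, wNorm_phi hU] at hpoincare
  calc ‖p.val t - Ψ.val t‖ ^ (2 - expA α)
      ≤ (cP * wNorm U m.W1 (2 - expA α) (p.grad t - Ψ.grad t : m.L2A)) ^ (2 - expA α) :=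
        Real.rpow_le_rpow (norm_nonneg _) hpoincare (by linarith [hα.expA_lt_one])
    _ = cP ^ (2 - expA α) * gradModular m (p.grad t - Ψ.grad t) := by
        rw [Real.mul_rpow hcP (wNorm_W1_nonneg hα hU _), wNorm_W1_rpow hα hU]
    _ ≤ cP ^ (2 - expA α) * (2 * (gradModular m (p.grad t) + gradModular m (Ψ.grad t))) := by
        gcongr
        exact gradModular_sub_le hα hU _ _
    _ ≤ cP ^ (2 - expA α) * (2 * (dissipation m (p.grad t) + G m Ψ t)) := by
        gcongr ?_ * (2 * ?_)
        linarith [gradModular_le hα hU (p.grad t), Bstar_add_gradModular_le_G Ψ t hU]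
    _ = _ := by ring

theorem mem_zeroTrace (hU : MeasurableSet U) (hp : IsPoincareSolution m cP p Ψ) (ht : 0 < t) :
    (p.val t - Ψ.val t, p.grad t - Ψ.grad t) ∈ zeroTrace m hU :=
  hp.isSolution.2 t ht

theorem deriv_mem_zeroTrace (hU : MeasurableSet U) (hp : IsPoincareSolution m cP p Ψ)
    (ht : 0 < t) : (p.dval t - Ψ.dval t, p.dgrad t - Ψ.dgrad t) ∈ zeroTrace m hU :=
  hasDerivAt_mem_of_isClosed (testPairs m hU).isClosed_topologicalClosure
    (((p.hasDerivAt_val t ht).sub (Ψ.hasDerivAt_val t ht)).prodMk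
      ((p.hasDerivAt_grad t ht).sub (Ψ.hasDerivAt_grad t ht)))
    ((lt_mem_nhds ht).mono fun _ hs => hp.mem_zeroTrace hU hs)

theorem two_mul_inner_val_sub_le (hα : IsForchExponents α) (hU : MeasurableSet U)
    (hp : IsPoincareSolution m cP p Ψ) (ht : 0 < t) :
    2 * ⟪p.val t - Ψ.val t, p.dval t - Ψ.dval t⟫ ≤ -(3 / 2) * dissipation m (p.grad t)
      + 2 * ‖Ψ.grad t‖ ^ 2 + 2 * (‖p.val t - Ψ.val t‖ * ‖Ψ.dval t‖) := by
  have hweak := hp.isSolution.1.inner_dval hα hU ht (hp.mem_zeroTrace hU ht)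
  rw [inner_sub_right (fluxLp hα hU (p.grad t)), inner_fluxLp_self] at hweak
  have hflux := norm_sq_fluxLp_le_dissipation hα hU (p.grad t)
  have hdata := real_inner_le_norm (fluxLp hα hU (p.grad t)) (Ψ.grad t)
  have htime := neg_le_of_abs_le (abs_real_inner_le_norm (Ψ.dval t) (p.val t - Ψ.val t))
  rw [real_inner_comm, inner_sub_left, hweak]
  linarith [sq_nonneg (‖fluxLp hα hU (p.grad t)‖ / 2 - ‖Ψ.grad t‖),
    mul_comm ‖Ψ.dval t‖ ‖p.val t - Ψ.val t‖]

theorem two_mul_inner_fluxLp_dgrad_le (hα : IsForchExponents α) (hU : MeasurableSet U)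
    (hp : IsPoincareSolution m cP p Ψ) (ht : 0 < t) :
    2 * ⟪fluxLp hα hU (p.grad t), p.dgrad t⟫ ≤ dissipation m (p.grad t) / 2
      + 2 * ‖Ψ.dgrad t‖ ^ 2 + ‖Ψ.dval t‖ ^ 2 - ‖p.dval t - Ψ.dval t‖ ^ 2 := by
  have hweak := hp.isSolution.1.inner_dval hα hU ht (hp.deriv_mem_zeroTrace hU ht)
  rw [inner_sub_right (fluxLp hα hU (p.grad t))] at hweak
  have hsplit := real_inner_self_eq_norm_sq (p.dval t - Ψ.dval t)
  rw [inner_sub_left] at hsplit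
  have hflux := norm_sq_fluxLp_le_dissipation hα hU (p.grad t)
  have hdata := real_inner_le_norm (fluxLp hα hU (p.grad t)) (Ψ.dgrad t)
  have htime := neg_le_of_abs_le (abs_real_inner_le_norm (Ψ.dval t) (p.dval t - Ψ.dval t))
  linarith [sq_nonneg (‖fluxLp hα hU (p.grad t)‖ / 2 - ‖Ψ.dgrad t‖),
    sq_nonneg (‖Ψ.dval t‖ - ‖p.dval t - Ψ.dval t‖)]

theorem inner_dval_sub_le (hα : IsForchExponents α) (hU : MeasurableSet U)
    (hp : IsPoincareSolution m cP p Ψ) (hs : 0 < s) (ht : 0 < t) :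
    ⟪p.dval s - p.dval t, (p.val s - Ψ.val s) - (p.val t - Ψ.val t)⟫ ≤
      1 / 4 * ‖Ψ.grad s - Ψ.grad t‖ ^ 2 := by
  have hmem := (zeroTrace m hU).sub_mem (hp.mem_zeroTrace hU hs) (hp.mem_zeroTrace hU ht)
  have hgrad : (p.grad s - Ψ.grad s) - (p.grad t - Ψ.grad t) =
    (p.grad s - p.grad t) - (Ψ.grad s - Ψ.grad t) := by abel
  have hweak : ⟪p.dval s - p.dval t, (p.val s - Ψ.val s) - (p.val t - Ψ.val t)⟫ =
      -⟪fluxLp hα hU (p.grad s) - fluxLp hα hU (p.grad t),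
        (p.grad s - p.grad t) - (Ψ.grad s - Ψ.grad t)⟫ := by
    have hweak_s := hp.isSolution.1.inner_dval hα hU hs hmem
    have hweak_t := hp.isSolution.1.inner_dval hα hU ht hmem
    rw [Prod.fst_sub, Prod.snd_sub, hgrad] at hweak_s hweak_t
    rw [inner_sub_left, hweak_s, hweak_t, inner_sub_left]
    ring
  have hcocoercive := fluxLp_cocoercive hα hU (p.grad s) (p.grad t)
  have hdata := real_inner_le_norm (fluxLp hα hU (p.grad s) - fluxLp hα hU (p.grad t))
    (Ψ.grad s - Ψ.grad t)
  rw [hweak, inner_sub_right]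
  linarith [sq_nonneg (‖fluxLp hα hU (p.grad s) - fluxLp hα hU (p.grad t)‖ -
    1 / 2 * ‖Ψ.grad s - Ψ.grad t‖)]

-- The equation need not be differentiable in time: the bound is proved for difference quotients,
-- where the flux only enters through its monotonicity, and then passed to the limit.
theorem inner_ddval_le (hα : IsForchExponents α) (hU : MeasurableSet U)
    (hp : IsPoincareSolution m cP p Ψ) (ht : 0 < t) :
    ⟪p.ddval t, p.dval t - Ψ.dval t⟫ ≤ 1 / 4 * ‖Ψ.dgrad t‖ ^ 2 := by
  have hdval := hasDerivAt_iff_tendsto_slope.1 (p.hasDerivAt_dval t ht)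
  have hval := hasDerivAt_iff_tendsto_slope.1
    ((p.hasDerivAt_val t ht).sub (Ψ.hasDerivAt_val t ht))
  have hgrad := hasDerivAt_iff_tendsto_slope.1 (Ψ.hasDerivAt_grad t ht)
  refine le_of_tendsto_of_tendsto (hdval.inner hval) ((hgrad.norm.pow 2).const_mul (1 / 4)) ?_
  filter_upwards [nhdsWithin_le_nhds (lt_mem_nhds ht)] with s hs
  have hquotient := mul_le_mul_of_nonneg_left (hp.inner_dval_sub_le hα hU hs ht)
    (sq_nonneg (s - t)⁻¹)
  simp only [slope, vsub_eq_sub, real_inner_smul_left, real_inner_smul_right, norm_smul, mul_pow,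
    Pi.sub_apply, Real.norm_eq_abs, sq_abs]
  linarith

theorem two_mul_inner_dval_sub_le (hα : IsForchExponents α) (hU : MeasurableSet U)
    (hp : IsPoincareSolution m cP p Ψ) (ht : 0 < t) :
    2 * ⟪p.dval t - Ψ.dval t, p.ddval t - Ψ.ddval t⟫ ≤
      ‖Ψ.dgrad t‖ ^ 2 / 2 + ‖p.dval t - Ψ.dval t‖ ^ 2 + ‖Ψ.ddval t‖ ^ 2 := by
  have hdata := neg_le_of_abs_le (abs_real_inner_le_norm (Ψ.ddval t) (p.dval t - Ψ.dval t))
  rw [real_inner_comm, inner_sub_left]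
  linarith [hp.inner_ddval_le hα hU ht, sq_nonneg (‖Ψ.ddval t‖ - ‖p.dval t - Ψ.dval t‖)]

end IsPoincareSolution

/-- The energy `∫_U H(x, |∇p(t)|) dx + ‖p̄(t)‖²` of a solution `p` with boundary data `Ψ`. -/
noncomputable def totalEnergy (p Ψ : RegularPath m) (t : ℝ) : ℝ :=
  energy m (p.grad t) + ‖p.val t - Ψ.val t‖ ^ 2

section Derivatives

variable (p Ψ : RegularPath m) {t : ℝ}

theorem continuousOn_norm_sq_val_sub :
    ContinuousOn (fun s => ‖p.val s - Ψ.val s‖ ^ 2) (Ici 0) :=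
  (p.continuousOn_val.sub Ψ.continuousOn_val).norm.pow 2

theorem hasDerivAt_norm_sq_val_sub (ht : 0 < t) :
    HasDerivAt (fun s => ‖p.val s - Ψ.val s‖ ^ 2)
      (2 * ⟪p.val t - Ψ.val t, p.dval t - Ψ.dval t⟫) t :=
  ((p.hasDerivAt_val t ht).fun_sub (Ψ.hasDerivAt_val t ht)).norm_sq

theorem hasDerivAt_norm_sq_dval_sub (ht : 0 < t) :
    HasDerivAt (fun s => ‖p.dval s - Ψ.dval s‖ ^ 2)
      (2 * ⟪p.dval t - Ψ.dval t, p.ddval t - Ψ.ddval t⟫) t :=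
  ((p.hasDerivAt_dval t ht).fun_sub (Ψ.hasDerivAt_dval t ht)).norm_sq

variable (hα : IsForchExponents α) (hU : MeasurableSet U)
include hα hU

theorem continuousOn_totalEnergy : ContinuousOn (totalEnergy p Ψ) (Ici 0) :=
  ((continuous_energy hα hU).comp_continuousOn p.continuousOn_grad).add
    (continuousOn_norm_sq_val_sub p Ψ)

theorem totalEnergy_nonneg (t : ℝ) : 0 ≤ totalEnergy p Ψ t :=
  add_nonneg (energy_nonneg hα hU _) (sq_nonneg _)

theorem norm_sq_val_sub_le_totalEnergy (t : ℝ) : ‖p.val t - Ψ.val t‖ ^ 2 ≤ totalEnergy p Ψ t :=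
  le_add_of_nonneg_left (energy_nonneg hα hU _)

theorem hasDerivAt_totalEnergy (ht : 0 < t) :
    HasDerivAt (totalEnergy p Ψ) (2 * ⟪fluxLp hα hU (p.grad t), p.dgrad t⟫
      + 2 * ⟪p.val t - Ψ.val t, p.dval t - Ψ.dval t⟫) t :=
  (hasDerivAt_energy hα hU (p.hasDerivAt_grad t ht)).add (hasDerivAt_norm_sq_val_sub p Ψ ht)

end Derivatives

/-- The differential inequalities at time `t`, with constant `C`, satisfied by a solution `p` with
boundary data `Ψ`: they control `‖p̄‖²`, the energy and `‖p̄ₜ‖²`. The field `coercive` is the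
lower bound for the dissipation that the Poincaré–Sobolev inequality provides. -/
structure EnergyIneq (C : ℝ) (p Ψ : RegularPath m) (t : ℝ) : Prop where
  coercive : ‖p.val t - Ψ.val t‖ ^ (2 - expA α) ≤ C * (dissipation m (p.grad t) + G m Ψ t)
  deriv_val : deriv (fun s => ‖p.val s - Ψ.val s‖ ^ 2) t ≤
    -dissipation m (p.grad t) + C * G m Ψ t
  deriv_energy : deriv (totalEnergy p Ψ) t ≤
    -energy m (p.grad t) / 4 - ‖p.dval t - Ψ.dval t‖ ^ 2 + C * G m Ψ t + 2 * G1 m Ψ t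
  deriv_dval : deriv (fun s => ‖p.dval s - Ψ.dval s‖ ^ 2) t ≤
    G1 m Ψ t / 2 + ‖p.dval t - Ψ.dval t‖ ^ 2 + G2 m Ψ t

theorem exists_energyIneq (hα : IsForchExponents α) {cP : ℝ} (hcP : 0 < cP) :
    ∃ C : ℝ, 1 ≤ C ∧ ∀ {n : ℕ} {U : Set (EuclideanSpace ℝ (Fin n))}, MeasurableSet U →
      ∀ (m : Medium U α) (p Ψ : RegularPath m), IsPoincareSolution m cP p Ψ →
        ∀ t, 0 < t → EnergyIneq C p Ψ t := by
  have hk : 0 < 2 * cP ^ (2 - expA α) := by positivity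
  obtain ⟨c, hc, hyoung⟩ := exists_mul_le_mul_rpow_add_mul_rpow hα.holderConjugate
    (inv_pos.2 (mul_pos four_pos hk))
  refine ⟨2 * cP ^ (2 - expA α) + 2 * c + 4, by linarith, fun hU m p Ψ hp t ht => ?_⟩
  have hcoercive := hp.norm_val_sub_rpow_le hα hU hcP.le ht
  have hG := one_le_G Ψ t hα hU
  have hdiss := dissipation_nonneg hα hU (p.grad t)
  set k := 2 * cP ^ (2 - expA α)
  have habsorb : 2 * (‖p.val t - Ψ.val t‖ * ‖Ψ.dval t‖) ≤
      (dissipation m (p.grad t) + G m Ψ t) / 2 + 2 * c * G m Ψ t := by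
    have hval : (4 * k)⁻¹ * ‖p.val t - Ψ.val t‖ ^ (2 - expA α) ≤
        (dissipation m (p.grad t) + G m Ψ t) / 4 := by
      rw [inv_mul_le_iff₀ (by positivity)]
      linarith
    have hdval := mul_le_mul_of_nonneg_left (norm_dval_rpow_le_G Ψ t hα hU) hc.le
    linarith [hyoung _ _ (norm_nonneg (p.val t - Ψ.val t)) (norm_nonneg (Ψ.dval t))]
  have hval : 2 * ⟪p.val t - Ψ.val t, p.dval t - Ψ.dval t⟫ ≤
      -dissipation m (p.grad t) + (2 * c + 3) * G m Ψ t := by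
    linarith [hp.two_mul_inner_val_sub_le hα hU ht, norm_sq_grad_le_G Ψ t hα hU]
  have hkG : 0 ≤ k * G m Ψ t := by positivity
  constructor
  · refine hcoercive.trans (mul_le_mul_of_nonneg_right ?_ (by linarith))
    linarith
  · rw [(hasDerivAt_norm_sq_val_sub p Ψ ht).deriv]
    linarith
  · rw [(hasDerivAt_totalEnergy p Ψ hα hU ht).deriv, G1_eq Ψ t hU]
    linarith [hp.two_mul_inner_fluxLp_dgrad_le hα hU ht, norm_sq_dval_le_G Ψ t hα hU,
      energy_le_two_mul_dissipation hα hU (p.grad t)]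
  · rw [(hasDerivAt_norm_sq_dval_sub p Ψ ht).deriv, G1_eq Ψ t hU, G2_eq Ψ t hU]
    exact hp.two_mul_inner_dval_sub_le hα hU ht

end EnergyInequalities

section Comparison

variable {f : ℝ → ℝ} {a b L δ : ℝ}

theorem le_max_of_deriv_nonpos (hab : a ≤ b) (hf : ContinuousOn f (Icc a b))
    (hdiff : DifferentiableOn ℝ f (Ioo a b)) (hderiv : ∀ x ∈ Ioo a b, L < f x → deriv f x ≤ 0) :
    f b ≤ max (f a) L := by
  by_contra! hlt
  set S := Icc a b ∩ f ⁻¹' Iic (max (f a) L)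
  have hbdd : BddAbove S := ⟨b, fun x hx => hx.1.2⟩
  have hlast : sSup S ∈ S :=
    (hf.preimage_isClosed_of_isClosed isClosed_Icc isClosed_Iic).csSup_mem
      ⟨a, ⟨le_rfl, hab⟩, le_max_left (f a) L⟩ hbdd
  have habove : ∀ x ∈ Ioo (sSup S) b, L < f x := by
    intro x hx
    by_contra! hle
    exact (le_csSup hbdd ⟨⟨hlast.1.1.trans hx.1.le, hx.2.le⟩, le_max_of_le_right hle⟩).not_gt hx.1
  have hsub : Ioo (sSup S) b ⊆ Ioo a b := Ioo_subset_Ioo_left hlast.1.1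
  have hanti : AntitoneOn f (Icc (sSup S) b) := by
    refine antitoneOn_of_deriv_nonpos (convex_Icc _ b)
      (hf.mono (Icc_subset_Icc_left hlast.1.1)) ?_ ?_ <;> rw [interior_Icc]
    · exact hdiff.mono hsub
    · exact fun x hx => hderiv x (hsub hx) (habove x hx)
  have hdecrease := hanti (left_mem_Icc.2 hlast.1.2) (right_mem_Icc.2 hlast.1.2) hlast.1.2
  exact (hdecrease.trans hlast.2).not_gt hlt

theorem sub_le_mul_sub_of_deriv_le (hab : a ≤ b) (hf : ContinuousOn f (Icc a b))
    (hdiff : DifferentiableOn ℝ f (Ioo a b)) (hderiv : ∀ x ∈ Ioo a b, deriv f x ≤ L) :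
    f b - f a ≤ L * (b - a) := by
  rw [← interior_Icc] at hdiff hderiv
  exact (convex_Icc a b).image_sub_le_mul_sub_of_deriv_le hf hdiff hderiv
    a (left_mem_Icc.2 hab) b (right_mem_Icc.2 hab) hab

theorem eventually_le_of_deriv_le_neg (hδ : 0 < δ) (hdiff : ∀ᶠ x in atTop, DifferentiableAt ℝ f x)
    (hderiv : ∀ᶠ x in atTop, L < f x → deriv f x ≤ -δ) : ∀ᶠ x in atTop, f x ≤ L := by
  obtain ⟨T, hT⟩ := eventually_atTop.1 (hdiff.and hderiv)
  have hcont : ∀ a b, T ≤ a → ContinuousOn f (Icc a b) := fun a b ha x hx =>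
    (hT x (ha.trans hx.1)).1.continuousAt.continuousWithinAt
  have hdiffOn : ∀ a b, T ≤ a → DifferentiableOn ℝ f (Ioo a b) := fun a b ha x hx =>
    (hT x (ha.trans hx.1.le)).1.differentiableWithinAt
  obtain ⟨x₀, hx₀, hle⟩ : ∃ x, T ≤ x ∧ f x ≤ L := by
    by_contra! hgt
    have hTb : T ≤ T + (f T - L) / δ :=
      le_add_of_nonneg_right (div_nonneg (sub_nonneg.2 (hgt T le_rfl).le) hδ.le)
    have hdrop := sub_le_mul_sub_of_deriv_le hTb (hcont _ _ le_rfl) (hdiffOn _ _ le_rfl)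
      fun x hx => (hT x hx.1.le).2 (hgt x hx.1.le)
    rw [add_sub_cancel_left, neg_mul, mul_div_cancel₀ _ hδ.ne'] at hdrop
    linarith [hgt _ hTb]
  filter_upwards [eventually_ge_atTop x₀] with x hx
  refine (le_max_of_deriv_nonpos hx (hcont _ _ hx₀) (hdiffOn _ _ hx₀) fun y hy hLy => ?_).trans
    (max_le hle le_rfl)
  exact ((hT y (hx₀.trans hy.1.le)).2 hLy).trans (neg_nonpos.2 hδ.le)

end Comparison

theorem IsForchExponents.le_rpow_two_div (hα : IsForchExponents α) {g : ℝ} (hg : 1 ≤ g) :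
    g ≤ g ^ (2 / (2 - expA α)) := by
  refine Real.self_le_rpow_of_one_le hg ?_
  rw [le_div_iff₀ (by linarith [hα.expA_lt_one])]
  linarith [hα.expA_pos]

section EnergyBounds

variable {C : ℝ} {p Ψ : RegularPath m} {t g g₁ g₂ Y : ℝ}

namespace EnergyIneq

theorem deriv_norm_sq_val_sub_le (hα : IsForchExponents α) (hC : 1 ≤ C)
    (hI : EnergyIneq C p Ψ t) (hg : 1 ≤ g) (hG : G m Ψ t ≤ g)
    (hlt : (C * (2 + C) * g) ^ (2 / (2 - expA α)) < ‖p.val t - Ψ.val t‖ ^ 2) :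
    deriv (fun s => ‖p.val s - Ψ.val s‖ ^ 2) t ≤ -1 := by
  have ha : 0 < 2 - expA α := by linarith [hα.expA_lt_one]
  have hroot : C * (2 + C) * g < ‖p.val t - Ψ.val t‖ ^ (2 - expA α) := by
    rw [← Real.rpow_natCast] at hlt
    have hpow := Real.rpow_lt_rpow (by positivity) hlt (half_pos ha)
    rwa [← Real.rpow_mul (by positivity), ← Real.rpow_mul (by positivity),
      div_mul_div_cancel₀ ha.ne', div_self two_ne_zero, Real.rpow_one, Nat.cast_ofNat,
      mul_div_cancel₀ _ two_ne_zero] at hpow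
  have hdiss : (2 + C) * g < dissipation m (p.grad t) + G m Ψ t := by
    refine lt_of_mul_lt_mul_left ?_ (zero_le_one.trans hC)
    linarith [hI.coercive]
  nlinarith [hI.deriv_val]

theorem deriv_totalEnergy_le (hC : 1 ≤ C) (hI : EnergyIneq C p Ψ t) (hG : G m Ψ t ≤ g)
    (hG1 : G1 m Ψ t ≤ g₁) (hY : ‖p.val t - Ψ.val t‖ ^ 2 ≤ Y) :
    deriv (totalEnergy p Ψ) t ≤
      -totalEnergy p Ψ t / 4 + (Y / 4 + C * g + 2 * g₁) - ‖p.dval t - Ψ.dval t‖ ^ 2 := by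
  have := mul_le_mul_of_nonneg_left hG (zero_le_one.trans hC)
  have hderiv := hI.deriv_energy
  rw [totalEnergy]
  linarith

end EnergyIneq

variable (hα : IsForchExponents α) (hC : 1 ≤ C) (hI : ∀ s, 0 < s → EnergyIneq C p Ψ s)
include hα hC hI

section FiniteTime

theorem norm_sq_val_sub_le (hU : MeasurableSet U) (ht : 0 ≤ t) (hg : 1 ≤ g)
    (hG : ∀ s ∈ Icc 0 t, G m Ψ s ≤ g) :
    ‖p.val t - Ψ.val t‖ ^ 2 ≤
      totalEnergy p Ψ 0 + (C * (2 + C) * g) ^ (2 / (2 - expA α)) := by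
  have hL : 0 ≤ (C * (2 + C) * g) ^ (2 / (2 - expA α)) := by positivity
  refine (le_max_of_deriv_nonpos (f := fun s => ‖p.val s - Ψ.val s‖ ^ 2)
    (L := (C * (2 + C) * g) ^ (2 / (2 - expA α))) ht
    ((continuousOn_norm_sq_val_sub p Ψ).mono Icc_subset_Ici_self)
    (fun s hs => (hasDerivAt_norm_sq_val_sub p Ψ hs.1).differentiableAt.differentiableWithinAt)
    fun s hs hlt => ?_).trans (max_le ?_ ?_)
  · exact ((hI s hs.1).deriv_norm_sq_val_sub_le hα hC hg (hG s ⟨hs.1.le, hs.2.le⟩) hlt).trans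
      (by norm_num)
  · linarith [norm_sq_val_sub_le_totalEnergy p Ψ hα hU 0]
  · linarith [totalEnergy_nonneg p Ψ hα hU 0]

variable (hU : MeasurableSet U) (hG : ∀ s ∈ Icc 0 t, G m Ψ s ≤ g)
  (hG1 : ∀ s ∈ Icc 0 t, G1 m Ψ s ≤ g₁) (hY : ∀ s ∈ Icc 0 t, ‖p.val s - Ψ.val s‖ ^ 2 ≤ Y)
include hU hG hG1 hY

theorem totalEnergy_le_max (ht : 0 ≤ t) :
    totalEnergy p Ψ t ≤ max (totalEnergy p Ψ 0) (4 * (Y / 4 + C * g + 2 * g₁)) := by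
  refine le_max_of_deriv_nonpos ht
    ((continuousOn_totalEnergy p Ψ hα hU).mono Icc_subset_Ici_self)
    (fun s hs => (hasDerivAt_totalEnergy p Ψ hα hU hs.1).differentiableAt.differentiableWithinAt)
    fun s hs hlt => ?_
  have hs' : s ∈ Icc 0 t := Ioo_subset_Icc_self hs
  linarith [(hI s hs.1).deriv_totalEnergy_le hC (hG s hs') (hG1 s hs') (hY s hs'),
    sq_nonneg ‖p.dval s - Ψ.dval s‖]

variable (hG2 : ∀ s ∈ Icc 0 t, G2 m Ψ s ≤ g₂) (hg₁ : 0 ≤ g₁) (hg₂ : 0 ≤ g₂)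
include hG2 hg₁ hg₂

theorem sub_mul_norm_sq_dval_sub_le {r : ℝ} (hr : 0 < r) (hrt : r ≤ t) (htr : t - r ≤ 1) :
    (t - r) * ‖p.dval t - Ψ.dval t‖ ^ 2 ≤
      2 * totalEnergy p Ψ r + 2 * (Y / 4 + C * g + 3 * g₁ + g₂) * (t - r) := by
  have hderiv : ∀ s, 0 < s →
      HasDerivAt (fun s => totalEnergy p Ψ s + (s - r) * ‖p.dval s - Ψ.dval s‖ ^ 2 / 2)
        (deriv (totalEnergy p Ψ) s + (1 * ‖p.dval s - Ψ.dval s‖ ^ 2 +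
          (s - r) * deriv (fun s => ‖p.dval s - Ψ.dval s‖ ^ 2) s) / 2) s := fun s hs =>
    (hasDerivAt_totalEnergy p Ψ hα hU hs).differentiableAt.hasDerivAt.add
      ((((hasDerivAt_id s).sub_const r).mul
        (hasDerivAt_norm_sq_dval_sub p Ψ hs).differentiableAt.hasDerivAt).div_const 2)
  have hmean := sub_le_mul_sub_of_deriv_le (L := Y / 4 + C * g + 3 * g₁ + g₂) hrt
    (fun s hs => (hderiv s (hr.trans_le hs.1)).continuousAt.continuousWithinAt)
    (fun s hs => (hderiv s (hr.trans hs.1)).differentiableAt.differentiableWithinAt)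
    fun s hs => by
      have hs0 : 0 < s := hr.trans hs.1
      have hs' : s ∈ Icc 0 t := ⟨hs0.le, hs.2.le⟩
      rw [(hderiv s hs0).deriv]
      have hgrowth : (s - r) * deriv (fun s => ‖p.dval s - Ψ.dval s‖ ^ 2) s ≤
          1 * (g₁ / 2 + ‖p.dval s - Ψ.dval s‖ ^ 2 + g₂) :=
        mul_le_mul_of_nonneg (by linarith [hs.2])
          (by linarith [(hI s hs0).deriv_dval, hG1 s hs', hG2 s hs'])
          (sub_nonneg.2 hs.1.le) (by positivity)
      linarith [(hI s hs0).deriv_totalEnergy_le hC (hG s hs') (hG1 s hs') (hY s hs'),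
        totalEnergy_nonneg p Ψ hα hU s]
  simp only [sub_self, zero_mul, zero_div, add_zero] at hmean
  linarith [totalEnergy_nonneg p Ψ hα hU t]

theorem mul_norm_sq_dval_sub_le (ht : 0 < t) (ht1 : t ≤ 1) :
    t * ‖p.dval t - Ψ.dval t‖ ^ 2 ≤
      2 * totalEnergy p Ψ 0 + 2 * (Y / 4 + C * g + 3 * g₁ + g₂) * t := by
  have hsub : Tendsto (fun r : ℝ => t - r) (𝓝[>] 0) (𝓝 t) :=
    ((continuous_sub_left t).tendsto' 0 t (sub_zero t)).mono_left nhdsWithin_le_nhds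
  have henergy : Tendsto (totalEnergy p Ψ) (𝓝[>] 0) (𝓝 (totalEnergy p Ψ 0)) :=
    (continuousOn_totalEnergy p Ψ hα hU 0 self_mem_Ici).mono_left
      (nhdsWithin_mono _ Ioi_subset_Ici_self)
  refine le_of_tendsto_of_tendsto (hsub.mul_const _)
    ((henergy.const_mul 2).add (hsub.const_mul _)) ?_
  filter_upwards [Ioo_mem_nhdsGT ht] with r hr
  exact sub_mul_norm_sq_dval_sub_le hα hC hI hU hG hG1 hY hG2 hg₁ hg₂ hr.1 hr.2.le
    (by linarith [hr.1])

theorem norm_sq_dval_sub_le {t₀ : ℝ} (ht₀ : t₀ ∈ Ioc (0 : ℝ) 1) (ht : t₀ ≤ t) (hg : 0 ≤ g)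
    (hY0 : 0 ≤ Y) :
    ‖p.dval t - Ψ.dval t‖ ^ 2 ≤
      2 * (t₀⁻¹ * totalEnergy p Ψ 0) + 10 * (Y / 4 + C * g + 3 * g₁ + g₂) := by
  have ht_pos := ht₀.1.trans_le ht
  have hE := totalEnergy_nonneg p Ψ hα hU 0
  have hS : 0 ≤ Y / 4 + C * g + 3 * g₁ + g₂ := by positivity
  rcases le_or_gt t 1 with ht1 | ht1
  · have hbound := mul_norm_sq_dval_sub_le hα hC hI hU hG hG1 hY hG2 hg₁ hg₂ ht_pos ht1
    rw [← le_div_iff₀' ht_pos, add_div, mul_div_cancel_right₀ _ ht_pos.ne', mul_div_assoc,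
      div_eq_inv_mul] at hbound
    have hinv : t⁻¹ * totalEnergy p Ψ 0 ≤ t₀⁻¹ * totalEnergy p Ψ 0 :=
      mul_le_mul_of_nonneg_right (inv_anti₀ ht₀.1 ht) hE
    linarith
  · have hbound := sub_mul_norm_sq_dval_sub_le hα hC hI hU hG hG1 hY hG2 hg₁ hg₂
      (sub_pos.2 ht1) (by linarith) (by linarith)
    have hsub : Icc 0 (t - 1) ⊆ Icc 0 t := Icc_subset_Icc_right (by linarith)
    have henergy : totalEnergy p Ψ (t - 1) ≤
        totalEnergy p Ψ 0 + 4 * (Y / 4 + C * g + 2 * g₁) :=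
      (totalEnergy_le_max hα hC hI hU (fun s hs => hG s (hsub hs)) (fun s hs => hG1 s (hsub hs))
        (fun s hs => hY s (hsub hs)) (sub_pos.2 ht1).le).trans
        (max_le_add_of_nonneg hE (by positivity))
    have hinv : totalEnergy p Ψ 0 ≤ t₀⁻¹ * totalEnergy p Ψ 0 :=
      le_mul_of_one_le_left hE ((one_le_inv₀ ht₀.1).2 ht₀.2)
    rw [sub_sub_cancel, one_mul, mul_one] at hbound
    linarith

end FiniteTime

section LargeTime

variable (hG : ∀ᶠ s in atTop, G m Ψ s ≤ g)
include hG

theorem eventually_norm_sq_val_sub_le (hg : 1 ≤ g) :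
    ∀ᶠ s in atTop, ‖p.val s - Ψ.val s‖ ^ 2 ≤ (C * (2 + C) * g) ^ (2 / (2 - expA α)) := by
  refine eventually_le_of_deriv_le_neg one_pos ?_ ?_
  · filter_upwards [eventually_gt_atTop 0] with s hs
    exact (hasDerivAt_norm_sq_val_sub p Ψ hs).differentiableAt
  · filter_upwards [hG, eventually_gt_atTop 0] with s hGs hs hlt
    exact (hI s hs).deriv_norm_sq_val_sub_le hα hC hg hGs hlt

variable (hU : MeasurableSet U) (hG1 : ∀ᶠ s in atTop, G1 m Ψ s ≤ g₁)
  (hY : ∀ᶠ s in atTop, ‖p.val s - Ψ.val s‖ ^ 2 ≤ Y)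
include hU hG1 hY

theorem eventually_totalEnergy_le :
    ∀ᶠ s in atTop, totalEnergy p Ψ s ≤ 4 * (Y / 4 + C * g + 2 * g₁ + 1) := by
  refine eventually_le_of_deriv_le_neg one_pos ?_ ?_
  · filter_upwards [eventually_gt_atTop 0] with s hs
    exact (hasDerivAt_totalEnergy p Ψ hα hU hs).differentiableAt
  · filter_upwards [hG, hG1, hY, eventually_gt_atTop 0] with s hGs hG1s hYs hs hlt
    linarith [(hI s hs).deriv_totalEnergy_le hC hGs hG1s hYs, sq_nonneg ‖p.dval s - Ψ.dval s‖]

theorem eventually_totalEnergy_add_norm_sq_dval_sub_le (hG2 : ∀ᶠ s in atTop, G2 m Ψ s ≤ g₂) :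
    ∀ᶠ s in atTop, totalEnergy p Ψ s + ‖p.dval s - Ψ.dval s‖ ^ 2 / 2 ≤
      4 * (Y / 4 + C * g + 9 / 4 * g₁ + g₂ / 2 + 1) := by
  have hderiv : ∀ s, 0 < s →
      HasDerivAt (fun s => totalEnergy p Ψ s + ‖p.dval s - Ψ.dval s‖ ^ 2 / 2)
        (deriv (totalEnergy p Ψ) s + deriv (fun s => ‖p.dval s - Ψ.dval s‖ ^ 2) s / 2) s :=
    fun s hs => (hasDerivAt_totalEnergy p Ψ hα hU hs).differentiableAt.hasDerivAt.add
      ((hasDerivAt_norm_sq_dval_sub p Ψ hs).differentiableAt.hasDerivAt.div_const 2)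
  refine eventually_le_of_deriv_le_neg one_pos ?_ ?_
  · filter_upwards [eventually_gt_atTop 0] with s hs
    exact (hderiv s hs).differentiableAt
  · filter_upwards [hG, hG1, hG2, hY, eventually_gt_atTop 0] with s hGs hG1s hG2s hYs hs hlt
    rw [(hderiv s hs).deriv]
    linarith [(hI s hs).deriv_totalEnergy_le hC hGs hG1s hYs, (hI s hs).deriv_dval,
      sq_nonneg ‖p.dval s - Ψ.dval s‖]

end LargeTime
end EnergyBounds

theorem exists_energy_bound (hα : IsForchExponents α) {cP : ℝ} (hcP : 0 < cP) :
    ∃ C : ℝ, 1 ≤ C ∧ ∀ {n : ℕ} {U : Set (EuclideanSpace ℝ (Fin n))}, MeasurableSet U →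
      ∀ (m : Medium U α) (p Ψ : RegularPath m), IsPoincareSolution m cP p Ψ →
      ∀ t g g₁ : ℝ, 0 ≤ t → 1 ≤ g → 0 ≤ g₁ → (∀ s ∈ Icc 0 t, G m Ψ s ≤ g) →
        (∀ s ∈ Icc 0 t, G1 m Ψ s ≤ g₁) →
        totalEnergy p Ψ t ≤ C * (totalEnergy p Ψ 0 + g ^ (2 / (2 - expA α)) + g₁) ∧
        ∀ t₀ ∈ Ioc (0 : ℝ) 1, t₀ ≤ t → ∀ g₂ : ℝ, 0 ≤ g₂ → (∀ s ∈ Icc 0 t, G2 m Ψ s ≤ g₂) →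
          ‖p.dval t - Ψ.dval t‖ ^ 2 ≤
            C * (t₀⁻¹ * totalEnergy p Ψ 0 + g ^ (2 / (2 - expA α)) + g₁ + g₂) := by
  obtain ⟨C, hC, hI⟩ := exists_energyIneq hα hcP
  set k := (C * (2 + C)) ^ (2 / (2 - expA α))
  have hk : 0 ≤ k := by positivity
  refine ⟨40 + 10 * k + 10 * C, by linarith, fun hU m p Ψ hp t g g₁ ht hg hg₁ hG hG1 => ?_⟩
  have hE := totalEnergy_nonneg p Ψ hα hU 0
  have hY : ∀ s ∈ Icc 0 t, ‖p.val s - Ψ.val s‖ ^ 2 ≤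
      totalEnergy p Ψ 0 + k * g ^ (2 / (2 - expA α)) := fun s hs => by
    rw [← Real.mul_rpow (by positivity) (by positivity)]
    exact norm_sq_val_sub_le hα hC (hI hU m p Ψ hp) hU hs.1 hg
      fun r hr => hG r ⟨hr.1, hr.2.trans hs.2⟩
  have hgγ := hα.le_rpow_two_div hg
  set γ := g ^ (2 / (2 - expA α))
  have : 0 ≤ γ := by positivity
  have hCg : C * g ≤ C * γ := by gcongr
  have hproducts : 0 ≤ k * γ ∧ 0 ≤ C * γ ∧ 0 ≤ k * g₁ ∧ 0 ≤ C * g₁ := by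
    refine ⟨?_, ?_, ?_, ?_⟩ <;> positivity
  constructor
  · have hkE : 0 ≤ k * totalEnergy p Ψ 0 ∧ 0 ≤ C * totalEnergy p Ψ 0 := by
      constructor <;> positivity
    exact (totalEnergy_le_max hα hC (hI hU m p Ψ hp) hU hG hG1 hY ht).trans
      (max_le (by linarith) (by linarith))
  · intro t₀ ht₀ htt g₂ hg₂ hG2
    have hbound := norm_sq_dval_sub_le hα hC (hI hU m p Ψ hp) hU hG hG1 hY hG2 hg₁ hg₂ ht₀ htt
      (by linarith) (by positivity)
    have hinv : totalEnergy p Ψ 0 ≤ t₀⁻¹ * totalEnergy p Ψ 0 :=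
      le_mul_of_one_le_left hE ((one_le_inv₀ ht₀.1).2 ht₀.2)
    have : 0 ≤ t₀⁻¹ * totalEnergy p Ψ 0 := hE.trans hinv
    set E := t₀⁻¹ * totalEnergy p Ψ 0
    have hkE : 0 ≤ k * E ∧ 0 ≤ C * E ∧ 0 ≤ k * g₂ ∧ 0 ≤ C * g₂ := by
      refine ⟨?_, ?_, ?_, ?_⟩ <;> positivity
    linarith

theorem exists_eventually_energy_bound (hα : IsForchExponents α) {cP : ℝ} (hcP : 0 < cP) :
    ∃ C : ℝ, 1 ≤ C ∧ ∀ {n : ℕ} {U : Set (EuclideanSpace ℝ (Fin n))}, MeasurableSet U →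
      ∀ (m : Medium U α) (p Ψ : RegularPath m), IsPoincareSolution m cP p Ψ →
      ∀ g g₁ g₂ : ℝ, 1 ≤ g → 0 ≤ g₁ → 0 ≤ g₂ → (∀ᶠ s in atTop, G m Ψ s ≤ g) →
        (∀ᶠ s in atTop, G1 m Ψ s ≤ g₁) → (∀ᶠ s in atTop, G2 m Ψ s ≤ g₂) →
        ∀ᶠ t in atTop, totalEnergy p Ψ t ≤ C * (g ^ (2 / (2 - expA α)) + g₁) ∧
          ‖p.dval t - Ψ.dval t‖ ^ 2 ≤ C * (g ^ (2 / (2 - expA α)) + g₁ + g₂) := by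
  obtain ⟨C, hC, hI⟩ := exists_energyIneq hα hcP
  set k := (C * (2 + C)) ^ (2 / (2 - expA α))
  have hk : 0 ≤ k := by positivity
  refine ⟨40 + 10 * k + 10 * C, by linarith,
    fun hU m p Ψ hp g g₁ g₂ hg hg₁ hg₂ hG hG1 hG2 => ?_⟩
  have hY : ∀ᶠ s in atTop, ‖p.val s - Ψ.val s‖ ^ 2 ≤ k * g ^ (2 / (2 - expA α)) := by
    rw [← Real.mul_rpow (by positivity) (by positivity)]
    exact eventually_norm_sq_val_sub_le hα hC (hI hU m p Ψ hp) hG hg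
  have hgγ := hα.le_rpow_two_div hg
  set γ := g ^ (2 / (2 - expA α))
  have : 0 ≤ γ := by positivity
  have hCg : C * g ≤ C * γ := by gcongr
  have hproducts : 0 ≤ k * γ ∧ 0 ≤ C * γ ∧ 0 ≤ k * g₁ ∧ 0 ≤ C * g₁ ∧ 0 ≤ k * g₂ ∧
      0 ≤ C * g₂ := by
    refine ⟨?_, ?_, ?_, ?_, ?_, ?_⟩ <;> positivity
  filter_upwards [eventually_totalEnergy_le hα hC (hI hU m p Ψ hp) hG hU hG1 hY,
    eventually_totalEnergy_add_norm_sq_dval_sub_le hα hC (hI hU m p Ψ hp) hG hU hG1 hY hG2]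
    with s henergy hdval
  have := totalEnergy_nonneg p Ψ hα hU s
  constructor <;> linarith

section Calculus

theorem continuousOn_sSup_image_Icc {f : ℝ → ℝ} (hf : ContinuousOn f (Ici 0)) :
    ContinuousOn (fun t => sSup (f '' Icc 0 t)) (Ici 0) := by
  have himage : ∀ t ∈ Ici (0 : ℝ),
      f '' Icc 0 t = (fun r => f (max (t * r) 0)) '' Icc (0 : ℝ) 1 := by
    intro t ht
    have hscale : Icc (0 : ℝ) t = (fun r => t * r) '' Icc 0 1 := by
      rw [image_mul_left_Icc ht zero_le_one, mul_zero, mul_one]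
    rw [hscale, image_image]
    exact image_congr fun r hr => by rw [max_eq_left (mul_nonneg ht hr.1)]
  have hcont : Continuous fun t : ℝ =>
      sSup ((fun t r : ℝ => f (max (t * r) 0)) t '' Icc (0 : ℝ) 1) :=
    isCompact_Icc.continuous_sSup <|
      hf.comp_continuous ((continuous_fst.mul continuous_snd).max continuous_const)
        fun _ => mem_Ici.2 (le_max_right _ _)
  exact hcont.continuousOn.congr fun t ht => congrArg sSup (himage t ht)

theorem le_sSup_image_Icc {f : ℝ → ℝ} (hf : ContinuousOn f (Ici 0)) {s t : ℝ}
    (hs : s ∈ Icc 0 t) : f s ≤ sSup (f '' Icc 0 t) :=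
  le_csSup (isCompact_Icc.image_of_continuousOn (hf.mono Icc_subset_Ici_self)).bddAbove
    (mem_image_of_mem f hs)

theorem hasDerivAt_integral_of_continuousOn_Icc {k : ℝ → ℝ} {a b s : ℝ}
    (hk : ContinuousOn k (Icc a b)) (hs : s ∈ Ioo a b) :
    HasDerivAt (fun r => ∫ τ in a..r, k τ) (k s) s :=
  intervalIntegral.integral_hasDerivAt_right
    ((hk.mono (Icc_subset_Icc_right hs.2.le)).intervalIntegrable_of_Icc hs.1.le)
    ((hk.mono Ioo_subset_Icc_self).stronglyMeasurableAtFilter isOpen_Ioo s hs)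
    (hk.continuousAt (Icc_mem_nhds hs.1 hs.2))

theorem gronwall_le {k f w : ℝ → ℝ} {a b : ℝ} (hab : a ≤ b) (hk : ContinuousOn k (Icc a b))
    (hf : IntervalIntegrable f volume a b) (hw : ContinuousOn w (Icc a b))
    (hdiff : ∀ s ∈ Ioo a b, DifferentiableAt ℝ w s)
    (hderiv : ∀ s ∈ Ioo a b, deriv w s ≤ -k s * w s + f s) :
    w b ≤ Real.exp (-∫ τ in a..b, k τ) * w a +
      ∫ s in a..b, Real.exp (-∫ τ in s..b, k τ) * f s := by
  have hkint : ∀ s ∈ Icc a b, IntervalIntegrable k volume a s := fun s hs =>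
    (hk.mono (Icc_subset_Icc_right hs.2)).intervalIntegrable_of_Icc hs.1
  set E : ℝ → ℝ := fun s => ∫ τ in a..s, k τ
  have hEa : E a = 0 := intervalIntegral.integral_same
  have hE : ContinuousOn (fun s => Real.exp (E s)) (Icc a b) := by
    refine Real.continuous_exp.comp_continuousOn ?_
    have := intervalIntegral.continuousOn_primitive_interval' (hkint b ⟨hab, le_rfl⟩) left_mem_uIcc
    rwa [uIcc_of_le hab] at this
  have hweighted : Real.exp (E b) * w b - Real.exp (E a) * w a ≤
      ∫ s in a..b, Real.exp (E s) * f s := by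
    refine intervalIntegral.sub_le_integral_of_hasDeriv_right_of_le hab (hE.mul hw)
      (fun s hs => ((hasDerivAt_integral_of_continuousOn_Icc hk hs).exp.mul
        (hdiff s hs).hasDerivAt).hasDerivWithinAt) ?_ fun s hs => ?_
    · rw [← intervalIntegrable_iff_integrableOn_Icc_of_le hab]
      exact hf.continuousOn_mul (by rwa [uIcc_of_le hab])
    · linarith [mul_le_mul_of_nonneg_left (hderiv s hs) (Real.exp_pos (E s)).le]
  have hforcing : ∫ s in a..b, Real.exp (-∫ τ in s..b, k τ) * f s =
      Real.exp (-E b) * ∫ s in a..b, Real.exp (E s) * f s := by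
    rw [← intervalIntegral.integral_const_mul]
    refine intervalIntegral.integral_congr fun s hs => ?_
    rw [uIcc_of_le hab] at hs
    have hsplit : ∫ τ in s..b, k τ = E b - E s :=
      (intervalIntegral.integral_interval_sub_left (hkint b ⟨hab, le_rfl⟩) (hkint s hs)).symm
    simp only [hsplit, ← mul_assoc, ← Real.exp_add]
    ring_nf
  calc w b = Real.exp (-E b) * (Real.exp (E b) * w b) := by
        rw [← mul_assoc, ← Real.exp_add, neg_add_cancel, Real.exp_zero, one_mul]
    _ ≤ Real.exp (-E b) * (w a + ∫ s in a..b, Real.exp (E s) * f s) := by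
        rw [hEa, Real.exp_zero] at hweighted
        gcongr
        linarith
    _ = _ := by rw [hforcing, mul_add]

theorem add_le_two_mul_rpow_half {r s y : ℝ} (h : r ^ 2 + s ^ 2 ≤ y) :
    r + s ≤ 2 * y ^ (1 / 2 : ℝ) := by
  have hr : r ≤ √y := Real.le_sqrt_of_sq_le (by linarith [sq_nonneg s])
  have hs : s ≤ √y := Real.le_sqrt_of_sq_le (by linarith [sq_nonneg r])
  rw [← Real.sqrt_eq_rpow]
  linarith

end Calculus

/-- Two solutions `p₁`, `p₂` with boundary data `Ψ₁`, `Ψ₂`, for which the Poincaré–Sobolev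
inequality with constant `cP` holds for `p̄₁`, `p̄₂` and `P̄ = p̄₁ - p̄₂`. -/
structure IsPoincarePair (m : Medium U α) (cP : ℝ) (p₁ Ψ₁ p₂ Ψ₂ : RegularPath m) : Prop where
  fst : IsPoincareSolution m cP p₁ Ψ₁
  snd : IsPoincareSolution m cP p₂ Ψ₂
  poincare : ∀ t, 0 < t →
    PoincareSobolev m cP (Pbar p₁ Ψ₁ p₂ Ψ₂ t) (gradPbar p₁ Ψ₁ p₂ Ψ₂ t)

section Difference

variable (p₁ Ψ₁ p₂ Ψ₂ : RegularPath m)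

theorem gradPbar_eq (t : ℝ) :
    gradPbar p₁ Ψ₁ p₂ Ψ₂ t = p₁.grad t - p₂.grad t - (Ψ₁.grad t - Ψ₂.grad t) :=
  sub_sub_sub_comm _ _ _ _

theorem continuousOn_Pbar : ContinuousOn (Pbar p₁ Ψ₁ p₂ Ψ₂) (Ici 0) :=
  (p₁.continuousOn_val.sub Ψ₁.continuousOn_val).sub
    (p₂.continuousOn_val.sub Ψ₂.continuousOn_val)

theorem hasDerivAt_norm_sq_Pbar {t : ℝ} (ht : 0 < t) :
    HasDerivAt (fun s => ‖Pbar p₁ Ψ₁ p₂ Ψ₂ s‖ ^ 2)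
      (2 * ⟪Pbar p₁ Ψ₁ p₂ Ψ₂ t,
        (p₁.dval t - p₂.dval t) - (Ψ₁.dval t - Ψ₂.dval t)⟫) t := by
  rw [sub_sub_sub_comm]
  exact (((p₁.hasDerivAt_val t ht).sub (Ψ₁.hasDerivAt_val t ht)).sub
    ((p₂.hasDerivAt_val t ht).sub (Ψ₂.hasDerivAt_val t ht))).norm_sq

theorem D_nonneg (hU : MeasurableSet U) (t : ℝ) : 0 ≤ D m Ψ₁ Ψ₂ t := by
  rw [D_eq Ψ₁ Ψ₂ t hU]
  positivity

theorem norm_Pbar_le (hα : IsForchExponents α) (hU : MeasurableSet U) {t j : ℝ}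
    (hj : totalEnergy p₁ Ψ₁ t + totalEnergy p₂ Ψ₂ t ≤ j) :
    ‖Pbar p₁ Ψ₁ p₂ Ψ₂ t‖ ≤ 2 * j ^ (1 / 2 : ℝ) :=
  (norm_sub_le _ _).trans <| add_le_two_mul_rpow_half <| by
    linarith [norm_sq_val_sub_le_totalEnergy p₁ Ψ₁ hα hU t,
      norm_sq_val_sub_le_totalEnergy p₂ Ψ₂ hα hU t]

theorem wNorm_gradPbar_sq_le (hα : IsForchExponents α) (hU : MeasurableSet U) {t j : ℝ}
    (hj : totalEnergy p₁ Ψ₁ t + totalEnergy p₂ Ψ₂ t + Bstar m ≤ j) :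
    wNorm U m.W1 (2 - expA α) (gradPbar p₁ Ψ₁ p₂ Ψ₂ t) ^ 2 ≤
      2 * fluxConst α * (⟪fluxLp hα hU (p₁.grad t) - fluxLp hα hU (p₂.grad t),
        p₁.grad t - p₂.grad t⟫ + ‖Ψ₁.grad t - Ψ₂.grad t‖ ^ 2) *
          j ^ (expA α / (2 - expA α)) := by
  have hinner : 0 ≤ ⟪fluxLp hα hU (p₁.grad t) - fluxLp hα hU (p₂.grad t),
      p₁.grad t - p₂.grad t⟫ := (sq_nonneg _).trans (fluxLp_cocoercive hα hU _ _)
  have hconst : 0 < fluxConst α := fluxConst_pos α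
  have hdiss₁ := dissipation_nonneg hα hU (p₁.grad t)
  have hdiss₂ := dissipation_nonneg hα hU (p₂.grad t)
  have hB := one_le_Bstar m
  have hexp : 0 ≤ expA α / (2 - expA α) :=
    div_nonneg hα.expA_pos.le (by linarith [hα.expA_lt_one])
  rw [gradPbar_eq]
  refine (wNorm_W1_sub_sub_sq_le _ _ hα hU _).trans ?_
  gcongr
  unfold totalEnergy at hj
  linarith [dissipation_le_energy hα hU (p₁.grad t), dissipation_le_energy hα hU (p₂.grad t),
    sq_nonneg ‖p₁.val t - Ψ₁.val t‖, sq_nonneg ‖p₂.val t - Ψ₂.val t‖]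

end Difference

namespace IsPoincarePair

variable {cP t j : ℝ} {p₁ Ψ₁ p₂ Ψ₂ : RegularPath m}

theorem inner_dval_sub_Pbar_le (hα : IsForchExponents α) (hU : MeasurableSet U)
    (hp : IsPoincarePair m cP p₁ Ψ₁ p₂ Ψ₂) (ht : 0 < t) :
    ⟪p₁.dval t - p₂.dval t, Pbar p₁ Ψ₁ p₂ Ψ₂ t⟫ ≤
      -⟪fluxLp hα hU (p₁.grad t) - fluxLp hα hU (p₂.grad t), p₁.grad t - p₂.grad t⟫ / 2
        + ‖Ψ₁.grad t - Ψ₂.grad t‖ ^ 2 / 2 := by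
  have hmem : (Pbar p₁ Ψ₁ p₂ Ψ₂ t, gradPbar p₁ Ψ₁ p₂ Ψ₂ t) ∈ zeroTrace m hU :=
    (zeroTrace m hU).sub_mem (hp.fst.mem_zeroTrace hU ht) (hp.snd.mem_zeroTrace hU ht)
  have hweak₁ := hp.fst.isSolution.1.inner_dval hα hU ht hmem
  have hweak₂ := hp.snd.isSolution.1.inner_dval hα hU ht hmem
  have hweak : ⟪p₁.dval t - p₂.dval t, Pbar p₁ Ψ₁ p₂ Ψ₂ t⟫ =
      -⟪fluxLp hα hU (p₁.grad t) - fluxLp hα hU (p₂.grad t), gradPbar p₁ Ψ₁ p₂ Ψ₂ t⟫ := by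
    rw [inner_sub_left (p₁.dval t), inner_sub_left, hweak₁, hweak₂]
    ring
  have hcocoercive := fluxLp_cocoercive hα hU (p₁.grad t) (p₂.grad t)
  have hdata := real_inner_le_norm (fluxLp hα hU (p₁.grad t) - fluxLp hα hU (p₂.grad t))
    (Ψ₁.grad t - Ψ₂.grad t)
  rw [hweak, gradPbar_eq, inner_sub_right]
  linarith [sq_nonneg (‖fluxLp hα hU (p₁.grad t) - fluxLp hα hU (p₂.grad t)‖
    - ‖Ψ₁.grad t - Ψ₂.grad t‖)]

theorem norm_sq_Pbar_le (hα : IsForchExponents α) (hU : MeasurableSet U)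
    (hp : IsPoincarePair m cP p₁ Ψ₁ p₂ Ψ₂) (ht : 0 < t)
    (hj : totalEnergy p₁ Ψ₁ t + totalEnergy p₂ Ψ₂ t + Bstar m ≤ j) :
    ‖Pbar p₁ Ψ₁ p₂ Ψ₂ t‖ ^ 2 ≤ cP ^ 2 * (2 * fluxConst α) * j ^ (expA α / (2 - expA α)) *
      (⟪fluxLp hα hU (p₁.grad t) - fluxLp hα hU (p₂.grad t), p₁.grad t - p₂.grad t⟫
        + ‖Ψ₁.grad t - Ψ₂.grad t‖ ^ 2) := by
  have hpoincare := hp.poincare t ht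
  rw [PoincareSobolev, wNorm_phi hU] at hpoincare
  calc ‖Pbar p₁ Ψ₁ p₂ Ψ₂ t‖ ^ 2
      ≤ cP ^ 2 * wNorm U m.W1 (2 - expA α) (gradPbar p₁ Ψ₁ p₂ Ψ₂ t) ^ 2 := by
        rw [← mul_pow]
        gcongr
    _ ≤ _ := mul_le_mul_of_nonneg_left (wNorm_gradPbar_sq_le p₁ Ψ₁ p₂ Ψ₂ hα hU hj) (sq_nonneg cP)
    _ = _ := by ring

theorem deriv_norm_sq_Pbar_le (hα : IsForchExponents α) (hU : MeasurableSet U) (hcP : 0 < cP)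
    (hp : IsPoincarePair m cP p₁ Ψ₁ p₂ Ψ₂) (ht : 0 < t)
    (hj : totalEnergy p₁ Ψ₁ t + totalEnergy p₂ Ψ₂ t + Bstar m ≤ j) :
    deriv (fun s => ‖Pbar p₁ Ψ₁ p₂ Ψ₂ s‖ ^ 2) t ≤
      -(1 / (cP ^ 2 * (2 * fluxConst α)) * j ^ (-(expA α / (2 - expA α)))) *
          ‖Pbar p₁ Ψ₁ p₂ Ψ₂ t‖ ^ 2
        + 4 * (j ^ (1 / 2 : ℝ) * D m Ψ₁ Ψ₂ t) := by
  have hB := one_le_Bstar m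
  have hj1 : 1 ≤ j := by
    linarith [totalEnergy_nonneg p₁ Ψ₁ hα hU t, totalEnergy_nonneg p₂ Ψ₂ hα hU t]
  have hj0 : 0 < j := by linarith
  have hroot : 1 ≤ j ^ (1 / 2 : ℝ) := Real.one_le_rpow hj1 (by norm_num)
  have hconst : 0 < fluxConst α := fluxConst_pos α
  have hdiss := hp.norm_sq_Pbar_le hα hU ht hj
  rw [mul_assoc, ← inv_mul_le_iff₀ (by positivity), ← inv_mul_le_iff₀ (by positivity),
    ← Real.rpow_neg hj0.le, mul_left_comm, ← one_div, ← mul_assoc] at hdiss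
  have hinner := hp.inner_dval_sub_Pbar_le hα hU ht
  have hPbar := norm_Pbar_le p₁ Ψ₁ p₂ Ψ₂ hα hU (t := t) (j := j) (by linarith)
  have htime : -⟪Ψ₁.dval t - Ψ₂.dval t, Pbar p₁ Ψ₁ p₂ Ψ₂ t⟫ ≤
      ‖Ψ₁.dval t - Ψ₂.dval t‖ * (2 * j ^ (1 / 2 : ℝ)) :=
    ((neg_le_abs _).trans (abs_real_inner_le_norm _ _)).trans (by gcongr)
  have hgrad : ‖Ψ₁.grad t - Ψ₂.grad t‖ ^ 2 ≤ j ^ (1 / 2 : ℝ) * ‖Ψ₁.grad t - Ψ₂.grad t‖ ^ 2 :=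
    le_mul_of_one_le_left (sq_nonneg _) hroot
  have hrest : 0 ≤ j ^ (1 / 2 : ℝ) * ‖Ψ₁.grad t - Ψ₂.grad t‖ := by positivity
  rw [(hasDerivAt_norm_sq_Pbar p₁ Ψ₁ p₂ Ψ₂ ht).deriv, real_inner_comm, inner_sub_left,
    D_eq Ψ₁ Ψ₂ t hU]
  linarith [sq_nonneg ‖Ψ₁.grad t - Ψ₂.grad t‖]

theorem wNorm_gradPbar_sq_le_of_norm_sq_dval_le (hα : IsForchExponents α) (hU : MeasurableSet U)
    (hp : IsPoincarePair m cP p₁ Ψ₁ p₂ Ψ₂) (ht : 0 < t)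
    (hj : totalEnergy p₁ Ψ₁ t + totalEnergy p₂ Ψ₂ t + Bstar m ≤ j) {x : ℝ}
    (hx : ‖p₁.dval t‖ ^ 2 + ‖p₂.dval t‖ ^ 2 ≤ x) :
    wNorm U m.W1 (2 - expA α) (gradPbar p₁ Ψ₁ p₂ Ψ₂ t) ^ 2 ≤
      8 * fluxConst α * j ^ (expA α / (2 - expA α)) *
        (x ^ (1 / 2 : ℝ) * ‖Pbar p₁ Ψ₁ p₂ Ψ₂ t‖ + D m Ψ₁ Ψ₂ t) := by
  have hB := one_le_Bstar m
  have hj0 : 0 ≤ j := by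
    linarith [totalEnergy_nonneg p₁ Ψ₁ hα hU t, totalEnergy_nonneg p₂ Ψ₂ hα hU t]
  have hconst : 0 < fluxConst α := fluxConst_pos α
  have htime : -⟪p₁.dval t - p₂.dval t, Pbar p₁ Ψ₁ p₂ Ψ₂ t⟫ ≤
      2 * x ^ (1 / 2 : ℝ) * ‖Pbar p₁ Ψ₁ p₂ Ψ₂ t‖ :=
    ((neg_le_abs _).trans (abs_real_inner_le_norm _ _)).trans <| by
      gcongr
      exact (norm_sub_le _ _).trans (add_le_two_mul_rpow_half hx)
  have hflux : ⟪fluxLp hα hU (p₁.grad t) - fluxLp hα hU (p₂.grad t), p₁.grad t - p₂.grad t⟫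
      + ‖Ψ₁.grad t - Ψ₂.grad t‖ ^ 2 ≤
        4 * (x ^ (1 / 2 : ℝ) * ‖Pbar p₁ Ψ₁ p₂ Ψ₂ t‖ + D m Ψ₁ Ψ₂ t) := by
    rw [D_eq Ψ₁ Ψ₂ t hU]
    linarith [hp.inner_dval_sub_Pbar_le hα hU ht, sq_nonneg ‖Ψ₁.grad t - Ψ₂.grad t‖,
      norm_nonneg (Ψ₁.grad t - Ψ₂.grad t), norm_nonneg (Ψ₁.dval t - Ψ₂.dval t)]
  refine (wNorm_gradPbar_sq_le p₁ Ψ₁ p₂ Ψ₂ hα hU hj).trans ?_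
  calc _ ≤ 2 * fluxConst α * (4 * (x ^ (1 / 2 : ℝ) * ‖Pbar p₁ Ψ₁ p₂ Ψ₂ t‖ + D m Ψ₁ Ψ₂ t)) *
        j ^ (expA α / (2 - expA α)) := by gcongr
    _ = _ := by ring

end IsPoincarePair

section Majorants

theorem IsMajorant.le_of_mem_Icc {M g : ℝ → ℝ} (hM : IsMajorant M g) {s t : ℝ}
    (hs : s ∈ Icc 0 t) : g s ≤ M t :=
  (hM.2.2 s hs.1).trans (hM.2.1 hs.1 (hs.1.trans hs.2) hs.2)

variable {p₁ p₂ Ψ₁ Ψ₂ : RegularPath m} {M₁ M₂ : ℝ → ℝ} {t t₀ : ℝ}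

theorem G1_nonneg (Ψ : RegularPath m) (t : ℝ) (hU : MeasurableSet U) : 0 ≤ G1 m Ψ t :=
  G1_eq Ψ t hU ▸ sq_nonneg _

theorem G2_nonneg (Ψ : RegularPath m) (t : ℝ) (hU : MeasurableSet U) : 0 ≤ G2 m Ψ t :=
  G2_eq Ψ t hU ▸ sq_nonneg _

theorem H0_add_P0 (p₁ Ψ₁ p₂ Ψ₂ : RegularPath m) (hU : MeasurableSet U) :
    H0 m p₁ p₂ + P0 m p₁ Ψ₁ p₂ Ψ₂ = totalEnergy p₁ Ψ₁ 0 + totalEnergy p₂ Ψ₂ 0 := by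
  unfold H0 P0 totalEnergy energy
  rw [norm_sq_L2Phi hU, norm_sq_L2Phi hU]
  ring

theorem norm_sq_dval_le (hα : IsForchExponents α) (hU : MeasurableSet U) (p Ψ : RegularPath m)
    (t : ℝ) : ‖p.dval t‖ ^ 2 ≤ 2 * ‖p.dval t - Ψ.dval t‖ ^ 2 + 2 * G m Ψ t :=
  calc ‖p.dval t‖ ^ 2 = ‖(p.dval t - Ψ.dval t) + Ψ.dval t‖ ^ 2 := by rw [sub_add_cancel]
    _ ≤ (‖p.dval t - Ψ.dval t‖ + ‖Ψ.dval t‖) ^ 2 := by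
        gcongr
        exact norm_add_le _ _
    _ ≤ 2 * (‖p.dval t - Ψ.dval t‖ ^ 2 + ‖Ψ.dval t‖ ^ 2) := add_sq_le
    _ ≤ _ := by linarith [norm_sq_dval_le_G Ψ t hα hU]

theorem continuousOn_calM1 (hα : IsForchExponents α) (hM₁ : IsMajorant M₁ (G m Ψ₁))
    (hM₂ : IsMajorant M₂ (G m Ψ₂)) (hG1₁ : ContinuousOn (G1 m Ψ₁) (Ici 0))
    (hG1₂ : ContinuousOn (G1 m Ψ₂) (Ici 0)) :
    ContinuousOn (calM1 m p₁ Ψ₁ p₂ Ψ₂ M₁ M₂) (Ici 0) :=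
  (continuousOn_const.add ((hM₁.1.add hM₂.1).rpow_const fun _ _ =>
    Or.inr (div_nonneg zero_le_two (by linarith [hα.expA_lt_one])))).add
      (continuousOn_sSup_image_Icc (hG1₁.add hG1₂))

theorem G1_G2_le_sSup (hU : MeasurableSet U) (hG1₁ : ContinuousOn (G1 m Ψ₁) (Ici 0))
    (hG1₂ : ContinuousOn (G1 m Ψ₂) (Ici 0)) (hG2₁ : ContinuousOn (G2 m Ψ₁) (Ici 0))
    (hG2₂ : ContinuousOn (G2 m Ψ₂) (Ici 0)) {s : ℝ} (hs : s ∈ Icc 0 t) :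
    letI σ := sSup ((fun τ => (G1 m Ψ₁ τ + G1 m Ψ₂ τ) + (G2 m Ψ₁ τ + G2 m Ψ₂ τ)) '' Icc 0 t)
    G1 m Ψ₁ s ≤ σ ∧ G1 m Ψ₂ s ≤ σ ∧ G2 m Ψ₁ s ≤ σ ∧ G2 m Ψ₂ s ≤ σ := by
  have hsum := le_sSup_image_Icc ((hG1₁.add hG1₂).add (hG2₁.add hG2₂)) hs
  simp only [Pi.add_apply] at hsum
  have hG1₁0 := G1_nonneg Ψ₁ s hU
  have hG1₂0 := G1_nonneg Ψ₂ s hU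
  have hG2₁0 := G2_nonneg Ψ₁ s hU
  have hG2₂0 := G2_nonneg Ψ₂ s hU
  refine ⟨?_, ?_, ?_, ?_⟩ <;> exact le_trans (by linarith) hsum

variable (hα : IsForchExponents α) (hU : MeasurableSet U) (hM₁ : IsMajorant M₁ (G m Ψ₁))
  (hM₂ : IsMajorant M₂ (G m Ψ₂)) (ht : 0 ≤ t)
include hα hU hM₁ hM₂ ht

theorem Bstar_le_majorant_add : Bstar m ≤ M₁ t + M₂ t := by
  linarith [Bstar_le_G Ψ₁ t hα hU, hM₁.2.2 t ht, one_le_G Ψ₂ t hα hU, hM₂.2.2 t ht]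

theorem one_le_majorant_add : 1 ≤ M₁ t + M₂ t :=
  (one_le_Bstar m).trans (Bstar_le_majorant_add hα hU hM₁ hM₂ ht)

theorem majorant_add_le_calM1 : M₁ t + M₂ t ≤ calM1 m p₁ Ψ₁ p₂ Ψ₂ M₁ M₂ t := by
  have hsup : 0 ≤ sSup ((fun τ => G1 m Ψ₁ τ + G1 m Ψ₂ τ) '' Icc 0 t) :=
    Real.sSup_nonneg <| forall_mem_image.2 fun s _ =>
      add_nonneg (G1_nonneg Ψ₁ s hU) (G1_nonneg Ψ₂ s hU)
  unfold calM1
  rw [H0_add_P0 _ _ _ _ hU]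
  linarith [totalEnergy_nonneg p₁ Ψ₁ hα hU 0, totalEnergy_nonneg p₂ Ψ₂ hα hU 0,
    hα.le_rpow_two_div (one_le_majorant_add hα hU hM₁ hM₂ ht)]

theorem one_le_calM1 : 1 ≤ calM1 m p₁ Ψ₁ p₂ Ψ₂ M₁ M₂ t :=
  (one_le_majorant_add hα hU hM₁ hM₂ ht).trans (majorant_add_le_calM1 hα hU hM₁ hM₂ ht)

omit hM₁ hM₂ in
theorem calM1_le_calM2 (hG1₁ : ContinuousOn (G1 m Ψ₁) (Ici 0))
    (hG1₂ : ContinuousOn (G1 m Ψ₂) (Ici 0)) (hG2₁ : ContinuousOn (G2 m Ψ₁) (Ici 0))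
    (hG2₂ : ContinuousOn (G2 m Ψ₂) (Ici 0)) (ht₀ : t₀ ∈ Ioc (0 : ℝ) 1) :
    calM1 m p₁ Ψ₁ p₂ Ψ₂ M₁ M₂ t ≤ calM2 m p₁ Ψ₁ p₂ Ψ₂ M₁ M₂ t₀ t := by
  unfold calM1 calM2
  rw [H0_add_P0 _ _ _ _ hU]
  gcongr ?_ + _ + ?_
  · exact le_mul_of_one_le_left (add_nonneg (totalEnergy_nonneg p₁ Ψ₁ hα hU 0)
      (totalEnergy_nonneg p₂ Ψ₂ hα hU 0)) ((one_le_inv₀ ht₀.1).2 ht₀.2)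
  · refine csSup_le ((nonempty_Icc.2 ht).image _) (forall_mem_image.2 fun s hs => ?_)
    exact (le_add_of_nonneg_right (add_nonneg (G2_nonneg Ψ₁ s hU) (G2_nonneg Ψ₂ s hU))).trans
      (le_sSup_image_Icc ((hG1₁.add hG1₂).add (hG2₁.add hG2₂)) hs)

end Majorants

theorem exists_totalEnergy_le_calM1 (hα : IsForchExponents α) {cP : ℝ} (hcP : 0 < cP) :
    ∃ K : ℝ, 1 ≤ K ∧ ∀ {n : ℕ} {U : Set (EuclideanSpace ℝ (Fin n))}, MeasurableSet U →
      ∀ (m : Medium U α) (p₁ Ψ₁ p₂ Ψ₂ : RegularPath m), IsPoincarePair m cP p₁ Ψ₁ p₂ Ψ₂ →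
      ContinuousOn (G1 m Ψ₁) (Ici 0) → ContinuousOn (G1 m Ψ₂) (Ici 0) →
      ∀ M₁ M₂ : ℝ → ℝ, IsMajorant M₁ (G m Ψ₁) → IsMajorant M₂ (G m Ψ₂) → ∀ t, 0 ≤ t →
        totalEnergy p₁ Ψ₁ t + totalEnergy p₂ Ψ₂ t + Bstar m ≤
          K * calM1 m p₁ Ψ₁ p₂ Ψ₂ M₁ M₂ t := by
  obtain ⟨C, hC, henergy⟩ := exists_energy_bound hα hcP
  refine ⟨2 * C + 1, by linarith, fun hU m p₁ Ψ₁ p₂ Ψ₂ hp hG1₁ hG1₂ M₁ M₂ hM₁ hM₂ t ht => ?_⟩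
  have hM : 1 ≤ M₁ t + M₂ t := one_le_majorant_add hα hU hM₁ hM₂ ht
  have hM₁0 : 1 ≤ M₁ t := (one_le_G Ψ₁ t hα hU).trans (hM₁.2.2 t ht)
  have hM₂0 : 1 ≤ M₂ t := (one_le_G Ψ₂ t hα hU).trans (hM₂.2.2 t ht)
  have hB := (Bstar_le_majorant_add hα hU hM₁ hM₂ ht).trans
    (majorant_add_le_calM1 (p₁ := p₁) (p₂ := p₂) hα hU hM₁ hM₂ ht)
  set γ := (M₁ t + M₂ t) ^ (2 / (2 - expA α)) with hγ
  set σ := sSup ((fun τ => G1 m Ψ₁ τ + G1 m Ψ₂ τ) '' Icc 0 t) with hσ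
  have hG1 : ∀ s ∈ Icc 0 t, G1 m Ψ₁ s + G1 m Ψ₂ s ≤ σ := fun s hs =>
    le_sSup_image_Icc (hG1₁.add hG1₂) hs
  have hG1₁_le : ∀ s ∈ Icc 0 t, G1 m Ψ₁ s ≤ σ := fun s hs => by
    linarith [hG1 s hs, G1_nonneg Ψ₂ s hU]
  have hG1₂_le : ∀ s ∈ Icc 0 t, G1 m Ψ₂ s ≤ σ := fun s hs => by
    linarith [hG1 s hs, G1_nonneg Ψ₁ s hU]
  have hσ0 : 0 ≤ σ := (G1_nonneg Ψ₁ t hU).trans (hG1₁_le t ⟨ht, le_rfl⟩)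
  have henergy₁ := (henergy hU m p₁ Ψ₁ hp.fst t _ σ ht hM hσ0
    (fun s hs => by linarith [hM₁.le_of_mem_Icc hs]) hG1₁_le).1
  have henergy₂ := (henergy hU m p₂ Ψ₂ hp.snd t _ σ ht hM hσ0
    (fun s hs => by linarith [hM₂.le_of_mem_Icc hs]) hG1₂_le).1
  have hcal : calM1 m p₁ Ψ₁ p₂ Ψ₂ M₁ M₂ t =
      totalEnergy p₁ Ψ₁ 0 + totalEnergy p₂ Ψ₂ 0 + γ + σ := by
    rw [hγ, hσ, ← H0_add_P0 _ _ _ _ hU, calM1]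
  have hinit : 0 ≤ C * (totalEnergy p₁ Ψ₁ 0 + totalEnergy p₂ Ψ₂ 0) :=
    mul_nonneg (by linarith) (add_nonneg (totalEnergy_nonneg p₁ Ψ₁ hα hU 0)
      (totalEnergy_nonneg p₂ Ψ₂ hα hU 0))
  calc totalEnergy p₁ Ψ₁ t + totalEnergy p₂ Ψ₂ t + Bstar m
      ≤ C * (totalEnergy p₁ Ψ₁ 0 + γ + σ) + C * (totalEnergy p₂ Ψ₂ 0 + γ + σ)
          + calM1 m p₁ Ψ₁ p₂ Ψ₂ M₁ M₂ t := by gcongr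
    _ = (2 * C + 1) * calM1 m p₁ Ψ₁ p₂ Ψ₂ M₁ M₂ t
          - C * (totalEnergy p₁ Ψ₁ 0 + totalEnergy p₂ Ψ₂ 0) := by
        rw [hcal]
        ring
    _ ≤ _ := sub_le_self _ hinit

theorem exists_norm_sq_dval_le_calM2 (hα : IsForchExponents α) {cP : ℝ} (hcP : 0 < cP) :
    ∃ K : ℝ, 1 ≤ K ∧ ∀ {n : ℕ} {U : Set (EuclideanSpace ℝ (Fin n))}, MeasurableSet U →
      ∀ (m : Medium U α) (p₁ Ψ₁ p₂ Ψ₂ : RegularPath m), IsPoincarePair m cP p₁ Ψ₁ p₂ Ψ₂ →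
      ContinuousOn (G1 m Ψ₁) (Ici 0) → ContinuousOn (G1 m Ψ₂) (Ici 0) →
      ContinuousOn (G2 m Ψ₁) (Ici 0) → ContinuousOn (G2 m Ψ₂) (Ici 0) →
      ∀ M₁ M₂ : ℝ → ℝ, IsMajorant M₁ (G m Ψ₁) → IsMajorant M₂ (G m Ψ₂) →
      ∀ t₀ ∈ Ioc (0 : ℝ) 1, ∀ t, t₀ ≤ t →
        ‖p₁.dval t‖ ^ 2 + ‖p₂.dval t‖ ^ 2 ≤ K * calM2 m p₁ Ψ₁ p₂ Ψ₂ M₁ M₂ t₀ t := by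
  obtain ⟨C, hC, henergy⟩ := exists_energy_bound hα hcP
  refine ⟨8 * C + 2, by linarith, fun hU m p₁ Ψ₁ p₂ Ψ₂ hp hG1₁ hG1₂ hG2₁ hG2₂ M₁ M₂ hM₁ hM₂
    t₀ ht₀ t ht₀t => ?_⟩
  have ht : 0 ≤ t := ht₀.1.le.trans ht₀t
  have hM : 1 ≤ M₁ t + M₂ t := one_le_majorant_add hα hU hM₁ hM₂ ht
  have hMcal : M₁ t + M₂ t ≤ calM2 m p₁ Ψ₁ p₂ Ψ₂ M₁ M₂ t₀ t :=
    (majorant_add_le_calM1 hα hU hM₁ hM₂ ht).trans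
      (calM1_le_calM2 hα hU ht hG1₁ hG1₂ hG2₁ hG2₂ ht₀)
  have hM₁0 : 1 ≤ M₁ t := (one_le_G Ψ₁ t hα hU).trans (hM₁.2.2 t ht)
  have hM₂0 : 1 ≤ M₂ t := (one_le_G Ψ₂ t hα hU).trans (hM₂.2.2 t ht)
  set γ := (M₁ t + M₂ t) ^ (2 / (2 - expA α)) with hγ
  set σ := sSup ((fun τ => (G1 m Ψ₁ τ + G1 m Ψ₂ τ) + (G2 m Ψ₁ τ + G2 m Ψ₂ τ)) '' Icc 0 t) with hσ
  have hle : ∀ s ∈ Icc 0 t, G1 m Ψ₁ s ≤ σ ∧ G1 m Ψ₂ s ≤ σ ∧ G2 m Ψ₁ s ≤ σ ∧ G2 m Ψ₂ s ≤ σ :=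
    fun s hs => G1_G2_le_sSup hU hG1₁ hG1₂ hG2₁ hG2₂ hs
  have hσ0 : 0 ≤ σ := (G1_nonneg Ψ₁ t hU).trans (hle t ⟨ht, le_rfl⟩).1
  have hvel₁ := (henergy hU m p₁ Ψ₁ hp.fst t _ σ ht hM hσ0
    (fun s hs => by linarith [hM₁.le_of_mem_Icc hs]) fun s hs => (hle s hs).1).2
      t₀ ht₀ ht₀t σ hσ0 fun s hs => (hle s hs).2.2.1
  have hvel₂ := (henergy hU m p₂ Ψ₂ hp.snd t _ σ ht hM hσ0
    (fun s hs => by linarith [hM₂.le_of_mem_Icc hs]) fun s hs => (hle s hs).2.1).2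
      t₀ ht₀ ht₀t σ hσ0 fun s hs => (hle s hs).2.2.2
  have hinit : 0 ≤ t₀⁻¹ * (totalEnergy p₁ Ψ₁ 0 + totalEnergy p₂ Ψ₂ 0) :=
    mul_nonneg (inv_nonneg.2 ht₀.1.le) (add_nonneg (totalEnergy_nonneg p₁ Ψ₁ hα hU 0)
      (totalEnergy_nonneg p₂ Ψ₂ hα hU 0))
  have hcal : calM2 m p₁ Ψ₁ p₂ Ψ₂ M₁ M₂ t₀ t =
      t₀⁻¹ * (totalEnergy p₁ Ψ₁ 0 + totalEnergy p₂ Ψ₂ 0) + γ + σ := by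
    rw [hγ, hσ, ← H0_add_P0 _ _ _ _ hU, calM2]
  calc ‖p₁.dval t‖ ^ 2 + ‖p₂.dval t‖ ^ 2
      ≤ 2 * (‖p₁.dval t - Ψ₁.dval t‖ ^ 2 + ‖p₂.dval t - Ψ₂.dval t‖ ^ 2) + 2 * (M₁ t + M₂ t) := by
        linarith [norm_sq_dval_le hα hU p₁ Ψ₁ t, norm_sq_dval_le hα hU p₂ Ψ₂ t,
          hM₁.2.2 t ht, hM₂.2.2 t ht]
    _ ≤ 2 * (C * (4 * calM2 m p₁ Ψ₁ p₂ Ψ₂ M₁ M₂ t₀ t))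
          + 2 * calM2 m p₁ Ψ₁ p₂ Ψ₂ M₁ M₂ t₀ t := by
        gcongr
        refine (add_le_add hvel₁ hvel₂).trans ?_
        rw [← mul_add, hcal]
        gcongr
        linarith [show 0 ≤ γ by positivity]
    _ = _ := by ring

theorem intervalIntegrable_D (hα : IsForchExponents α) (hU : MeasurableSet U)
    {Ψ₁ Ψ₂ : RegularPath m} {t g : ℝ} (ht : 0 ≤ t) (hg₁ : ∀ s ∈ Ioc 0 t, G m Ψ₁ s ≤ g)
    (hg₂ : ∀ s ∈ Ioc 0 t, G m Ψ₂ s ≤ g) : IntervalIntegrable (D m Ψ₁ Ψ₂) volume 0 t := by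
  have hgrad : ContinuousOn (fun s => ‖Ψ₁.grad s - Ψ₂.grad s‖) (uIcc 0 t) := by
    rw [uIcc_of_le ht]
    exact (Ψ₁.continuousOn_grad.sub Ψ₂.continuousOn_grad).norm.mono Icc_subset_Ici_self
  have hdval : ContinuousOn (fun s => ‖Ψ₁.dval s - Ψ₂.dval s‖) (Ioc 0 t) := fun s hs =>
    ((Ψ₁.hasDerivAt_dval s hs.1).continuousAt.sub
      (Ψ₂.hasDerivAt_dval s hs.1).continuousAt).norm.continuousWithinAt
  rw [show D m Ψ₁ Ψ₂ = fun s => (‖Ψ₁.grad s - Ψ₂.grad s‖ ^ 2 + ‖Ψ₁.grad s - Ψ₂.grad s‖) +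
    ‖Ψ₁.dval s - Ψ₂.dval s‖ from funext fun s => D_eq Ψ₁ Ψ₂ s hU]
  refine ((hgrad.pow 2).add hgrad).intervalIntegrable.add ?_
  rw [intervalIntegrable_iff_integrableOn_Ioc_of_le ht]
  refine Integrable.of_bound (hdval.aestronglyMeasurable measurableSet_Ioc) (2 * √g) ?_
  filter_upwards [ae_restrict_mem measurableSet_Ioc] with s hs
  rw [norm_norm]
  linarith [norm_sub_le (Ψ₁.dval s) (Ψ₂.dval s),
    Real.le_sqrt_of_sq_le ((norm_sq_dval_le_G Ψ₁ s hα hU).trans (hg₁ s hs)),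
    Real.le_sqrt_of_sq_le ((norm_sq_dval_le_G Ψ₂ s hα hU).trans (hg₂ s hs))]

/-- The factor `d₄` in the decay of `‖P̄‖²_{L²_φ}`, when the total energy is at most `K` times the
comparison function `j`: the damping coefficient is then at least
`decayRate α cP K * j ^ (-a / (2 - a))`. -/
noncomputable def decayRate (α : Fin (N + 1) → ℝ) (cP K : ℝ) : ℝ :=
  1 / (cP ^ 2 * (2 * fluxConst α)) * K ^ (-(expA α / (2 - expA α)))

theorem decayRate_pos (α : Fin (N + 1) → ℝ) {cP K : ℝ} (hcP : 0 < cP) (hK : 0 < K) :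
    0 < decayRate α cP K := by
  have := fluxConst_pos α
  unfold decayRate
  positivity

section GradientEstimate

variable {cP : ℝ} {p₁ Ψ₁ p₂ Ψ₂ : RegularPath m} {j : ℝ → ℝ} {K t : ℝ}

theorem IsPoincarePair.norm_sq_Pbar_le_integral (hα : IsForchExponents α) (hU : MeasurableSet U)
    (hcP : 0 < cP) (hp : IsPoincarePair m cP p₁ Ψ₁ p₂ Ψ₂) (ht : 0 ≤ t)
    (hjc : ContinuousOn j (Icc 0 t)) (hj : ∀ s ∈ Icc 0 t, 0 < j s) (hK : 0 ≤ K)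
    (henergy : ∀ s ∈ Ioo 0 t, totalEnergy p₁ Ψ₁ s + totalEnergy p₂ Ψ₂ s + Bstar m ≤ K * j s)
    (hD : IntervalIntegrable (D m Ψ₁ Ψ₂) volume 0 t) :
    ‖Pbar p₁ Ψ₁ p₂ Ψ₂ t‖ ^ 2 ≤
      Real.exp (-decayRate α cP K * ∫ τ in (0 : ℝ)..t, j τ ^ (-(expA α / (2 - expA α)))) *
          ‖Pbar p₁ Ψ₁ p₂ Ψ₂ 0‖ ^ 2 +
        4 * K ^ (1 / 2 : ℝ) * ∫ s in (0 : ℝ)..t,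
          Real.exp (-decayRate α cP K * ∫ τ in s..t, j τ ^ (-(expA α / (2 - expA α)))) *
            j s ^ (1 / 2 : ℝ) * D m Ψ₁ Ψ₂ s := by
  have hjrpow (r : ℝ) : ContinuousOn (fun s => j s ^ r) (Icc 0 t) :=
    hjc.rpow_const fun s hs => Or.inl (hj s hs).ne'
  have hforcing : IntervalIntegrable
      (fun s => 4 * K ^ (1 / 2 : ℝ) * (j s ^ (1 / 2 : ℝ) * D m Ψ₁ Ψ₂ s)) volume 0 t :=
    (hD.continuousOn_mul (uIcc_of_le ht ▸ hjrpow (1 / 2))).const_mul _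
  have hgronwall := gronwall_le ht (continuousOn_const.mul (hjrpow _)) hforcing
    ((continuousOn_Pbar p₁ Ψ₁ p₂ Ψ₂).norm.pow 2 |>.mono Icc_subset_Ici_self)
    (fun s hs => (hasDerivAt_norm_sq_Pbar p₁ Ψ₁ p₂ Ψ₂ hs.1).differentiableAt)
    (k := fun s => decayRate α cP K * j s ^ (-(expA α / (2 - expA α)))) fun s hs => by
      have hjs : 0 ≤ j s := (hj s (Ioo_subset_Icc_self hs)).le
      refine (hp.deriv_norm_sq_Pbar_le hα hU hcP hs.1 (henergy s hs)).trans_eq ?_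
      rw [Real.mul_rpow hK hjs, Real.mul_rpow hK hjs, decayRate]
      simp only [Pi.pow_apply]
      ring
  simp only [intervalIntegral.integral_const_mul, Pi.pow_apply, ← neg_mul] at hgronwall
  refine hgronwall.trans_eq ?_
  congr 1
  rw [← intervalIntegral.integral_const_mul]
  refine intervalIntegral.integral_congr fun s _ => ?_
  ring

theorem IsPoincarePair.norm_Pbar_add_D_le (hα : IsForchExponents α) (hU : MeasurableSet U)
    (hcP : 0 < cP) (hp : IsPoincarePair m cP p₁ Ψ₁ p₂ Ψ₂) (ht : 0 ≤ t)
    (hjc : ContinuousOn j (Icc 0 t)) (hj : ∀ s ∈ Icc 0 t, 0 < j s) (hK : 1 ≤ K)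
    (henergy : ∀ s ∈ Ioo 0 t, totalEnergy p₁ Ψ₁ s + totalEnergy p₂ Ψ₂ s + Bstar m ≤ K * j s)
    (hD : IntervalIntegrable (D m Ψ₁ Ψ₂) volume 0 t) :
    ‖Pbar p₁ Ψ₁ p₂ Ψ₂ t‖ + D m Ψ₁ Ψ₂ t ≤ 2 * (4 * K ^ (1 / 2 : ℝ)) ^ (1 / 2 : ℝ) *
      (Real.exp (-decayRate α cP K * ∫ τ in (0 : ℝ)..t, j τ ^ (-(expA α / (2 - expA α)))) *
          ‖Pbar p₁ Ψ₁ p₂ Ψ₂ 0‖ ^ 2 + D m Ψ₁ Ψ₂ t ^ 2 +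
        ∫ s in (0 : ℝ)..t,
          Real.exp (-decayRate α cP K * ∫ τ in s..t, j τ ^ (-(expA α / (2 - expA α)))) *
            j s ^ (1 / 2 : ℝ) * D m Ψ₁ Ψ₂ s) ^ (1 / 2 : ℝ) := by
  have hgronwall :=
    hp.norm_sq_Pbar_le_integral hα hU hcP ht hjc hj (zero_le_one.trans hK) henergy hD
  have hK_half : 1 ≤ K ^ (1 / 2 : ℝ) := Real.one_le_rpow hK (by norm_num)
  have hforcing : 0 ≤ ∫ s in (0 : ℝ)..t,
      Real.exp (-decayRate α cP K * ∫ τ in s..t, j τ ^ (-(expA α / (2 - expA α)))) *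
        j s ^ (1 / 2 : ℝ) * D m Ψ₁ Ψ₂ s :=
    intervalIntegral.integral_nonneg ht fun s hs => mul_nonneg
      (mul_nonneg (Real.exp_pos _).le (Real.rpow_nonneg (hj s hs).le _)) (D_nonneg Ψ₁ Ψ₂ hU s)
  set X := Real.exp (-decayRate α cP K * ∫ τ in (0 : ℝ)..t, j τ ^ (-(expA α / (2 - expA α)))) *
    ‖Pbar p₁ Ψ₁ p₂ Ψ₂ 0‖ ^ 2
  set I := ∫ s in (0 : ℝ)..t,
    Real.exp (-decayRate α cP K * ∫ τ in s..t, j τ ^ (-(expA α / (2 - expA α)))) *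
      j s ^ (1 / 2 : ℝ) * D m Ψ₁ Ψ₂ s
  have hX : 0 ≤ X := by positivity
  rw [mul_assoc, ← Real.mul_rpow (by positivity) (by positivity)]
  refine add_le_two_mul_rpow_half ?_
  have hXL : X ≤ 4 * K ^ (1 / 2 : ℝ) * X := le_mul_of_one_le_left hX (by linarith)
  have hDL : D m Ψ₁ Ψ₂ t ^ 2 ≤ 4 * K ^ (1 / 2 : ℝ) * D m Ψ₁ Ψ₂ t ^ 2 :=
    le_mul_of_one_le_left (sq_nonneg _) (by linarith)
  linarith

theorem IsPoincarePair.wNorm_gradPbar_sq_le_rpow_kappa (hα : IsForchExponents α)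
    (hU : MeasurableSet U) (hp : IsPoincarePair m cP p₁ Ψ₁ p₂ Ψ₂) (ht : 0 < t) {K₁ K₂ y : ℝ}
    (hK₁ : 0 ≤ K₁) (hK₂ : 1 ≤ K₂) (hy : 1 ≤ y)
    (henergy : totalEnergy p₁ Ψ₁ t + totalEnergy p₂ Ψ₂ t + Bstar m ≤ K₁ * y)
    (hdval : ‖p₁.dval t‖ ^ 2 + ‖p₂.dval t‖ ^ 2 ≤ K₂ * y) :
    wNorm U m.W1 (2 - expA α) (gradPbar p₁ Ψ₁ p₂ Ψ₂ t) ^ 2 ≤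
      8 * fluxConst α * K₁ ^ (expA α / (2 - expA α)) * K₂ ^ (1 / 2 : ℝ) *
        (y ^ kappa α * (‖Pbar p₁ Ψ₁ p₂ Ψ₂ t‖ + D m Ψ₁ Ψ₂ t)) := by
  have hconst := fluxConst_pos α
  have hK₂0 : 0 ≤ K₂ := zero_le_one.trans hK₂
  have hy0 : 0 < y := zero_lt_one.trans_le hy
  have hroot : 1 ≤ (K₂ * y) ^ (1 / 2 : ℝ) :=
    Real.one_le_rpow (one_le_mul_of_one_le_of_one_le hK₂ hy) (by norm_num)
  calc wNorm U m.W1 (2 - expA α) (gradPbar p₁ Ψ₁ p₂ Ψ₂ t) ^ 2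
      ≤ 8 * fluxConst α * (K₁ * y) ^ (expA α / (2 - expA α)) *
          ((K₂ * y) ^ (1 / 2 : ℝ) * ‖Pbar p₁ Ψ₁ p₂ Ψ₂ t‖ + D m Ψ₁ Ψ₂ t) :=
        hp.wNorm_gradPbar_sq_le_of_norm_sq_dval_le hα hU ht henergy hdval
    _ ≤ 8 * fluxConst α * (K₁ * y) ^ (expA α / (2 - expA α)) *
          ((K₂ * y) ^ (1 / 2 : ℝ) * ‖Pbar p₁ Ψ₁ p₂ Ψ₂ t‖ +
            (K₂ * y) ^ (1 / 2 : ℝ) * D m Ψ₁ Ψ₂ t) := by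
        gcongr
        exact le_mul_of_one_le_left (D_nonneg Ψ₁ Ψ₂ hU t) hroot
    _ = _ := by
        rw [Real.mul_rpow hK₁ hy0.le, Real.mul_rpow hK₂0 hy0.le, kappa, Real.rpow_add hy0]
        ring

end GradientEstimate

theorem exists_gradient_estimate (hα : IsForchExponents α) {cP : ℝ} (hcP : 0 < cP) :
    ∃ C d₄ : ℝ, 0 < C ∧ 0 < d₄ ∧
      ∀ {n : ℕ} {U : Set (EuclideanSpace ℝ (Fin n))}, MeasurableSet U →
      ∀ (m : Medium U α) (p₁ Ψ₁ p₂ Ψ₂ : RegularPath m), IsPoincarePair m cP p₁ Ψ₁ p₂ Ψ₂ →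
      ContinuousOn (G1 m Ψ₁) (Ici 0) → ContinuousOn (G1 m Ψ₂) (Ici 0) →
      ContinuousOn (G2 m Ψ₁) (Ici 0) → ContinuousOn (G2 m Ψ₂) (Ici 0) →
      ∀ M₁ M₂ : ℝ → ℝ, IsMajorant M₁ (G m Ψ₁) → IsMajorant M₂ (G m Ψ₂) →
      ∀ t₀ ∈ Ioc (0 : ℝ) 1, ∀ t, t₀ ≤ t →
        wNorm U m.W1 (2 - expA α) (gradPbar p₁ Ψ₁ p₂ Ψ₂ t) ^ 2 ≤
          C * (calM2 m p₁ Ψ₁ p₂ Ψ₂ M₁ M₂ t₀ t ^ kappa α *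
            (Real.exp (-d₄ * ∫ τ in (0 : ℝ)..t,
                  calM1 m p₁ Ψ₁ p₂ Ψ₂ M₁ M₂ τ ^ (-(expA α / (2 - expA α)))) *
                wNorm U m.phi 2 (Pbar p₁ Ψ₁ p₂ Ψ₂ 0) ^ 2
              + D m Ψ₁ Ψ₂ t ^ 2
              + (∫ s in (0 : ℝ)..t,
                  Real.exp (-d₄ * ∫ τ in s..t,
                    calM1 m p₁ Ψ₁ p₂ Ψ₂ M₁ M₂ τ ^ (-(expA α / (2 - expA α)))) *
                  calM1 m p₁ Ψ₁ p₂ Ψ₂ M₁ M₂ s ^ (1 / 2 : ℝ) * D m Ψ₁ Ψ₂ s)) ^ (1 / 2 : ℝ)) := by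
  obtain ⟨K₁, hK₁, henergy⟩ := exists_totalEnergy_le_calM1 hα hcP
  obtain ⟨K₂, hK₂, hdval⟩ := exists_norm_sq_dval_le_calM2 hα hcP
  have hK₁0 : 0 < K₁ := zero_lt_one.trans_le hK₁
  have : 0 < K₂ := zero_lt_one.trans_le hK₂
  have hconst := fluxConst_pos α
  refine ⟨8 * fluxConst α * K₁ ^ (expA α / (2 - expA α)) * K₂ ^ (1 / 2 : ℝ) *
    (2 * (4 * K₁ ^ (1 / 2 : ℝ)) ^ (1 / 2 : ℝ)), decayRate α cP K₁, by positivity,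
    decayRate_pos α hcP hK₁0, ?_⟩
  intro n U hU m p₁ Ψ₁ p₂ Ψ₂ hp hG1₁ hG1₂ hG2₁ hG2₂ M₁ M₂ hM₁ hM₂ t₀ ht₀ t ht₀t
  have ht : 0 < t := ht₀.1.trans_le ht₀t
  have hone (s : ℝ) (hs : 0 ≤ s) : 1 ≤ calM1 m p₁ Ψ₁ p₂ Ψ₂ M₁ M₂ s :=
    one_le_calM1 hα hU hM₁ hM₂ hs
  have hM1M2 : calM1 m p₁ Ψ₁ p₂ Ψ₂ M₁ M₂ t ≤ calM2 m p₁ Ψ₁ p₂ Ψ₂ M₁ M₂ t₀ t :=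
    calM1_le_calM2 hα hU ht.le hG1₁ hG1₂ hG2₁ hG2₂ ht₀
  have hbound := henergy hU m p₁ Ψ₁ p₂ Ψ₂ hp hG1₁ hG1₂ M₁ M₂ hM₁ hM₂
  have hD : IntervalIntegrable (D m Ψ₁ Ψ₂) volume 0 t :=
    intervalIntegrable_D hα hU ht.le (g := max (M₁ t) (M₂ t))
      (fun s hs => (hM₁.le_of_mem_Icc (Ioc_subset_Icc_self hs)).trans (le_max_left _ _))
      (fun s hs => (hM₂.le_of_mem_Icc (Ioc_subset_Icc_self hs)).trans (le_max_right _ _))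
  have hsum := hp.norm_Pbar_add_D_le hα hU hcP ht.le
    ((continuousOn_calM1 hα hM₁ hM₂ hG1₁ hG1₂).mono Icc_subset_Ici_self)
    (fun s hs => zero_lt_one.trans_le (hone s hs.1)) hK₁ (fun s hs => hbound s hs.1.le) hD
  refine (hp.wNorm_gradPbar_sq_le_rpow_kappa hα hU ht hK₁0.le hK₂ ((hone t ht.le).trans hM1M2)
    ((hbound t ht.le).trans (by gcongr)) (hdval hU m p₁ Ψ₁ p₂ Ψ₂ hp hG1₁ hG1₂ hG2₁ hG2₂
      M₁ M₂ hM₁ hM₂ t₀ ht₀ t ht₀t)).trans ?_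
  have hM2 : 0 ≤ calM2 m p₁ Ψ₁ p₂ Ψ₂ M₁ M₂ t₀ t := by linarith [hone t ht.le]
  rw [mul_assoc _ (2 * _), mul_left_comm (2 * _), wNorm_phi hU]
  gcongr

theorem rpow_mul_rpow_half_mul_rpow_half {y δ β : ℝ} (hy : 0 < y) (hδ : 0 ≤ δ) :
    y ^ β * (y ^ (1 / 2 : ℝ) * (y ^ (β + 1 / 2) * δ) ^ (1 / 2 : ℝ)) =
      (y ^ (3 * (β + 1 / 2)) * δ) ^ (1 / 2 : ℝ) := by
  rw [Real.mul_rpow (by positivity) hδ, Real.mul_rpow (by positivity) hδ, ← Real.rpow_mul hy.le,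
    ← Real.rpow_mul hy.le, ← mul_assoc, ← mul_assoc, ← Real.rpow_add hy, ← Real.rpow_add hy]
  congr 2
  ring

theorem IsForchExponents.kappa_pos (hα : IsForchExponents α) : 0 < kappa α := by
  have hβ : 0 < expA α / (2 - expA α) :=
    div_pos hα.expA_pos (by linarith [hα.expA_lt_one])
  exact add_pos hβ one_half_pos

theorem decayRate_mul_rpow_kappa {cP j : ℝ} (hcP : 0 < cP) (hj : 0 < j) :
    decayRate α cP j * (16 * cP ^ 2 * fluxConst α * j ^ kappa α) = 8 * j ^ (1 / 2 : ℝ) := by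
  have hconst := fluxConst_pos α
  rw [decayRate, kappa, Real.rpow_add hj, Real.rpow_neg hj.le]
  have hjβ : j ^ (expA α / (2 - expA α)) ≠ 0 := (Real.rpow_pos_of_pos hj _).ne'
  field_simp
  norm_num

section EventualEstimate

variable {cP : ℝ} {p₁ Ψ₁ p₂ Ψ₂ : RegularPath m}

theorem IsPoincarePair.eventually_norm_sq_Pbar_le (hα : IsForchExponents α)
    (hU : MeasurableSet U) (hcP : 0 < cP) (hp : IsPoincarePair m cP p₁ Ψ₁ p₂ Ψ₂) {j δ : ℝ}
    (hj : 0 < j) (hδ : 0 < δ)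
    (henergy : ∀ᶠ t in atTop, totalEnergy p₁ Ψ₁ t + totalEnergy p₂ Ψ₂ t + Bstar m ≤ j)
    (hD : ∀ᶠ t in atTop, D m Ψ₁ Ψ₂ t ≤ δ) :
    ∀ᶠ t in atTop,
      ‖Pbar p₁ Ψ₁ p₂ Ψ₂ t‖ ^ 2 ≤ 16 * cP ^ 2 * fluxConst α * j ^ kappa α * δ := by
  refine eventually_le_of_deriv_le_neg (δ := 4 * (j ^ (1 / 2 : ℝ) * δ)) (by positivity) ?_ ?_
  · filter_upwards [eventually_gt_atTop 0] with t ht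
    exact (hasDerivAt_norm_sq_Pbar p₁ Ψ₁ p₂ Ψ₂ ht).differentiableAt
  · filter_upwards [henergy, hD, eventually_gt_atTop 0] with t hjt hDt ht hlt
    have hforcing : j ^ (1 / 2 : ℝ) * D m Ψ₁ Ψ₂ t ≤ j ^ (1 / 2 : ℝ) * δ := by gcongr
    have hdecay : 8 * (j ^ (1 / 2 : ℝ) * δ) ≤
        decayRate α cP j * ‖Pbar p₁ Ψ₁ p₂ Ψ₂ t‖ ^ 2 := by
      rw [← mul_assoc, ← decayRate_mul_rpow_kappa hcP hj, mul_assoc]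
      exact mul_le_mul_of_nonneg_left hlt.le (decayRate_pos α hcP hj).le
    have hderiv := hp.deriv_norm_sq_Pbar_le hα hU hcP ht hjt
    rw [decayRate] at hdecay
    linarith

theorem IsPoincarePair.eventually_wNorm_gradPbar_sq_le (hα : IsForchExponents α)
    (hU : MeasurableSet U) (hcP : 0 < cP) (hp : IsPoincarePair m cP p₁ Ψ₁ p₂ Ψ₂) {j x δ : ℝ}
    (hj : 1 ≤ j) (hjx : j ≤ x) (hδ : 0 < δ)
    (henergy : ∀ᶠ t in atTop, totalEnergy p₁ Ψ₁ t + totalEnergy p₂ Ψ₂ t + Bstar m ≤ j)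
    (hdval : ∀ᶠ t in atTop, ‖p₁.dval t‖ ^ 2 + ‖p₂.dval t‖ ^ 2 ≤ x)
    (hD : ∀ᶠ t in atTop, D m Ψ₁ Ψ₂ t ≤ δ) :
    ∀ᶠ t in atTop, wNorm U m.W1 (2 - expA α) (gradPbar p₁ Ψ₁ p₂ Ψ₂ t) ^ 2 ≤
      8 * fluxConst α * ((x ^ (3 * kappa α) * (16 * cP ^ 2 * fluxConst α * δ)) ^ (1 / 2 : ℝ)
        + j ^ kappa α * δ) := by
  have hconst := fluxConst_pos α
  have hj0 : 0 < j := zero_lt_one.trans_le hj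
  have hx0 : 0 < x := hj0.trans_le hjx
  have hβ : 0 < expA α / (2 - expA α) :=
    div_pos hα.expA_pos (by linarith [hα.expA_lt_one])
  have hβκ : j ^ (expA α / (2 - expA α)) ≤ j ^ kappa α :=
    Real.rpow_le_rpow_of_exponent_le hj (le_add_of_nonneg_right one_half_pos.le)
  filter_upwards [henergy, hdval, hp.eventually_norm_sq_Pbar_le hα hU hcP hj0 hδ henergy hD, hD,
    eventually_gt_atTop 0] with t hjt hxt hPbar hDt ht
  have hnorm : ‖Pbar p₁ Ψ₁ p₂ Ψ₂ t‖ ≤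
      (x ^ kappa α * (16 * cP ^ 2 * fluxConst α * δ)) ^ (1 / 2 : ℝ) := by
    rw [← Real.sqrt_eq_rpow]
    refine Real.le_sqrt_of_sq_le (hPbar.trans ?_)
    have hjxκ : j ^ kappa α ≤ x ^ kappa α := Real.rpow_le_rpow hj0.le hjx hα.kappa_pos.le
    calc 16 * cP ^ 2 * fluxConst α * j ^ kappa α * δ
        ≤ 16 * cP ^ 2 * fluxConst α * x ^ kappa α * δ := by gcongr
      _ = x ^ kappa α * (16 * cP ^ 2 * fluxConst α * δ) := by ring
  refine (hp.wNorm_gradPbar_sq_le_of_norm_sq_dval_le hα hU ht hjt hxt).trans ?_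
  rw [mul_assoc (8 * fluxConst α), mul_add]
  have hDnn : 0 ≤ D m Ψ₁ Ψ₂ t := D_nonneg Ψ₁ Ψ₂ hU t
  gcongr
  rw [kappa, ← rpow_mul_rpow_half_mul_rpow_half hx0 (by positivity)]
  gcongr
  exact hnorm

end EventualEstimate

theorem exists_eventually_energy_dval_bound (hα : IsForchExponents α) {cP : ℝ} (hcP : 0 < cP) :
    ∃ K : ℝ, 1 ≤ K ∧
      ∀ {n : ℕ} {U : Set (EuclideanSpace ℝ (Fin n))}, MeasurableSet U →
      ∀ (m : Medium U α) (p₁ Ψ₁ p₂ Ψ₂ : RegularPath m), IsPoincarePair m cP p₁ Ψ₁ p₂ Ψ₂ →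
      ∀ g g₁ g₂ : ℝ, 0 ≤ g₁ → 0 ≤ g₂ →
      (∀ᶠ s in atTop, G m Ψ₁ s ≤ g) → (∀ᶠ s in atTop, G m Ψ₂ s ≤ g) →
      (∀ᶠ s in atTop, G1 m Ψ₁ s ≤ g₁) → (∀ᶠ s in atTop, G1 m Ψ₂ s ≤ g₁) →
      (∀ᶠ s in atTop, G2 m Ψ₁ s ≤ g₂) → (∀ᶠ s in atTop, G2 m Ψ₂ s ≤ g₂) →
      ∀ᶠ t in atTop,
        totalEnergy p₁ Ψ₁ t + totalEnergy p₂ Ψ₂ t + Bstar m ≤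
          K * (g ^ (2 / (2 - expA α)) + g₁) ∧
        ‖p₁.dval t‖ ^ 2 + ‖p₂.dval t‖ ^ 2 ≤ K * (g ^ (2 / (2 - expA α)) + g₁ + g₂) := by
  obtain ⟨C, hC, henergy⟩ := exists_eventually_energy_bound hα hcP
  refine ⟨4 * C + 4, by linarith, ?_⟩
  intro n U hU m p₁ Ψ₁ p₂ Ψ₂ hp g g₁ g₂ hg₁ hg₂ hG hG' hG1 hG1' hG2 hG2'
  obtain ⟨s, hs⟩ := hG.exists
  have hg : 1 ≤ g := (one_le_G Ψ₁ s hα hU).trans hs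
  have hBstar : Bstar m ≤ g := (Bstar_le_G Ψ₁ s hα hU).trans hs
  have hγ : g ≤ g ^ (2 / (2 - expA α)) := hα.le_rpow_two_div hg
  filter_upwards [henergy hU m p₁ Ψ₁ hp.fst g g₁ g₂ hg hg₁ hg₂ hG hG1 hG2,
    henergy hU m p₂ Ψ₂ hp.snd g g₁ g₂ hg hg₁ hg₂ hG' hG1' hG2', hG, hG']
    with t ⟨henergy₁, hdval₁⟩ ⟨henergy₂, hdval₂⟩ hGt hGt'
  have hγ₁ : 0 ≤ C * (g ^ (2 / (2 - expA α)) + g₁) := by positivity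
  constructor
  · linarith
  · linarith [norm_sq_dval_le hα hU p₁ Ψ₁ t, norm_sq_dval_le hα hU p₂ Ψ₂ t]

theorem exists_eventually_gradient_estimate (hα : IsForchExponents α) {cP : ℝ} (hcP : 0 < cP) :
    ∃ C : ℝ, 0 < C ∧
      ∀ {n : ℕ} {U : Set (EuclideanSpace ℝ (Fin n))}, MeasurableSet U →
      ∀ (m : Medium U α) (p₁ Ψ₁ p₂ Ψ₂ : RegularPath m), IsPoincarePair m cP p₁ Ψ₁ p₂ Ψ₂ →
      ∀ g g₁ g₂ δ : ℝ, 0 ≤ g₁ → 0 ≤ g₂ → 0 < δ →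
      (∀ᶠ s in atTop, G m Ψ₁ s ≤ g) → (∀ᶠ s in atTop, G m Ψ₂ s ≤ g) →
      (∀ᶠ s in atTop, G1 m Ψ₁ s ≤ g₁) → (∀ᶠ s in atTop, G1 m Ψ₂ s ≤ g₁) →
      (∀ᶠ s in atTop, G2 m Ψ₁ s ≤ g₂) → (∀ᶠ s in atTop, G2 m Ψ₂ s ≤ g₂) →
      (∀ᶠ s in atTop, D m Ψ₁ Ψ₂ s ≤ δ) →
      ∀ᶠ t in atTop, wNorm U m.W1 (2 - expA α) (gradPbar p₁ Ψ₁ p₂ Ψ₂ t) ^ 2 ≤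
        C * ((g ^ (2 / (2 - expA α)) + g₁ + g₂) ^ (3 * kappa α) * δ) ^ (1 / 2 : ℝ)
          + C * ((g ^ (2 / (2 - expA α)) + g₁) ^ kappa α * δ) := by
  obtain ⟨K, hK, hbound⟩ := exists_eventually_energy_dval_bound hα hcP
  have hconst := fluxConst_pos α
  have := hα.kappa_pos
  refine ⟨8 * fluxConst α * ((K ^ (3 * kappa α) * (16 * cP ^ 2 * fluxConst α)) ^ (1 / 2 : ℝ)
    + K ^ kappa α), by positivity, ?_⟩
  intro n U hU m p₁ Ψ₁ p₂ Ψ₂ hp g g₁ g₂ δ hg₁ hg₂ hδ hG hG' hG1 hG1' hG2 hG2' hD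
  have hev := hbound hU m p₁ Ψ₁ p₂ Ψ₂ hp g g₁ g₂ hg₁ hg₂ hG hG' hG1 hG1' hG2 hG2'
  have hγ : 1 ≤ g ^ (2 / (2 - expA α)) := by
    obtain ⟨s, hs⟩ := hG.exists
    have hg : 1 ≤ g := (one_le_G Ψ₁ s hα hU).trans hs
    exact hg.trans (hα.le_rpow_two_div hg)
  generalize g ^ (2 / (2 - expA α)) = γ at hγ hev ⊢
  filter_upwards [hp.eventually_wNorm_gradPbar_sq_le hα hU hcP (j := K * (γ + g₁))
    (x := K * (γ + g₁ + g₂)) (one_le_mul_of_one_le_of_one_le hK (by linarith))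
    (mul_le_mul_of_nonneg_left (le_add_of_nonneg_right hg₂) (by linarith)) hδ
    (hev.mono fun _ => And.left) (hev.mono fun _ => And.right) hD]
    with t ht
  have hK0 : 0 < K := zero_lt_one.trans_le hK
  refine ht.trans ?_
  calc 8 * fluxConst α * (((K * (γ + g₁ + g₂)) ^ (3 * kappa α)
          * (16 * cP ^ 2 * fluxConst α * δ)) ^ (1 / 2 : ℝ) + (K * (γ + g₁)) ^ kappa α * δ)
      = 8 * fluxConst α * ((K ^ (3 * kappa α) * (16 * cP ^ 2 * fluxConst α)) ^ (1 / 2 : ℝ)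
          * ((γ + g₁ + g₂) ^ (3 * kappa α) * δ) ^ (1 / 2 : ℝ)
          + K ^ kappa α * ((γ + g₁) ^ kappa α * δ)) := by
        rw [← Real.mul_rpow (by positivity) (by positivity),
          Real.mul_rpow hK0.le (by positivity), Real.mul_rpow hK0.le (by positivity)]
        ring_nf
    _ ≤ _ := by
        rw [← mul_add, mul_assoc (8 * fluxConst α) (_ + _)]
        gcongr
        rw [add_mul, mul_add, mul_add]
        exact add_le_add (le_add_of_nonneg_right (by positivity))
          (le_add_of_nonneg_left (by positivity))

theorem eventually_le_toReal_add_of_limsupInfty_le {f : ℝ → ℝ} {a : ℝ≥0∞} (ha : a ≠ ⊤)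
    (hf : limsupInfty f ≤ a) {ε : ℝ} (hε : 0 < ε) : ∀ᶠ s in atTop, f s ≤ a.toReal + ε := by
  have hlt : limsupInfty f < ENNReal.ofReal (a.toReal + ε) := by
    refine hf.trans_lt ?_
    rw [ENNReal.ofReal_add ENNReal.toReal_nonneg hε.le, ENNReal.ofReal_toReal ha]
    exact ENNReal.lt_add_right ha (ENNReal.ofReal_pos.2 hε).ne'
  filter_upwards [eventually_lt_of_limsup_lt hlt] with s hs
  exact (ENNReal.ofReal_lt_ofReal_iff'.1 hs).1.le

theorem limsupInfty_le_of_eventually_le {f : ℝ → ℝ} {F : ℝ → ℝ} (hF : Continuous F)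
    (hle : ∀ ε, 0 < ε → ∀ᶠ t in atTop, f t ≤ F ε) : limsupInfty f ≤ ENNReal.ofReal (F 0) := by
  have hlim : Tendsto (fun ε => ENNReal.ofReal (F ε)) (𝓝[>] 0) (𝓝 (ENNReal.ofReal (F 0))) :=
    ((ENNReal.continuous_ofReal.comp hF).tendsto 0).mono_left nhdsWithin_le_nhds
  refine ge_of_tendsto hlim ?_
  filter_upwards [self_mem_nhdsWithin] with ε hε
  refine limsup_le_of_le (by isBoundedDefault) ?_
  filter_upwards [hle ε hε] with t ht
  exact ENNReal.ofReal_le_ofReal ht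

theorem one_le_limsupInfty_G (hα : IsForchExponents α) (hU : MeasurableSet U)
    (Ψ : RegularPath m) : 1 ≤ limsupInfty (G m Ψ) := by
  refine le_limsup_of_frequently_le (Eventually.frequently (Eventually.of_forall fun s => ?_))
  exact ENNReal.one_le_ofReal.2 (one_le_G Ψ s hα hU)

/-- The right-hand side of the limit estimate, as a function of bounds `A`, `B₁`, `B₂`, `δ` for
the limits superior of `G`, `G1`, `G2`, `D`. -/
noncomputable def limitBound (C q κ : ℝ) (A B₁ B₂ δ : ℝ≥0∞) : ℝ≥0∞ :=
  ENNReal.ofReal C * ((A ^ q + B₁ + B₂) ^ (3 * κ) * δ) ^ (1 / 2 : ℝ)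
    + ENNReal.ofReal C * ((A ^ q + B₁) ^ κ * δ)

theorem limitBound_eq_top {C q κ : ℝ} (hC : 0 < C) (hq : 0 < q) (hκ : 0 < κ)
    {A B₁ B₂ δ : ℝ≥0∞} (hA : A ≠ 0) (hδ : δ ≠ 0 ∨ (A ≠ ⊤ ∧ B₁ ≠ ⊤ ∧ B₂ ≠ ⊤))
    (htop : ¬(A ≠ ⊤ ∧ B₁ ≠ ⊤ ∧ B₂ ≠ ⊤ ∧ δ ≠ ⊤)) : limitBound C q κ A B₁ B₂ δ = ⊤ := by
  have hAq : A ^ q ≠ 0 := (ENNReal.rpow_eq_zero_iff_of_pos hq).not.2 hA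
  have hbase : (A ^ q + B₁ + B₂) ^ (3 * κ) ≠ 0 := by
    rw [Ne, ENNReal.rpow_eq_zero_iff_of_pos (by positivity)]
    simp only [add_eq_zero, hAq, false_and, not_false_eq_true]
  have hprod : (A ^ q + B₁ + B₂) ^ (3 * κ) * δ = ⊤ := by
    by_cases hδtop : δ = ⊤
    · rw [hδtop, ENNReal.mul_top hbase]
    · have hδ0 : δ ≠ 0 := hδ.resolve_right fun h => htop ⟨h.1, h.2.1, h.2.2, hδtop⟩
      have hsum : A ^ q + B₁ + B₂ = ⊤ := by
        by_contra hne
        simp only [ENNReal.add_eq_top, not_or, ENNReal.rpow_eq_top_iff_of_pos hq] at hne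
        exact htop ⟨hne.1.1, hne.1.2, hne.2, hδtop⟩
      rw [hsum, ENNReal.top_rpow_of_pos (by positivity), ENNReal.top_mul hδ0]
  rw [limitBound, hprod, ENNReal.top_rpow_of_pos one_half_pos,
    ENNReal.mul_top (ENNReal.ofReal_pos.2 hC).ne', top_add]

theorem limitBound_ofReal {C q κ A B₁ B₂ δ : ℝ} (hC : 0 ≤ C) (hq : 0 ≤ q) (hκ : 0 ≤ κ)
    (hA : 0 ≤ A) (hB₁ : 0 ≤ B₁) (hB₂ : 0 ≤ B₂) (hδ : 0 ≤ δ) :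
    limitBound C q κ (ENNReal.ofReal A) (ENNReal.ofReal B₁) (ENNReal.ofReal B₂)
        (ENNReal.ofReal δ) =
      ENNReal.ofReal (C * ((A ^ q + B₁ + B₂) ^ (3 * κ) * δ) ^ (1 / 2 : ℝ)
        + C * ((A ^ q + B₁) ^ κ * δ)) := by
  have hAq : 0 ≤ A ^ q := Real.rpow_nonneg hA q
  rw [limitBound, ENNReal.ofReal_rpow_of_nonneg hA hq, ← ENNReal.ofReal_add hAq hB₁,
    ← ENNReal.ofReal_add (by positivity) hB₂,
    ENNReal.ofReal_rpow_of_nonneg (by positivity) (by positivity),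
    ENNReal.ofReal_rpow_of_nonneg (by positivity) hκ, ← ENNReal.ofReal_mul (by positivity),
    ENNReal.ofReal_rpow_of_nonneg (by positivity) one_half_pos.le, ← ENNReal.ofReal_mul hC,
    ← ENNReal.ofReal_mul (by positivity), ← ENNReal.ofReal_mul hC,
    ← ENNReal.ofReal_add (by positivity) (by positivity)]

theorem continuous_limitBound_shift {C q κ A B₁ B₂ δ : ℝ} (hq : 0 ≤ q) (hκ : 0 ≤ κ) :
    Continuous fun ε : ℝ =>
      C * (((A + ε) ^ q + (B₁ + ε) + (B₂ + ε)) ^ (3 * κ) * (δ + ε)) ^ (1 / 2 : ℝ)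
        + C * (((A + ε) ^ q + (B₁ + ε)) ^ κ * (δ + ε)) := by
  have hrpow {u : ℝ → ℝ} {e : ℝ} (he : 0 ≤ e) (hu : Continuous u) :
      Continuous fun ε => u ε ^ e := (Real.continuous_rpow_const he).comp hu
  have : Continuous fun ε : ℝ => (A + ε) ^ q := hrpow hq (by fun_prop)
  have : Continuous fun ε : ℝ => ((A + ε) ^ q + (B₁ + ε)) ^ κ := hrpow hκ (by fun_prop)
  have : Continuous fun ε : ℝ => ((A + ε) ^ q + (B₁ + ε) + (B₂ + ε)) ^ (3 * κ) :=
    hrpow (by positivity) (by fun_prop)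
  exact (continuous_const.mul (hrpow one_half_pos.le (by fun_prop))).add (by fun_prop)

theorem exists_limsupInfty_gradient_estimate (hα : IsForchExponents α) {cP : ℝ}
    (hcP : 0 < cP) :
    ∃ C : ℝ, 0 < C ∧
      ∀ {n : ℕ} {U : Set (EuclideanSpace ℝ (Fin n))}, MeasurableSet U →
      ∀ (m : Medium U α) (p₁ Ψ₁ p₂ Ψ₂ : RegularPath m), IsPoincarePair m cP p₁ Ψ₁ p₂ Ψ₂ →
      ∀ A B₁ B₂ : ℝ≥0∞, A = limsupInfty (G m Ψ₁) + limsupInfty (G m Ψ₂) →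
      B₁ = limsupInfty (G1 m Ψ₁) + limsupInfty (G1 m Ψ₂) →
      B₂ = limsupInfty (G2 m Ψ₁) + limsupInfty (G2 m Ψ₂) →
      (limsupInfty (D m Ψ₁ Ψ₂) ≠ 0 ∨ (A ≠ ⊤ ∧ B₁ ≠ ⊤ ∧ B₂ ≠ ⊤)) →
      limsupInfty (fun t => wNorm U m.W1 (2 - expA α) (gradPbar p₁ Ψ₁ p₂ Ψ₂ t) ^ 2) ≤
        limitBound C (2 / (2 - expA α)) (kappa α) A B₁ B₂ (limsupInfty (D m Ψ₁ Ψ₂)) := by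
  obtain ⟨C, hC, hmain⟩ := exists_eventually_gradient_estimate hα hcP
  refine ⟨C, hC, ?_⟩
  intro n U hU m p₁ Ψ₁ p₂ Ψ₂ hp A B₁ B₂ hA hB₁ hB₂ hδ
  have hq : 0 < 2 / (2 - expA α) := div_pos two_pos (by linarith [hα.expA_lt_one])
  have hκ := hα.kappa_pos
  have hA0 : A ≠ 0 := by
    rw [hA]
    exact (zero_lt_one.trans_le ((one_le_limsupInfty_G hα hU Ψ₁).trans le_self_add)).ne'
  by_cases hfin : A ≠ ⊤ ∧ B₁ ≠ ⊤ ∧ B₂ ≠ ⊤ ∧ limsupInfty (D m Ψ₁ Ψ₂) ≠ ⊤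
  · obtain ⟨hAt, hB₁t, hB₂t, hDt⟩ := hfin
    rw [← ENNReal.ofReal_toReal hAt, ← ENNReal.ofReal_toReal hB₁t, ← ENNReal.ofReal_toReal hB₂t,
      ← ENNReal.ofReal_toReal hDt, limitBound_ofReal hC.le hq.le hκ.le ENNReal.toReal_nonneg
        ENNReal.toReal_nonneg ENNReal.toReal_nonneg ENNReal.toReal_nonneg]
    have hcont := continuous_limitBound_shift (C := C) (A := A.toReal) (B₁ := B₁.toReal)
      (B₂ := B₂.toReal) (δ := (limsupInfty (D m Ψ₁ Ψ₂)).toReal) hq.le hκ.le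
    refine (limsupInfty_le_of_eventually_le hcont fun ε hε => ?_).trans_eq
      (by simp only [add_zero])
    exact hmain hU m p₁ Ψ₁ p₂ Ψ₂ hp _ _ _ _ (by positivity) (by positivity) (by positivity)
      (eventually_le_toReal_add_of_limsupInfty_le hAt (hA ▸ le_self_add) hε)
      (eventually_le_toReal_add_of_limsupInfty_le hAt (hA ▸ le_add_self) hε)
      (eventually_le_toReal_add_of_limsupInfty_le hB₁t (hB₁ ▸ le_self_add) hε)
      (eventually_le_toReal_add_of_limsupInfty_le hB₁t (hB₁ ▸ le_add_self) hε)
      (eventually_le_toReal_add_of_limsupInfty_le hB₂t (hB₂ ▸ le_self_add) hε)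
      (eventually_le_toReal_add_of_limsupInfty_le hB₂t (hB₂ ▸ le_add_self) hε)
      (eventually_le_toReal_add_of_limsupInfty_le hDt le_rfl hε)
  · rw [limitBound_eq_top hC hq hκ hA0 hδ hfin]
    exact le_top

end Forchheimer

theorem mainTheorem6_general {N : ℕ} {α : Fin (N + 1) → ℝ} (hα : IsForchExponents α)
    {cP : ℝ} (hcP : 0 < cP) :
    ∃ C d₄ : ℝ, 0 < C ∧ 0 < d₄ ∧
      ∀ {n : ℕ} {U : Set (EuclideanSpace ℝ (Fin n))}, MeasurableSet U →
      ∀ (m : Medium U α) (p₁ p₂ Ψ₁ Ψ₂ : RegularPath m),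
        IsSolution m p₁ Ψ₁ → IsSolution m p₂ Ψ₂ →
        ContinuousOn (G1 m Ψ₁) (Ici 0) → ContinuousOn (G1 m Ψ₂) (Ici 0) →
        ContinuousOn (G2 m Ψ₁) (Ici 0) → ContinuousOn (G2 m Ψ₂) (Ici 0) →
        (∀ t, 0 < t →
          PoincareSobolev m cP (p₁.val t - Ψ₁.val t) (p₁.grad t - Ψ₁.grad t) ∧
          PoincareSobolev m cP (p₂.val t - Ψ₂.val t) (p₂.grad t - Ψ₂.grad t) ∧
          PoincareSobolev m cP (Pbar p₁ Ψ₁ p₂ Ψ₂ t) (gradPbar p₁ Ψ₁ p₂ Ψ₂ t)) →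
        (∀ M₁ M₂ : ℝ → ℝ, IsMajorant M₁ (G m Ψ₁) → IsMajorant M₂ (G m Ψ₂) →
          ∀ t₀ ∈ Ioc (0 : ℝ) 1, ∀ t, t₀ ≤ t →
            wNorm U m.W1 (2 - expA α) (gradPbar p₁ Ψ₁ p₂ Ψ₂ t) ^ 2 ≤
              C * calM2 m p₁ Ψ₁ p₂ Ψ₂ M₁ M₂ t₀ t ^ kappa α *
                (Real.exp (-d₄ * ∫ τ in (0 : ℝ)..t,
                      calM1 m p₁ Ψ₁ p₂ Ψ₂ M₁ M₂ τ ^ (-(expA α / (2 - expA α)))) *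
                    wNorm U m.phi 2 (Pbar p₁ Ψ₁ p₂ Ψ₂ 0) ^ 2
                  + D m Ψ₁ Ψ₂ t ^ 2
                  + (∫ s in (0 : ℝ)..t,
                      Real.exp (-d₄ * ∫ τ in s..t,
                        calM1 m p₁ Ψ₁ p₂ Ψ₂ M₁ M₂ τ ^ (-(expA α / (2 - expA α)))) *
                      calM1 m p₁ Ψ₁ p₂ Ψ₂ M₁ M₂ s ^ (1 / 2 : ℝ) * D m Ψ₁ Ψ₂ s)) ^ (1 / 2 : ℝ)) ∧
        (∀ (A 𝒢₁ 𝒢₂ 𝒟 : ℝ≥0∞),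
          A = limsupInfty (G m Ψ₁) + limsupInfty (G m Ψ₂) →
          𝒢₁ = limsupInfty (G1 m Ψ₁) + limsupInfty (G1 m Ψ₂) →
          𝒢₂ = limsupInfty (G2 m Ψ₁) + limsupInfty (G2 m Ψ₂) →
          𝒟 = limsupInfty (D m Ψ₁ Ψ₂) →
          (𝒟 ≠ 0 ∨ (A ≠ ⊤ ∧ 𝒢₁ ≠ ⊤ ∧ 𝒢₂ ≠ ⊤)) →
          limsupInfty (fun t =>
              wNorm U m.W1 (2 - expA α) (gradPbar p₁ Ψ₁ p₂ Ψ₂ t) ^ 2) ≤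
            ENNReal.ofReal C *
                ((A ^ (2 / (2 - expA α)) + 𝒢₁ + 𝒢₂) ^ (3 * kappa α) * 𝒟) ^ (1 / 2 : ℝ)
              + ENNReal.ofReal C *
                ((A ^ (2 / (2 - expA α)) + 𝒢₁) ^ kappa α * 𝒟)) := by
  obtain ⟨C₁, d₄, hC₁, hd₄, hestimate⟩ := exists_gradient_estimate hα hcP
  obtain ⟨C₂, -, hlimit⟩ := exists_limsupInfty_gradient_estimate hα hcP
  refine ⟨max C₁ C₂, d₄, lt_max_of_lt_left hC₁, hd₄, ?_⟩
  intro n U hU m p₁ p₂ Ψ₁ Ψ₂ hs₁ hs₂ hG1₁ hG1₂ hG2₁ hG2₂ hP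
  have hp : IsPoincarePair m cP p₁ Ψ₁ p₂ Ψ₂ :=
    ⟨⟨hs₁, fun t ht => (hP t ht).1⟩, ⟨hs₂, fun t ht => (hP t ht).2.1⟩,
      fun t ht => (hP t ht).2.2⟩
  constructor
  · intro M₁ M₂ hM₁ hM₂ t₀ ht₀ t ht
    have hle := hestimate hU m p₁ Ψ₁ p₂ Ψ₂ hp hG1₁ hG1₂ hG2₁ hG2₂ M₁ M₂ hM₁ hM₂ t₀ ht₀ t ht
    rw [mul_assoc]
    exact hle.trans (mul_le_mul_of_nonneg_right (le_max_left _ _)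
      (nonneg_of_mul_nonneg_right ((sq_nonneg _).trans hle) hC₁))
  · rintro A 𝒢₁ 𝒢₂ _ hA h𝒢₁ h𝒢₂ rfl hδ
    refine (hlimit hU m p₁ Ψ₁ p₂ Ψ₂ hp A 𝒢₁ 𝒢₂ hA h𝒢₁ h𝒢₂ hδ).trans ?_
    rw [limitBound]
    gcongr <;> exact le_max_right _ _

theorem mainTheorem6 {n : ℕ} (hn : 2 ≤ n) (U : Set (EuclideanSpace ℝ (Fin n)))
    (hU_open : IsOpen U) (hU_conn : IsConnected U) (hU_bdd : Bornology.IsBounded U)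
    {N : ℕ} (hN : 1 ≤ N) (α : Fin (N + 1) → ℝ) (hα0 : α 0 = 0) (hα : StrictMono α)
    (cP : ℝ) (hcP : 0 < cP) :
    ∃ C d₄ : ℝ, 0 < C ∧ 0 < d₄ ∧
      ∀ (m : Medium U α) (p₁ p₂ Ψ₁ Ψ₂ : RegularPath m),
        IsSolution m p₁ Ψ₁ → IsSolution m p₂ Ψ₂ →
        ContinuousOn (G m Ψ₁) (Ici 0) → ContinuousOn (G m Ψ₂) (Ici 0) →
        ContinuousOn (G1 m Ψ₁) (Ici 0) → ContinuousOn (G1 m Ψ₂) (Ici 0) →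
        ContinuousOn (G2 m Ψ₁) (Ici 0) → ContinuousOn (G2 m Ψ₂) (Ici 0) →
        (∀ t, 0 < t →
          PoincareSobolev m cP (p₁.val t - Ψ₁.val t) (p₁.grad t - Ψ₁.grad t) ∧
          PoincareSobolev m cP (p₂.val t - Ψ₂.val t) (p₂.grad t - Ψ₂.grad t) ∧
          PoincareSobolev m cP (Pbar p₁ Ψ₁ p₂ Ψ₂ t) (gradPbar p₁ Ψ₁ p₂ Ψ₂ t)) →
        (∀ M₁ M₂ : ℝ → ℝ, IsMajorant M₁ (G m Ψ₁) → IsMajorant M₂ (G m Ψ₂) →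
          ∀ t₀ ∈ Ioc (0 : ℝ) 1, ∀ t, t₀ ≤ t →
            wNorm U m.W1 (2 - expA α) (gradPbar p₁ Ψ₁ p₂ Ψ₂ t) ^ 2 ≤
              C * calM2 m p₁ Ψ₁ p₂ Ψ₂ M₁ M₂ t₀ t ^ kappa α *
                (Real.exp (-d₄ * ∫ τ in (0 : ℝ)..t,
                      calM1 m p₁ Ψ₁ p₂ Ψ₂ M₁ M₂ τ ^ (-(expA α / (2 - expA α)))) *
                    wNorm U m.phi 2 (Pbar p₁ Ψ₁ p₂ Ψ₂ 0) ^ 2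
                  + D m Ψ₁ Ψ₂ t ^ 2
                  + (∫ s in (0 : ℝ)..t,
                      Real.exp (-d₄ * ∫ τ in s..t,
                        calM1 m p₁ Ψ₁ p₂ Ψ₂ M₁ M₂ τ ^ (-(expA α / (2 - expA α)))) *
                      calM1 m p₁ Ψ₁ p₂ Ψ₂ M₁ M₂ s ^ (1 / 2 : ℝ) * D m Ψ₁ Ψ₂ s)) ^ (1 / 2 : ℝ)) ∧
        (∀ (A 𝒢₁ 𝒢₂ 𝒟 : ℝ≥0∞),
          A = limsupInfty (G m Ψ₁) + limsupInfty (G m Ψ₂) →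
          𝒢₁ = limsupInfty (G1 m Ψ₁) + limsupInfty (G1 m Ψ₂) →
          𝒢₂ = limsupInfty (G2 m Ψ₁) + limsupInfty (G2 m Ψ₂) →
          𝒟 = limsupInfty (D m Ψ₁ Ψ₂) →
          (𝒟 ≠ 0 ∨ (A ≠ ⊤ ∧ 𝒢₁ ≠ ⊤ ∧ 𝒢₂ ≠ ⊤)) →
          limsupInfty (fun t =>
              wNorm U m.W1 (2 - expA α) (gradPbar p₁ Ψ₁ p₂ Ψ₂ t) ^ 2) ≤
            ENNReal.ofReal C *
                ((A ^ (2 / (2 - expA α)) + 𝒢₁ + 𝒢₂) ^ (3 * kappa α) * 𝒟) ^ (1 / 2 : ℝ)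
              + ENNReal.ofReal C *
                ((A ^ (2 / (2 - expA α)) + 𝒢₁) ^ kappa α * 𝒟)) := by
  obtain ⟨C, d₄, hC, hd₄, h⟩ := mainTheorem6_general ⟨hN, hα0, hα⟩ hcP
  exact ⟨C, d₄, hC, hd₄, fun m p₁ p₂ Ψ₁ Ψ₂ hs₁ hs₂ _ _ =>
    h hU_open.measurableSet m p₁ p₂ Ψ₁ Ψ₂ hs₁ hs₂⟩
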